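/- **Setting.** Let $0\le c<1<d\le 2$, $\Omega=(c,d)$, $\Omega_0=\Omega\setminus\{1\}$, and let $a:[c,d]\to\mathbb R$ satisfy: (i) $a(1)=0$, $a>0$ on $[c,d]\setminus\{1\}$, and there are $x_1^*\in[c,1)$, $x_2^*\in(1,d]$ such that $a$ is decreasing on $(x_1^*,1)$, increasing on $(1,x_2^*)$, and $$\mu_{1}:=\sup_{[x_1^*,1)}\frac{(1-x)|a'(x)|}{a(x)}=\lim_{x\nearrow1}\frac{(1-x)|a'(x)|}{a(x)}>0,\qquad \mu_{2}:=\sup_{(1,x_2^*]}\frac{(x-1)|a'(x)|}{a(x)}=\lim_{x\searrow1}\frac{(x-1)|a'(x)|}{a(x)}>0;$$ (ii) $a\in C([c,d])\cap C^1([c,d]\setminus\{1\})$; (iii) $(\sqrt a)_x\notin L^\infty(\Omega)$, and $(\sqrt a)_x\neq 0$ a.e. with $1/(\sqrt a)_x\in L^\infty(\Omega)$. Let $\kappa_1,\kappa_2$ be defined by $\sup_{[c,1)}\frac{(1-x)|a'|}{a}=\kappa_1\mu_1$ and $\sup_{(1,d]}\frac{(x-1)|a'|}{a}=\kappa_2\mu_2$,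 and let $$C_a^2=4\max\Big\{\tfrac{(1-c)^{\mu_1}}{\min_{[c,x_1^*]}a},\ \tfrac{(1-x_1^*)^{\mu_1}}{a(x_1^*)},\ \tfrac{(d-1)^{\mu_2}}{\min_{[x_2^*,d]}a},\ \tfrac{(x_2^*-1)^{\mu_2}}{a(x_2^*)}\Big\}.$$ **Spaces.** Put $\|u\|_a^2=\int_\Omega (u^2+a u_x^2)\,dx$. Let $H^1_a(\Omega)$ and $H^1_{a,0}(\Omega)$ be the $\|\cdot\|_a$-closures of $C^\infty(\overline\Omega)$ and $C_c^\infty(\Omega)$. Let $W^1_a(\Omega)$ be the space of $u\in L^2(\Omega)$ whose distributional derivative $u_x$ satisfies $\int_\Omega a u_x^2\,dx<\infty$; the derivative is taken on $\Omega$ if $1/a\in L^1(\Omega)$ and on $\Omega_0$ otherwise. Elements of $W^1_a(\Omega)$ are continuous on $[c,d]\setminus\{1\}$. Put $W^1_{a,0}(\Omega)=\{u\in W^1_a(\Omega): u(c)=u(d)=0\}$, $W^2_a(\Omega)=\{u\in W^1_a(\Omega):au_x\in W^{1,2}(\Omega)\}$ and $H^2_a(\Omega)=\{u\in H^1_a(\Omega):au_x\in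 W^{1,2}(\Omega)\}$. Fix a linear space $V$ with $H^1_{a,0}(\Omega)\subseteq V\subseteq W^1_{a,0}(\Omega)$, and give $\mathcal H_a=V\times L^2(\Omega)$ the norm $\|(u,v)\|^2_{\mathcal H_a}=\int_\Omega v^2\,dx+\int_\Omega a u_x^2\,dx$. **Mild solutions.** Let $\mathcal A(u,v)=(v,(au_x)_x)$, where $D(\mathcal A)$ is the set of $(u,v)\in (W^2_a(\Omega)\cap V)\times V$ such that * if $1/a\in L^1(\Omega)$: $\lim_{x\nearrow1}u=\lim_{x\searrow1}u$ and $\lim_{x\nearrow1}au_x=\lim_{x\searrow1}au_x$ (finite limits); * if $1/a\notin L^1(\Omega)$: $\lim_{x\nearrow1}a\varphi_xu=0=\lim_{x\searrow1}a\varphi_xu$ for all $\varphi\in H^2_a(\Omega)$, and $\lim_{x\nearrow1}au_x=0=\lim_{x\searrow1}au_x$. Let $e^{\mathcal At}$, $t\ge0$, be the strongly continuous semigroup on $\mathcal H_a$ generated by $\mathcal A$. For $(y_0,y_1)\in\mathcal H_a$ the mild solution $y$ of $$y_{tt}-(ay_x)_x=0\ \text{ in }\Omega_0,\qquad y(t,c)=y(t,d)=0,\qquad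 y(0)=y_0,\quad y_t(0)=y_1,$$ with the corresponding transmission conditions at $x=1$, is given by $(y(t),y_t(t))=e^{\mathcal At}(y_0,y_1)$. Let $E_y(t)=\frac12\int_{\Omega_0}(y_t^2+ay_x^2)\,dx$. If $(y_0,y_1)\in D(\mathcal A)$, then $y_x(t,c)$ and $y_x(t,d)$ are defined for every $t\ge0$. For general data $y_x(\cdot,c)$ and $y_x(\cdot,d)$ denote the limits in $L^2(0,T)$ of the normal derivatives of the solutions with data $(y_0^k,y_1^k)\in D(\mathcal A)$, for any sequence $(y_0^k,y_1^k)\to(y_0,y_1)$ in $\mathcal H_a$. **Lemma.** Let $y$ be a mild solution. Then, for every $T>0$, data in $D(\mathcal A)$ approximating $(y_0,y_1)$ exist, the limits $y_x(\cdot,c)$ and $y_x(\cdot,d)$ exist in $L^2(0,T)$ and do not depend on the approximating sequence, and $$a(c)\int_0^T y_x^2(t,c)\,dt\le\frac1{1-c}\Big[\max\{4,C_a^2\}+2T+2T\max_{i=1,2}\kappa_i\mu_i\Big]E_y(0),$$ $$a(d)\int_0^T y_x^2(t,d)\,dt\le\frac1{d-1}\Big[\max\{4,C_a^2\}+2T+2T\max_{i=1,2}\kappa_i\mu_i\Big]E_y(0).$$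 Moreover, $$(1-c)a(c)\int_0^Ty_x^2(t,c)\,dt+(d-1)a(d)\int_0^Ty_x^2(t,d)\,dt=2\int_{\Omega_0}\big[(x-1)y_x(t,x)y_t(t,x)\big]_{t=0}^{t=T}dx+\int_0^T\!\!\int_{\Omega_0}\Big(y_t^2+\Big[1-\frac{(x-1)a'(x)}{a(x)}\Big]a(x)\,y_x^2\Big)dx\,dt.$$ -/

import Mathlib

open Set Filter Topology MeasureTheory

open scoped ContDiff

noncomputable section

namespace DegenerateWave

/-- The punctured interval `Ω₀ = (c,d) ∖ {1}`. -/
def Omega0 (c d : ℝ) : Set ℝ := Ioo c d \ {1}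

/-- The Lebesgue space `L²(Ω)`, `Ω = (c,d)`. -/
abbrev L2 (c d : ℝ) : Type := Lp ℝ 2 (volume.restrict (Ioo c d))

/-- `g` is the distributional derivative of `u` on the open set `s`. -/
def HasWeakDerivOn (s : Set ℝ) (u g : ℝ → ℝ) : Prop :=
  LocallyIntegrableOn u s ∧ LocallyIntegrableOn g s ∧
    ∀ φ : ℝ → ℝ, ContDiff ℝ ∞ φ → HasCompactSupport φ → tsupport φ ⊆ s →
      ∫ x in s, u x * deriv φ x = -∫ x in s, g x * φ x

open Classical in
/-- `u_x`: the distributional derivative of `u` on `Ω₀` (unique up to null sets; `0` if there is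
none). -/
def wderiv (c d : ℝ) (u : ℝ → ℝ) : ℝ → ℝ :=
  if h : ∃ g, HasWeakDerivOn (Omega0 c d) u g then h.choose else 0

open Classical in
/-- The representative of the a.e. class of `f` that is continuous on `[c,d] ∖ {1}`
(unique there; `0` if there is none).  It gives a meaning to the values at `c` and `d` and to the
one-sided limits at `1`. -/
def crep (c d : ℝ) (f : ℝ → ℝ) : ℝ → ℝ :=
  if h : ∃ q : ℝ → ℝ, ContinuousOn q (Icc c d \ {1}) ∧ f =ᵐ[volume.restrict (Ioo c d)] q then
    h.choose else 0

/-! ### The weight -/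

/-- The derivative `a'` on `[c,d] ∖ {1}` (one-sided at `c` and `d`). -/
def wt' (a : ℝ → ℝ) (c d : ℝ) : ℝ → ℝ := derivWithin a (Icc c d)

/-- `μ₁ = sup_{[x₁,1)} (1-x)|a'|/a`. -/
def mu1 (a : ℝ → ℝ) (c d x₁ : ℝ) : ℝ :=
  sSup ((fun x => (1 - x) * |wt' a c d x| / a x) '' Ico x₁ 1)

/-- `μ₂ = sup_{(1,x₂]} (x-1)|a'|/a`. -/
def mu2 (a : ℝ → ℝ) (c d x₂ : ℝ) : ℝ :=
  sSup ((fun x => (x - 1) * |wt' a c d x| / a x) '' Ioc 1 x₂)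

/-- `κ₁`, determined by `sup_{[c,1)} (1-x)|a'|/a = κ₁ μ₁`. -/
def kappa1 (a : ℝ → ℝ) (c d x₁ : ℝ) : ℝ :=
  sSup ((fun x => (1 - x) * |wt' a c d x| / a x) '' Ico c 1) / mu1 a c d x₁

/-- `κ₂`, determined by `sup_{(1,d]} (x-1)|a'|/a = κ₂ μ₂`. -/
def kappa2 (a : ℝ → ℝ) (c d x₂ : ℝ) : ℝ :=
  sSup ((fun x => (x - 1) * |wt' a c d x| / a x) '' Ioc 1 d) / mu2 a c d x₂

/-- The standing assumptions on the interval and on the weight `a`, with the points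
`x₁ ∈ [c,1)`, `x₂ ∈ (1,d]` bounding the one-sided neighbourhoods of `1` in which `a` is
monotone. -/
structure IsWeight (a : ℝ → ℝ) (c d x₁ x₂ : ℝ) : Prop where
  c_nonneg : 0 ≤ c
  c_lt : c < 1
  lt_d : 1 < d
  d_le : d ≤ 2
  x₁_mem : x₁ ∈ Ico c 1
  x₂_mem : x₂ ∈ Ioc 1 d
  zero : a 1 = 0
  pos : ∀ x ∈ Icc c d \ {1}, 0 < a x
  anti : AntitoneOn a (Ioo x₁ 1)
  mono : MonotoneOn a (Ioo 1 x₂)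
  /-- the supremum on the left is attained as the limit at `1` -/
  lim_left : Tendsto (fun x => (1 - x) * |wt' a c d x| / a x) (𝓝[<] 1) (𝓝 (mu1 a c d x₁))
  mu1_pos : 0 < mu1 a c d x₁
  /-- the supremum on the right is attained as the limit at `1` -/
  lim_right : Tendsto (fun x => (x - 1) * |wt' a c d x| / a x) (𝓝[>] 1) (𝓝 (mu2 a c d x₂))
  mu2_pos : 0 < mu2 a c d x₂
  cont : ContinuousOn a (Icc c d)
  smooth : ContDiffOn ℝ 1 a (Icc c d \ {1})
  /-- `(√a)_x ∉ L^∞(Ω)` -/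
  sqrt_not_bdd : ¬ MemLp (deriv fun x => √(a x)) ⊤ (volume.restrict (Ioo c d))
  /-- `1 / (√a)_x ∈ L^∞(Ω)`; in particular `(√a)_x ≠ 0` almost everywhere -/
  sqrt_inv_bdd : (∀ᵐ x ∂(volume.restrict (Ioo c d)), deriv (fun z => √(a z)) x ≠ 0) ∧
    MemLp (fun x => (deriv (fun z => √(a z)) x)⁻¹) ⊤ (volume.restrict (Ioo c d))

/-- Weak degeneration: `1/a ∈ L¹(Ω)`. -/
def WeakDegeneration (a : ℝ → ℝ) (c d : ℝ) : Prop :=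
  IntegrableOn (fun x => 1 / a x) (Ioo c d)

/-- The constant `C_a²`. -/
def CaSq (a : ℝ → ℝ) (c d x₁ x₂ : ℝ) : ℝ :=
  4 * max
    (max ((1 - c) ^ mu1 a c d x₁ / sInf (a '' Icc c x₁)) ((1 - x₁) ^ mu1 a c d x₁ / a x₁))
    (max ((d - 1) ^ mu2 a c d x₂ / sInf (a '' Icc x₂ d)) ((x₂ - 1) ^ mu2 a c d x₂ / a x₂))

/-! ### Function spaces -/

/-- `u ∈ H¹_a(Ω)`: the closure of `C^∞(Ω̄)` for `‖u‖_a² = ∫ u² + a u_x²`. -/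
def MemH1a (a : ℝ → ℝ) (c d : ℝ) (u : L2 c d) : Prop :=
  ∃ g, HasWeakDerivOn (Omega0 c d) u g ∧ IntegrableOn (fun x => a x * g x ^ 2) (Ioo c d) ∧
    ∃ φ : ℕ → ℝ → ℝ, (∀ n, ContDiff ℝ ∞ (φ n)) ∧
      Tendsto (fun n => ∫ x in Ioo c d, ((u x - φ n x) ^ 2 + a x * (g x - deriv (φ n) x) ^ 2))
        atTop (𝓝 0)

/-- `u ∈ H¹_{a,0}(Ω)`: the closure of `C_c^∞(Ω)` for `‖·‖_a`. -/
def MemH1a0 (a : ℝ → ℝ) (c d : ℝ) (u : L2 c d) : Prop :=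
  ∃ g, HasWeakDerivOn (Omega0 c d) u g ∧ IntegrableOn (fun x => a x * g x ^ 2) (Ioo c d) ∧
    ∃ φ : ℕ → ℝ → ℝ, (∀ n, ContDiff ℝ ∞ (φ n) ∧ HasCompactSupport (φ n) ∧
        tsupport (φ n) ⊆ Ioo c d) ∧
      Tendsto (fun n => ∫ x in Ioo c d, ((u x - φ n x) ^ 2 + a x * (g x - deriv (φ n) x) ^ 2))
        atTop (𝓝 0)

/-- `u ∈ W¹_a(Ω)`: `u ∈ L²(Ω)` has a distributional derivative `u_x ∈ L²(Ω, a dx)`.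
If `1/a ∈ L¹(Ω)` (so that `L²(Ω, a dx) ⊆ L¹(Ω)`) this is the derivative on all of `Ω`;
otherwise it is the derivative on `Ω₀`, since then the elements of `H¹_a(Ω)` need not have an
integrable derivative across the point `1`. -/
def MemW1a (a : ℝ → ℝ) (c d : ℝ) (u : L2 c d) : Prop :=
  ∃ g, HasWeakDerivOn (Omega0 c d) u g ∧ IntegrableOn (fun x => a x * g x ^ 2) (Ioo c d) ∧
    (WeakDegeneration a c d → HasWeakDerivOn (Ioo c d) u g)

/-- `u ∈ W¹_{a,0}(Ω)`: in addition `u(c) = u(d) = 0`. -/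
def MemW1a0 (a : ℝ → ℝ) (c d : ℝ) (u : L2 c d) : Prop :=
  MemW1a a c d u ∧ crep c d u c = 0 ∧ crep c d u d = 0

/-- `f ∈ W^{1,2}(Ω)`. -/
def MemW12 (c d : ℝ) (f : ℝ → ℝ) : Prop :=
  MemLp f 2 (volume.restrict (Ioo c d)) ∧
    ∃ g, MemLp g 2 (volume.restrict (Ioo c d)) ∧ HasWeakDerivOn (Ioo c d) f g

/-- The flux `a u_x`. -/
def flux (a : ℝ → ℝ) (c d : ℝ) (u : ℝ → ℝ) : ℝ → ℝ := fun x => a x * wderiv c d u x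

/-- `u ∈ W²_a(Ω)`: `u ∈ W¹_a(Ω)` and `a u_x ∈ W^{1,2}(Ω)`. -/
def MemW2a (a : ℝ → ℝ) (c d : ℝ) (u : L2 c d) : Prop :=
  MemW1a a c d u ∧ MemW12 c d (flux a c d u)

/-- `u ∈ H²_a(Ω)`: `u ∈ H¹_a(Ω)` and `a u_x ∈ W^{1,2}(Ω)`. -/
def MemH2a (a : ℝ → ℝ) (c d : ℝ) (u : L2 c d) : Prop :=
  MemH1a a c d u ∧ MemW12 c d (flux a c d u)

/-! ### The wave operator and its semigroup -/

/-- The norm of `[u; v]` in `𝓗_a = V × L²(Ω)`. -/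
def haNorm (a : ℝ → ℝ) (c d : ℝ) (u v : L2 c d) : ℝ :=
  √((∫ x in Omega0 c d, v x ^ 2) + ∫ x in Omega0 c d, a x * wderiv c d u x ^ 2)

/-- The energy `½ ∫_{Ω₀} (v² + a u_x²)` of the state `[u; v]`. -/
def energy (a : ℝ → ℝ) (c d : ℝ) (u v : L2 c d) : ℝ :=
  1 / 2 * ∫ x in Omega0 c d, (v x ^ 2 + a x * wderiv c d u x ^ 2)

variable {c d : ℝ}

/-- `[u; v]` satisfies the transmission conditions at `1`. -/
def Transmission (a : ℝ → ℝ) (u : L2 c d) : Prop :=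
  (WeakDegeneration a c d →
    (∃ l, Tendsto (crep c d u) (𝓝[<] 1) (𝓝 l) ∧ Tendsto (crep c d u) (𝓝[>] 1) (𝓝 l)) ∧
    (∃ l, Tendsto (crep c d (flux a c d u)) (𝓝[<] 1) (𝓝 l) ∧
      Tendsto (crep c d (flux a c d u)) (𝓝[>] 1) (𝓝 l))) ∧
  (¬ WeakDegeneration a c d →
    (∀ φ : L2 c d, MemH2a a c d φ →
      Tendsto (fun x => crep c d (flux a c d φ) x * crep c d u x) (𝓝[<] 1) (𝓝 0) ∧
      Tendsto (fun x => crep c d (flux a c d φ) x * crep c d u x) (𝓝[>] 1) (𝓝 0)) ∧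
    Tendsto (crep c d (flux a c d u)) (𝓝[<] 1) (𝓝 0) ∧
    Tendsto (crep c d (flux a c d u)) (𝓝[>] 1) (𝓝 0))

/-- `U = [u; v]` belongs to the domain `D(𝓐) ⊆ V × L²(Ω)`. -/
def InDomain (a : ℝ → ℝ) (V : Submodule ℝ (L2 c d)) (U : V × L2 c d) : Prop :=
  MemW2a a c d U.1 ∧ U.2 ∈ V ∧ Transmission a (U.1 : L2 c d)

/-- `U = [u; v] ∈ D(𝓐)` and `𝓐 U = [v; (a u_x)_x] = F`. -/
def IsA (a : ℝ → ℝ) (V : Submodule ℝ (L2 c d)) (U F : V × L2 c d) : Prop :=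
  InDomain a V U ∧ (F.1 : L2 c d) = U.2 ∧
    HasWeakDerivOn (Ioo c d) (flux a c d (U.1 : L2 c d)) F.2

/-- `S` is the strongly continuous semigroup `e^{𝓐t}` (`t ≥ 0`) of bounded operators on
`𝓗_a = V × L²(Ω)` whose infinitesimal generator is `𝓐`. -/
structure IsSemigroupOf (a : ℝ → ℝ) (V : Submodule ℝ (L2 c d))
    (S : ℝ → (V × L2 c d) →ₗ[ℝ] (V × L2 c d)) : Prop where
  zero : S 0 = LinearMap.id
  add : ∀ s t, 0 ≤ s → 0 ≤ t → S (s + t) = S s ∘ₗ S t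
  bounded : ∀ t, 0 ≤ t → ∃ M : ℝ, ∀ U,
    haNorm a c d (S t U).1 (S t U).2 ≤ M * haNorm a c d U.1 U.2
  cont : ∀ U, ∀ t₀, 0 ≤ t₀ →
    Tendsto (fun t => haNorm a c d (S t U - S t₀ U).1 (S t U - S t₀ U).2) (𝓝[Ici 0] t₀)
      (𝓝 0)
  generator : ∀ U F, IsA a V U F ↔
    Tendsto (fun h : ℝ => haNorm a c d (h⁻¹ • (S h U - U) - F).1 (h⁻¹ • (S h U - U) - F).2)
      (𝓝[>] 0) (𝓝 0)

/-- `y`, with time derivative `yt` in `L²(Ω)`, is the mild solution with initial state `U₀`: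
`[y(t); yt(t)] = e^{𝓐t} U₀` for all `t ≥ 0`. -/
def IsMildSolution (V : Submodule ℝ (L2 c d)) (S : ℝ → (V × L2 c d) →ₗ[ℝ] (V × L2 c d))
    (U₀ : V × L2 c d) (y : ℝ → V) (yt : ℝ → L2 c d) : Prop :=
  ∀ t, 0 ≤ t → (y t, yt t) = S t U₀ ∧
    HasDerivWithinAt (fun s => (y s : L2 c d)) (yt t) (Ici 0) t

/-- The value at `e ∈ {c, d}` of `u_x` for `u ∈ W²_a(Ω)`. -/
def normalDeriv (u : L2 c d) (e : ℝ) : ℝ := crep c d (wderiv c d u) e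

/-- `g = y_x(·,e)` on `(0,T)` (`e ∈ {c, d}`) for the mild solution with initial state `U₀`.
For a state in `D(𝓐)` the value `y_x(t,e)` is defined pointwise in `t`. In general, `y_x(·,e)` is
the `L²(0,T)`-limit of the normal derivatives of the classical solutions along any sequence of
initial states in `D(𝓐)` that converges to `U₀` in `𝓗_a`, and such sequences exist. -/
def IsBoundaryDeriv (a : ℝ → ℝ) (V : Submodule ℝ (L2 c d))
    (S : ℝ → (V × L2 c d) →ₗ[ℝ] (V × L2 c d)) (U₀ : V × L2 c d) (e T : ℝ) (g : ℝ → ℝ) : Prop :=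
  (∃ U : ℕ → V × L2 c d, (∀ k, InDomain a V (U k)) ∧
    Tendsto (fun k => haNorm a c d (U k - U₀).1 (U k - U₀).2) atTop (𝓝 0)) ∧
  ∀ U : ℕ → V × L2 c d, (∀ k, InDomain a V (U k)) →
    Tendsto (fun k => haNorm a c d (U k - U₀).1 (U k - U₀).2) atTop (𝓝 0) →
    (∀ k, MemLp (fun t => normalDeriv ((S t (U k)).1 : L2 c d) e) 2 (volume.restrict (Ioo 0 T))) ∧
    Tendsto (fun k => eLpNorm (fun t => normalDeriv ((S t (U k)).1 : L2 c d) e - g t) 2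
      (volume.restrict (Ioo 0 T))) atTop (𝓝 0)

end DegenerateWave

end

open DegenerateWave

noncomputable section

namespace DegenerateWave

/-! ### Limits in `L²_loc` and observed semigroups -/

/-! The map $(u,v)\mapsto(\sqrt a\,u_x,v)$ (`stateMap`) turns the energy norm into the norm of
$L^2\times L^2$. The evolution is then handled abstractly in `ObservedSemigroup`, and the weight
enters through three facts about the domain of $\mathcal A$ and one pointwise bound.

Skew symmetry (`IsWeight.skew`). The integrand $a u_xv_x+v(au_x)_x$ is the derivative of $v\,au_x$
on each side of $1$. The values at $c,d$ vanish. At $1$ the one-sided limits agree if $1/a\in L^1$,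
since both factors are continuous there. Otherwise both are $0$, because $au_x\to0$ at the rate
$|x-1|^{1/2}$ and $v\in L^2$. Hence the energy is conserved.

Multiplier identity (`IsWeight.multiplier`). For $\mathcal A(u,v)=(v,g)$ and $q=au_x$, integrate
$((x-1)v^2)_x$ and $(\frac{x-1}{a}q^2)_x$ over each side. The ends $c,d$ produce the normal
derivatives. The terms at $1$ vanish whatever the transmission conditions are: divided by $x-1$ the
primitives become $v^2$ and $au_x^2$, which are integrable, whereas a nonzero limit would leave the
non-integrable $1/(x-1)$. The terms containing $v_x$ and $g$ form the time derivative of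
$2\int(x-1)u_xv$ along the flow, so integration in time gives the stated identity for data in the
domain.

Bounds. By `IsWeight.sq_le`, $(x-1)^2\le\frac{C_a^2}{4}a$; this rests on $\mu_i\le2$, which follows
from $1/(\sqrt a)_x\in L^\infty$ (`rate_le_two`). With energy conservation the right side of the
identity is at most the stated constant times $E_y(0)$. Applied to differences of solutions, the
same bound makes the normal derivatives Cauchy in $L^2(0,T)$ and their limit independent of the
sequence (`ObservedSemigroup.exists_trace`).

Density (`IsWeight.dense_domain`). A vector orthogonal to all test states has second component $0$
and first component $C/\sqrt a$. It pairs with a state as $C\int u_x$, which is $0$ because either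
$u$ vanishes at both ends and is absolutely continuous, or $1/a\notin L^1$ forces $C=0$. -/

/-- Sequences that are Cauchy in `L²(0,T)` for all `T` have a common limit in `L²_loc`. -/
theorem exists_limit_of_cauchy_memLp (f : ℕ → ℝ → ℝ)
    (hf : ∀ T : ℝ, 0 < T → ∀ k, MemLp (f k) 2 (volume.restrict (Ioo 0 T)))
    (hc : ∀ T : ℝ, 0 < T → ∀ ε : ENNReal, 0 < ε → ∃ N, ∀ m, N ≤ m → ∀ n, N ≤ n →
      eLpNorm (f m - f n) 2 (volume.restrict (Ioo 0 T)) < ε) :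
    ∃ g : ℝ → ℝ, ∀ T : ℝ, 0 < T → MemLp g 2 (volume.restrict (Ioo 0 T)) ∧
      Tendsto (fun k => eLpNorm (f k - g) 2 (volume.restrict (Ioo 0 T))) atTop (𝓝 0) := by
  have h1 : ∀ T : ℝ, 0 < T → ∃ g : ℝ → ℝ, MemLp g 2 (volume.restrict (Ioo 0 T)) ∧
      Tendsto (fun k => eLpNorm (f k - g) 2 (volume.restrict (Ioo 0 T))) atTop (𝓝 0) := by
    intro T hT
    have hcs : CauchySeq (fun k => (hf T hT k).toLp (f k)) := by
      rw [EMetric.cauchySeq_iff]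
      intro ε hε
      obtain ⟨N, hN⟩ := hc T hT ε hε
      exact ⟨N, fun m hm n hn => by rw [Lp.edist_toLp_toLp]; exact hN m hm n hn⟩
    obtain ⟨G, hG⟩ := cauchySeq_tendsto_of_complete hcs
    refine ⟨G, Lp.memLp G, ?_⟩
    rw [tendsto_iff_edist_tendsto_0] at hG
    refine hG.congr fun k => ?_
    conv_lhs => rw [← Lp.toLp_coeFn G (Lp.memLp G)]
    rw [Lp.edist_toLp_toLp]
  have h2 : ∀ n : ℕ, ∃ g : ℝ → ℝ, MemLp g 2 (volume.restrict (Ioo 0 ((n : ℝ) + 1))) ∧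
      Tendsto (fun k => eLpNorm (f k - g) 2 (volume.restrict (Ioo 0 ((n : ℝ) + 1)))) atTop (𝓝 0) :=
    fun n => h1 _ (by positivity)
  choose G hG hGt using h2
  have huniq : ∀ m n : ℕ, m ≤ n → G m =ᵐ[volume.restrict (Ioo 0 ((m : ℝ) + 1))] G n := by
    intro m n hmn
    have hsub : Ioo (0 : ℝ) ((m : ℝ) + 1) ⊆ Ioo 0 ((n : ℝ) + 1) :=
      Ioo_subset_Ioo le_rfl (by have : (m : ℝ) ≤ n := by exact_mod_cast hmn
                                linarith)
    have hn := (hG n).mono_measure (Measure.restrict_mono hsub le_rfl)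
    have hlim : Tendsto (fun k => eLpNorm (f k - G m) 2 (volume.restrict (Ioo 0 ((m : ℝ) + 1))) +
        eLpNorm (f k - G n) 2 (volume.restrict (Ioo 0 ((n : ℝ) + 1)))) atTop (𝓝 0) := by
      simpa using (hGt m).add (hGt n)
    have hle : eLpNorm (G m - G n) 2 (volume.restrict (Ioo 0 ((m : ℝ) + 1))) ≤ 0 := by
      refine ge_of_tendsto' hlim fun k => ?_
      have hfk := hf ((m : ℝ) + 1) (by positivity) k
      have : G m - G n = (f k - G n) - (f k - G m) := by ext; simp
      rw [this]
      refine (eLpNorm_sub_le (hfk.sub hn).1 (hfk.sub (hG m)).1 (by norm_num)).trans ?_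
      rw [add_comm]
      gcongr
    have h0 := (eLpNorm_eq_zero_iff ((hG m).sub hn).1 (by norm_num)).1 (le_antisymm hle bot_le)
    filter_upwards [h0] with t ht
    have : G m t - G n t = 0 := ht
    linarith
  -- For $t>0$ the interval $(0,\lfloor t\rfloor+1)$ is the first of the family that contains $t$,
  -- so this diagonal choice agrees a.e. with every `G N` on $(0,N+1)$.
  let g : ℝ → ℝ := fun t => G ⌊t⌋₊ t
  have hg : ∀ N : ℕ, G N =ᵐ[volume.restrict (Ioo 0 ((N : ℝ) + 1))] g := by
    intro N
    have hall : ∀ m : ℕ, ∀ᵐ t ∂(volume : Measure ℝ), m ≤ N → t ∈ Ioo (0 : ℝ) ((m : ℝ) + 1) →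
        G m t = G N t := by
      intro m
      by_cases hm : m ≤ N
      · have := huniq m N hm
        rw [Filter.EventuallyEq, ae_restrict_iff' measurableSet_Ioo] at this
        filter_upwards [this] with t ht _ h
        exact ht h
      · exact Eventually.of_forall fun t h => absurd h hm
    rw [Filter.EventuallyEq, ae_restrict_iff' measurableSet_Ioo]
    filter_upwards [ae_all_iff.2 hall] with t ht htN
    refine (ht ⌊t⌋₊ ?_ ⟨htN.1, Nat.lt_floor_add_one t⟩).symm
    have : ⌊t⌋₊ < N + 1 := (Nat.floor_lt htN.1.le).2 (by exact_mod_cast htN.2)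
    omega
  refine ⟨g, fun T hT => ?_⟩
  obtain ⟨N, hN⟩ := exists_nat_gt T
  have hsub : Ioo (0 : ℝ) T ⊆ Ioo 0 ((N : ℝ) + 1) := Ioo_subset_Ioo le_rfl (by linarith)
  have hle : volume.restrict (Ioo (0 : ℝ) T) ≤ volume.restrict (Ioo 0 ((N : ℝ) + 1)) :=
    Measure.restrict_mono hsub le_rfl
  refine ⟨((memLp_congr_ae (hg N)).1 (hG N)).mono_measure hle, ?_⟩
  refine tendsto_of_tendsto_of_tendsto_of_le_of_le tendsto_const_nhds (hGt N)
    (fun _ => bot_le) fun k => ?_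
  refine (eLpNorm_mono_measure _ hle).trans_eq (eLpNorm_congr_ae ?_)
  filter_upwards [hg N] with t ht
  simp [ht]

theorem eLpNorm_two_sq_eq {g : ℝ → ℝ} {T : ℝ} (hT : 0 < T)
    (hg : MemLp g 2 (volume.restrict (Ioo 0 T))) :
    (eLpNorm g 2 (volume.restrict (Ioo 0 T))).toReal ^ 2 = ∫ t in (0 : ℝ)..T, g t ^ 2 := by
  rw [hg.eLpNorm_eq_integral_rpow_norm (by norm_num) (by norm_num),
    intervalIntegral.integral_of_le hT.le, integral_Ioc_eq_integral_Ioo]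
  have h0 : 0 ≤ ∫ t in Ioo (0 : ℝ) T, g t ^ 2 := integral_nonneg fun t => sq_nonneg _
  simp only [ENNReal.toReal_ofNat, Real.rpow_ofNat, Real.norm_eq_abs, sq_abs]
  rw [ENNReal.toReal_ofReal (by positivity), ← Real.rpow_natCast, ← Real.rpow_mul h0]
  norm_num

theorem tendsto_integral_sq {f : ℕ → ℝ → ℝ} {g : ℝ → ℝ} {T : ℝ} (hT : 0 < T)
    (hf : ∀ k, MemLp (f k) 2 (volume.restrict (Ioo 0 T)))
    (hg : MemLp g 2 (volume.restrict (Ioo 0 T)))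
    (h : Tendsto (fun k => eLpNorm (f k - g) 2 (volume.restrict (Ioo 0 T))) atTop (𝓝 0)) :
    Tendsto (fun k => ∫ t in (0 : ℝ)..T, f k t ^ 2) atTop (𝓝 (∫ t in (0 : ℝ)..T, g t ^ 2)) := by
  have h1 : Tendsto (fun k => (hf k).toLp (f k)) atTop (𝓝 (hg.toLp g)) := by
    rw [tendsto_iff_edist_tendsto_0]
    exact h.congr fun k => (Lp.edist_toLp_toLp _ _ _ _).symm
  have h2 := (h1.norm).pow 2
  simp only [Lp.norm_toLp] at h2
  rw [eLpNorm_two_sq_eq hT hg] at h2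
  exact h2.congr fun k => eLpNorm_two_sq_eq hT (hf k)

/-- A semigroup `S` that is strongly continuous for the seminorm `‖J ·‖`, with skew-symmetric
generator `IsA` of dense domain `D`, and with two boundary functionals `p`, `q` on `D` that obey a
multiplier identity. -/
structure ObservedSemigroup {E X : Type*} [AddCommGroup E] [Module ℝ E] [NormedAddCommGroup X]
    [InnerProductSpace ℝ X] (J : E →ₗ[ℝ] X) (S : ℝ → E →ₗ[ℝ] E) (IsA : E → E → Prop)
    (D : E → Prop) (p q : E → ℝ) (α β : ℝ) (B Q : X →L[ℝ] X →L[ℝ] ℝ) : Prop where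
  zero : S 0 = LinearMap.id
  add : ∀ s t, 0 ≤ s → 0 ≤ t → S (s + t) = S s ∘ₗ S t
  bounded : ∀ t, 0 ≤ t → ∃ M : ℝ, ∀ U, ‖J (S t U)‖ ≤ M * ‖J U‖
  cont : ∀ U, ContinuousOn (fun t => J (S t U)) (Ici 0)
  generator : ∀ U F, IsA U F ↔
    Tendsto (fun h : ℝ => h⁻¹ • (J (S h U) - J U)) (𝓝[>] 0) (𝓝 (J F))
  domain : ∀ U, D U ↔ ∃ F, IsA U F
  skew : ∀ U F, IsA U F → inner ℝ (J U) (J F) = 0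
  p_sub : ∀ U W, D U → D W → p (U - W) = p U - p W
  q_sub : ∀ U W, D U → D W → q (U - W) = q U - q W
  α_pos : 0 < α
  β_pos : 0 < β
  multiplier : ∀ U F, IsA U F →
    α * p U ^ 2 + β * q U ^ 2 = B (J F) (J U) + B (J U) (J F) + Q (J U) (J U)
  dense : ∀ U, ∃ u : ℕ → E, (∀ k, D (u k)) ∧ Tendsto (fun k => J (u k)) atTop (𝓝 (J U))

/-! ### Orbits of an observed semigroup: invariance of the domain and conservation of the norm -/

namespace ObservedSemigroup

variable {E X : Type*} [AddCommGroup E] [Module ℝ E] [NormedAddCommGroup X]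
    [InnerProductSpace ℝ X] {J : E →ₗ[ℝ] X} {S : ℝ → E →ₗ[ℝ] E} {IsA : E → E → Prop}
    {D : E → Prop} {p q : E → ℝ} {α β : ℝ} {B Q : X →L[ℝ] X →L[ℝ] ℝ}

/-- `S t` commutes with the difference quotients defining the generator and is bounded for the
seminorm `‖J ·‖`. -/
theorem isA_orbit (h : ObservedSemigroup J S IsA D p q α β B Q) {U F : E} (hU : IsA U F) {t : ℝ}
    (ht : 0 ≤ t) : IsA (S t U) (S t F) := by
  rw [h.generator] at hU ⊢
  obtain ⟨M, hM⟩ := h.bounded t ht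
  rw [tendsto_iff_norm_sub_tendsto_zero] at hU ⊢
  have hU' := hU.const_mul M
  rw [mul_zero] at hU'
  refine squeeze_zero' (Eventually.of_forall fun _ => norm_nonneg _) ?_ hU'
  filter_upwards [self_mem_nhdsWithin] with s hs
  have e1 : S s (S t U) = S t (S s U) := by
    rw [← LinearMap.comp_apply, ← LinearMap.comp_apply, ← h.add s t (le_of_lt hs) ht,
      ← h.add t s ht (le_of_lt hs), add_comm]
  have e2 : s⁻¹ • (J (S s (S t U)) - J (S t U)) - J (S t F) = J (S t (s⁻¹ • (S s U - U) - F)) := by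
    rw [e1]; simp
  have e3 : s⁻¹ • (J (S s U) - J U) - J F = J (s⁻¹ • (S s U - U) - F) := by simp
  rw [e2, e3]
  exact hM _

/-- The generator yields right derivatives only. They suffice, since the fundamental theorem of
calculus holds for continuous functions with an integrable right derivative. -/
theorem hasDerivWithinAt_orbit (h : ObservedSemigroup J S IsA D p q α β B Q) {U F : E}
    (hU : IsA U F) {t : ℝ} (ht : 0 ≤ t) :
    HasDerivWithinAt (fun s => J (S s U)) (J (S t F)) (Ioi t) t := by
  have hA := (h.generator _ _).1 (h.isA_orbit hU ht)
  rw [hasDerivWithinAt_iff_tendsto_slope' (by simp)]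
  have hmap : Tendsto (fun s : ℝ => s - t) (𝓝[>] t) (𝓝[>] 0) := by
    refine tendsto_nhdsWithin_iff.2 ⟨?_, ?_⟩
    · have : Tendsto (fun s : ℝ => s - t) (𝓝 t) (𝓝 (t - t)) := tendsto_id.sub_const t
      rw [sub_self] at this
      exact this.mono_left nhdsWithin_le_nhds
    · filter_upwards [self_mem_nhdsWithin] with s hs
      exact sub_pos.2 (mem_Ioi.1 hs)
  refine (hA.comp hmap).congr' ?_
  filter_upwards [self_mem_nhdsWithin] with s hs
  have hs' : t < s := hs
  have e1 : S (s - t) (S t U) = S s U := by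
    rw [← LinearMap.comp_apply, ← h.add _ _ (by linarith) ht, sub_add_cancel]
  simp [slope_def_module, e1]

/-- The squared norm is continuous in time and its right derivative is $2\langle
JS_tU,JS_tF\rangle=0$ by skew symmetry. -/
theorem norm_orbit_of_isA (h : ObservedSemigroup J S IsA D p q α β B Q) {U F : E}
    (hU : IsA U F) {t : ℝ} (ht : 0 ≤ t) : ‖J (S t U)‖ = ‖J U‖ := by
  have hd : ∀ s ∈ Ioo (0 : ℝ) t,
      HasDerivWithinAt (fun s => inner ℝ (J (S s U)) (J (S s U))) 0 (Ioi s) s := by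
    intro s hs
    have h1 := h.hasDerivWithinAt_orbit hU hs.1.le
    have h2 := h1.inner ℝ h1
    rw [h.skew _ _ (h.isA_orbit hU hs.1.le), real_inner_comm,
      h.skew _ _ (h.isA_orbit hU hs.1.le), add_zero] at h2
    exact h2
  have hc : ContinuousOn (fun s => inner ℝ (J (S s U)) (J (S s U))) (Icc 0 t) :=
    ((h.cont U).mono Icc_subset_Ici_self).inner ((h.cont U).mono Icc_subset_Ici_self)
  have := intervalIntegral.integral_eq_sub_of_hasDeriv_right_of_le ht hc hd
    (by simp)
  simp only [intervalIntegral.integral_zero, real_inner_self_eq_norm_sq, h.zero,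
    LinearMap.id_apply] at this
  rw [← sq_eq_sq₀ (norm_nonneg _) (norm_nonneg _)]
  linarith

theorem norm_orbit (h : ObservedSemigroup J S IsA D p q α β B Q) (U : E) {t : ℝ} (ht : 0 ≤ t) :
    ‖J (S t U)‖ = ‖J U‖ := by
  obtain ⟨u, huD, hu⟩ := h.dense U
  obtain ⟨M, hM⟩ := h.bounded t ht
  have h1 : Tendsto (fun k => J (S t (u k))) atTop (𝓝 (J (S t U))) := by
    rw [tendsto_iff_norm_sub_tendsto_zero] at hu ⊢
    have hu' := hu.const_mul M
    rw [mul_zero] at hu'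
    refine squeeze_zero (fun _ => norm_nonneg _) (fun k => ?_) hu'
    have := hM (u k - U)
    simpa using this
  refine tendsto_nhds_unique (h1.norm.congr fun k => ?_) hu.norm
  obtain ⟨F, hF⟩ := (h.domain _).1 (huD k)
  exact h.norm_orbit_of_isA hF ht

theorem isA_sub (h : ObservedSemigroup J S IsA D p q α β B Q) {U F W G : E} (hU : IsA U F)
    (hW : IsA W G) : IsA (U - W) (F - G) := by
  rw [h.generator] at *
  have := hU.sub hW
  rw [← map_sub] at this
  refine this.congr fun s => ?_
  simp only [map_sub]
  module

theorem domain_sub (h : ObservedSemigroup J S IsA D p q α β B Q) {U W : E} (hU : D U) (hW : D W) :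
    D (U - W) := by
  obtain ⟨F, hF⟩ := (h.domain _).1 hU
  obtain ⟨G, hG⟩ := (h.domain _).1 hW
  exact (h.domain _).2 ⟨_, h.isA_sub hF hG⟩

theorem domain_orbit (h : ObservedSemigroup J S IsA D p q α β B Q) {U : E} (hU : D U) {t : ℝ}
    (ht : 0 ≤ t) : D (S t U) := by
  obtain ⟨F, hF⟩ := (h.domain _).1 hU
  exact (h.domain _).2 ⟨_, h.isA_orbit hF ht⟩

/-! ### Boundary functionals along orbits -/

theorem continuousOn_form (h : ObservedSemigroup J S IsA D p q α β B Q)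
    (B' : X →L[ℝ] X →L[ℝ] ℝ) (U W : E) :
    ContinuousOn (fun t => B' (J (S t U)) (J (S t W))) (Ici 0) :=
  (B'.continuous.comp_continuousOn (h.cont U)).clm_apply (h.cont W)

theorem tendsto_form {ι : Type*} {l : Filter ι} (B' : X →L[ℝ] X →L[ℝ] ℝ) {f g : ι → X} {x y : X}
    (hf : Tendsto f l (𝓝 x)) (hg : Tendsto g l (𝓝 y)) :
    Tendsto (fun i => B' (f i) (g i)) l (𝓝 (B' x y)) :=
  (B'.isBoundedBilinearMap.continuous.tendsto (x, y)).comp (hf.prodMk_nhds hg)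

/-- The multiplier identity for the difference $S_tU-S_{t_0}U$ writes $\alpha|\Delta
p|^2+\beta|\Delta q|^2$ through `J` of the differences of the orbits of `U` and of `F`, and both
tend to zero. -/
theorem continuousOn_boundary (h : ObservedSemigroup J S IsA D p q α β B Q) {U : E} (hU : D U) :
    ContinuousOn (fun t => p (S t U)) (Ici 0) ∧ ContinuousOn (fun t => q (S t U)) (Ici 0) := by
  obtain ⟨F, hF⟩ := (h.domain _).1 hU
  have key : ∀ t₀ : ℝ, 0 ≤ t₀ → Tendsto (fun t => α * (p (S t U) - p (S t₀ U)) ^ 2 +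
      β * (q (S t U) - q (S t₀ U)) ^ 2) (𝓝[Ici 0] t₀) (𝓝 0) := by
    intro t₀ ht₀
    have hu := (h.cont U t₀ ht₀).sub_const (J (S t₀ U))
    have hf := (h.cont F t₀ ht₀).sub_const (J (S t₀ F))
    rw [sub_self] at hu hf
    have := ((tendsto_form B hf hu).add (tendsto_form B hu hf)).add (tendsto_form Q hu hu)
    simp only [map_zero, add_zero] at this
    refine this.congr' ?_
    filter_upwards [self_mem_nhdsWithin] with t ht
    have hA := h.isA_sub (h.isA_orbit hF (t := t) ht) (h.isA_orbit hF ht₀)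
    have := h.multiplier _ _ hA
    rw [h.p_sub _ _ (h.domain_orbit hU ht) (h.domain_orbit hU ht₀),
      h.q_sub _ _ (h.domain_orbit hU ht) (h.domain_orbit hU ht₀)] at this
    rw [this]
    simp only [map_sub]
  have aux : ∀ (f : ℝ → ℝ) (γ : ℝ), 0 < γ → (∀ t₀ : ℝ, 0 ≤ t₀ →
      Tendsto (fun t => γ * (f t - f t₀) ^ 2) (𝓝[Ici 0] t₀) (𝓝 0)) → ContinuousOn f (Ici 0) := by
    intro f γ hγ hf t₀ ht₀
    have h1 := (hf t₀ ht₀).const_mul γ⁻¹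
    simp only [mul_zero, ← mul_assoc, inv_mul_cancel₀ hγ.ne', one_mul] at h1
    have h2 := h1.sqrt
    simp only [Real.sqrt_sq_eq_abs, Real.sqrt_zero] at h2
    rw [ContinuousWithinAt, tendsto_iff_norm_sub_tendsto_zero]
    exact h2
  constructor
  · refine aux _ α h.α_pos fun t₀ ht₀ => ?_
    refine squeeze_zero (fun t => mul_nonneg h.α_pos.le (sq_nonneg _)) (fun t => ?_) (key t₀ ht₀)
    have := mul_nonneg h.β_pos.le (sq_nonneg (q (S t U) - q (S t₀ U)))
    linarith
  · refine aux _ β h.β_pos fun t₀ ht₀ => ?_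
    refine squeeze_zero (fun t => mul_nonneg h.β_pos.le (sq_nonneg _)) (fun t => ?_) (key t₀ ht₀)
    have := mul_nonneg h.α_pos.le (sq_nonneg (p (S t U) - p (S t₀ U)))
    linarith

theorem memLp_of_continuousOn {f : ℝ → ℝ} (hf : ContinuousOn f (Ici 0)) (T : ℝ) :
    MemLp f 2 (volume.restrict (Ioo 0 T)) := by
  have hf' : ContinuousOn f (Icc 0 T) := hf.mono Icc_subset_Ici_self
  obtain ⟨C, hC⟩ := isCompact_Icc.exists_bound_of_continuousOn hf'
  refine MemLp.of_bound ((hf'.mono Ioo_subset_Icc_self).aestronglyMeasurable measurableSet_Ioo) C ?_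
  exact (ae_restrict_iff' measurableSet_Ioo).2
    (Eventually.of_forall fun t ht => hC t (Ioo_subset_Icc_self ht))

theorem intervalIntegrable_of_continuousOn {f : ℝ → ℝ} (hf : ContinuousOn f (Ici 0)) {T : ℝ}
    (hT : 0 ≤ T) : IntervalIntegrable f volume 0 T :=
  ContinuousOn.intervalIntegrable (hf.mono (by rw [uIcc_of_le hT]; exact Icc_subset_Ici_self))

/-- The two `B` terms of the multiplier identity are the right derivative of $B(JS_tU,JS_tU)$, so
they integrate to its increment. -/
theorem integral_multiplier (h : ObservedSemigroup J S IsA D p q α β B Q) {U : E} (hU : D U)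
    {T : ℝ} (hT : 0 ≤ T) :
    α * (∫ t in (0 : ℝ)..T, p (S t U) ^ 2) + β * (∫ t in (0 : ℝ)..T, q (S t U) ^ 2) =
      B (J (S T U)) (J (S T U)) - B (J U) (J U) +
        ∫ t in (0 : ℝ)..T, Q (J (S t U)) (J (S t U)) := by
  obtain ⟨F, hF⟩ := (h.domain _).1 hU
  obtain ⟨hp, hq⟩ := h.continuousOn_boundary hU
  have hsub : Icc (0 : ℝ) T ⊆ Ici 0 := Icc_subset_Ici_self
  have hBd : ContinuousOn (fun t => B (J (S t F)) (J (S t U)) + B (J (S t U)) (J (S t F)))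
      (Ici 0) := (h.continuousOn_form B F U).add (h.continuousOn_form B U F)
  have hFTC := intervalIntegral.integral_eq_sub_of_hasDeriv_right_of_le hT
    ((h.continuousOn_form B U U).mono hsub)
    (f' := fun t => B (J (S t F)) (J (S t U)) + B (J (S t U)) (J (S t F)))
    (fun t ht => by
      have h1 := h.hasDerivWithinAt_orbit hF ht.1.le
      exact (B.hasFDerivAt.comp_hasDerivWithinAt t h1).clm_apply h1)
    (intervalIntegrable_of_continuousOn hBd hT)
  have hpI : IntervalIntegrable (fun t => p (S t U) ^ 2) volume 0 T :=
    intervalIntegrable_of_continuousOn (hp.pow 2) hT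
  have hqI : IntervalIntegrable (fun t => q (S t U) ^ 2) volume 0 T :=
    intervalIntegrable_of_continuousOn (hq.pow 2) hT
  have hQI := intervalIntegrable_of_continuousOn (h.continuousOn_form Q U U) hT
  have hBI := intervalIntegrable_of_continuousOn hBd hT
  rw [← intervalIntegral.integral_const_mul, ← intervalIntegral.integral_const_mul,
    ← intervalIntegral.integral_add (hpI.const_mul α) (hqI.const_mul β)]
  have : ∫ t in (0 : ℝ)..T, (α * p (S t U) ^ 2 + β * q (S t U) ^ 2) = ∫ t in (0 : ℝ)..T,
      ((B (J (S t F)) (J (S t U)) + B (J (S t U)) (J (S t F))) + Q (J (S t U)) (J (S t U))) := by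
    refine intervalIntegral.integral_congr fun t ht => ?_
    rw [uIcc_of_le hT] at ht
    exact h.multiplier _ _ (h.isA_orbit hF ht.1)
  rw [this, intervalIntegral.integral_add hBI hQI, hFTC]
  simp [h.zero]

theorem integral_form_le (h : ObservedSemigroup J S IsA D p q α β B Q) {kQ : ℝ}
    (hQ : ∀ x, Q x x ≤ kQ * ‖x‖ ^ 2) (U : E) {T : ℝ} (hT : 0 ≤ T) :
    ∫ t in (0 : ℝ)..T, Q (J (S t U)) (J (S t U)) ≤ T * (kQ * ‖J U‖ ^ 2) := by
  have : ∫ t in (0 : ℝ)..T, Q (J (S t U)) (J (S t U)) ≤ ∫ t in (0 : ℝ)..T, kQ * ‖J U‖ ^ 2 := by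
    refine intervalIntegral.integral_mono_on hT
      (intervalIntegrable_of_continuousOn (h.continuousOn_form Q U U) hT) (by simp) fun t ht => ?_
    rw [← h.norm_orbit U ht.1]
    exact hQ _
  rwa [intervalIntegral.integral_const, sub_zero, smul_eq_mul] at this

theorem multiplier_le (h : ObservedSemigroup J S IsA D p q α β B Q) {kB kQ : ℝ}
    (hB : ∀ x, |B x x| ≤ kB * ‖x‖ ^ 2) (hQ : ∀ x, Q x x ≤ kQ * ‖x‖ ^ 2) (U : E) {T : ℝ}
    (hT : 0 ≤ T) :
    B (J (S T U)) (J (S T U)) - B (J U) (J U) + (∫ t in (0 : ℝ)..T, Q (J (S t U)) (J (S t U))) ≤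
      (2 * kB + T * kQ) * ‖J U‖ ^ 2 := by
  have h1 := (abs_le.1 (hB (J (S T U)))).2
  have h2 := (abs_le.1 (hB (J U))).1
  rw [h.norm_orbit U hT] at h1
  have h3 := h.integral_form_le hQ U hT
  linarith

/-- Boundary traces extend from the domain to all initial states. -/
theorem exists_trace (h : ObservedSemigroup J S IsA D p q α β B Q) {r : E → ℝ} {γ : ℝ}
    (hγ : 0 < γ) {K : ℝ → ℝ} (hr : ∀ U W, D U → D W → r (U - W) = r U - r W)
    (hc : ∀ U, D U → ContinuousOn (fun t => r (S t U)) (Ici 0))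
    (hK : ∀ U, D U → ∀ T : ℝ, 0 < T → γ * (∫ t in (0 : ℝ)..T, r (S t U) ^ 2) ≤ K T * ‖J U‖ ^ 2)
    (U₀ : E) : ∃ g : ℝ → ℝ, ∀ T : ℝ, 0 < T → MemLp g 2 (volume.restrict (Ioo 0 T)) ∧
      ∀ u : ℕ → E, (∀ k, D (u k)) → Tendsto (fun k => J (u k)) atTop (𝓝 (J U₀)) →
        Tendsto (fun k => eLpNorm (fun t => r (S t (u k)) - g t) 2 (volume.restrict (Ioo 0 T)))
          atTop (𝓝 0) := by
  have hm : ∀ U, D U → ∀ T, MemLp (fun t => r (S t U)) 2 (volume.restrict (Ioo 0 T)) :=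
    fun U hU T => memLp_of_continuousOn (hc U hU) T
  have hdiff : ∀ T : ℝ, 0 < T → ∀ U W, D U → D W →
      eLpNorm (fun t => r (S t U) - r (S t W)) 2 (volume.restrict (Ioo 0 T)) ≤
        ENNReal.ofReal (√(|K T| / γ) * ‖J U - J W‖) := by
    intro T hT U W hU hW
    have hUW := h.domain_sub hU hW
    have e1 : eLpNorm (fun t => r (S t U) - r (S t W)) 2 (volume.restrict (Ioo 0 T)) =
        eLpNorm (fun t => r (S t (U - W))) 2 (volume.restrict (Ioo 0 T)) := by
      refine eLpNorm_congr_ae ?_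
      refine (ae_restrict_iff' measurableSet_Ioo).2 (Eventually.of_forall fun t ht => ?_)
      simp only
      rw [map_sub, hr _ _ (h.domain_orbit hU ht.1.le) (h.domain_orbit hW ht.1.le)]
    rw [e1]
    refine (ENNReal.le_ofReal_iff_toReal_le (hm _ hUW T).2.ne (by positivity)).2 ?_
    refine abs_le_of_sq_le_sq' ?_ (by positivity) |>.2
    rw [eLpNorm_two_sq_eq hT (hm _ hUW T), mul_pow, Real.sq_sqrt (by positivity), ← map_sub,
      div_mul_eq_mul_div, le_div_iff₀ hγ, mul_comm]
    refine (hK _ hUW T hT).trans ?_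
    gcongr
    exact le_abs_self _
  -- One approximating sequence defines the trace. The Lipschitz bound `hdiff` then compares it with
  -- any other sequence.
  obtain ⟨u, huD, hu⟩ := h.dense U₀
  have hlim0 : ∀ T : ℝ, ∀ {ι : Type} {l : Filter ι} {v w : ι → E},
      Tendsto (fun i => J (v i) - J (w i)) l (𝓝 0) →
      Tendsto (fun i => ENNReal.ofReal (√(|K T| / γ) * ‖J (v i) - J (w i)‖)) l (𝓝 0) := by
    intro T ι l v w hvw
    have := ENNReal.tendsto_ofReal ((hvw.norm).const_mul (√(|K T| / γ)))
    simpa using this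
  obtain ⟨g, hg⟩ := exists_limit_of_cauchy_memLp (fun k t => r (S t (u k)))
    (fun T _ k => hm _ (huD k) T) (by
      intro T hT ε hε
      have hcs : Tendsto (fun mn : ℕ × ℕ => J (u mn.1) - J (u mn.2)) atTop (𝓝 0) := by
        rw [← prod_atTop_atTop_eq]
        have := (hu.comp tendsto_fst).sub (hu.comp tendsto_snd)
        rwa [sub_self] at this
      have := hlim0 T hcs
      obtain ⟨N, hN⟩ := eventually_atTop.1 (this.eventually_lt_const hε)
      refine ⟨max N.1 N.2, fun m hm n hn => lt_of_le_of_lt (hdiff T hT _ _ (huD m) (huD n))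
        (hN (m, n) ⟨?_, ?_⟩)⟩
      · exact (le_max_left _ _).trans hm
      · exact (le_max_right _ _).trans hn)
  refine ⟨g, fun T hT => ⟨(hg T hT).1, fun v hvD hv => ?_⟩⟩
  have hvu : Tendsto (fun k => J (v k) - J (u k)) atTop (𝓝 0) := by
    have := hv.sub hu
    rwa [sub_self] at this
  have hsum := (hlim0 T hvu).add (hg T hT).2
  rw [add_zero] at hsum
  refine tendsto_of_tendsto_of_tendsto_of_le_of_le tendsto_const_nhds hsum
    (fun _ => bot_le) fun k => ?_
  have e : (fun t => r (S t (v k)) - g t) =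
      (fun t => r (S t (v k)) - r (S t (u k))) + ((fun t => r (S t (u k))) - g) := by
    ext; simp
  simp only [e]
  refine (eLpNorm_add_le ((hm _ (hvD k) T).sub (hm _ (huD k) T)).1
    ((hm _ (huD k) T).sub (hg T hT).1).1 (by norm_num)).trans ?_
  gcongr
  exact hdiff T hT _ _ (hvD k) (huD k)

/-- Existence of the boundary traces, their bounds, and the multiplier identity, for all initial
states. -/
theorem exists_traces (h : ObservedSemigroup J S IsA D p q α β B Q) {kB kQ : ℝ}
    (hB : ∀ x, |B x x| ≤ kB * ‖x‖ ^ 2) (hQ : ∀ x, Q x x ≤ kQ * ‖x‖ ^ 2) (U₀ : E) :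
    ∃ f g : ℝ → ℝ, ∀ T : ℝ, 0 < T →
      MemLp f 2 (volume.restrict (Ioo 0 T)) ∧ MemLp g 2 (volume.restrict (Ioo 0 T)) ∧
      (∀ u : ℕ → E, (∀ k, D (u k)) → Tendsto (fun k => J (u k)) atTop (𝓝 (J U₀)) →
        (∀ k, MemLp (fun t => p (S t (u k))) 2 (volume.restrict (Ioo 0 T))) ∧
        Tendsto (fun k => eLpNorm (fun t => p (S t (u k)) - f t) 2 (volume.restrict (Ioo 0 T)))
          atTop (𝓝 0)) ∧
      (∀ u : ℕ → E, (∀ k, D (u k)) → Tendsto (fun k => J (u k)) atTop (𝓝 (J U₀)) →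
        (∀ k, MemLp (fun t => q (S t (u k))) 2 (volume.restrict (Ioo 0 T))) ∧
        Tendsto (fun k => eLpNorm (fun t => q (S t (u k)) - g t) 2 (volume.restrict (Ioo 0 T)))
          atTop (𝓝 0)) ∧
      α * (∫ t in (0 : ℝ)..T, f t ^ 2) + β * (∫ t in (0 : ℝ)..T, g t ^ 2) =
        B (J (S T U₀)) (J (S T U₀)) - B (J U₀) (J U₀) +
          ∫ t in (0 : ℝ)..T, Q (J (S t U₀)) (J (S t U₀)) := by
  have hsq : ∀ (r : E → ℝ) (γ : ℝ), 0 < γ → ∀ U (T : ℝ), 0 < T →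
      0 ≤ γ * ∫ t in (0 : ℝ)..T, r (S t U) ^ 2 := fun r γ hγ U T hT =>
    mul_nonneg hγ.le (intervalIntegral.integral_nonneg hT.le fun t _ => sq_nonneg _)
  have hbound : ∀ U, D U → ∀ T : ℝ, 0 < T → α * (∫ t in (0 : ℝ)..T, p (S t U) ^ 2) +
      β * (∫ t in (0 : ℝ)..T, q (S t U) ^ 2) ≤ (2 * kB + T * kQ) * ‖J U‖ ^ 2 := by
    intro U hU T hT
    rw [h.integral_multiplier hU hT.le]
    exact h.multiplier_le hB hQ U hT.le
  obtain ⟨f, hf⟩ := h.exists_trace h.α_pos (K := fun T => 2 * kB + T * kQ) h.p_sub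
    (fun U hU => (h.continuousOn_boundary hU).1)
    (fun U hU T hT => by linarith [hbound U hU T hT, hsq q β h.β_pos U T hT]) U₀
  obtain ⟨g, hg⟩ := h.exists_trace h.β_pos (K := fun T => 2 * kB + T * kQ) h.q_sub
    (fun U hU => (h.continuousOn_boundary hU).2)
    (fun U hU T hT => by linarith [hbound U hU T hT, hsq p α h.α_pos U T hT]) U₀
  refine ⟨f, g, fun T hT => ⟨(hf T hT).1, (hg T hT).1, fun u hu hu' => ⟨fun k =>
    memLp_of_continuousOn (h.continuousOn_boundary (hu k)).1 T, (hf T hT).2 u hu hu'⟩,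
    fun u hu hu' => ⟨fun k => memLp_of_continuousOn (h.continuousOn_boundary (hu k)).2 T,
      (hg T hT).2 u hu hu'⟩, ?_⟩⟩
  obtain ⟨u, huD, hu⟩ := h.dense U₀
  have h1 := tendsto_integral_sq hT
    (fun k => memLp_of_continuousOn (h.continuousOn_boundary (huD k)).1 T) (hf T hT).1
    ((hf T hT).2 u huD hu)
  have h2 := tendsto_integral_sq hT
    (fun k => memLp_of_continuousOn (h.continuousOn_boundary (huD k)).2 T) (hg T hT).1
    ((hg T hT).2 u huD hu)
  have hS : ∀ t : ℝ, 0 ≤ t → Tendsto (fun k => J (S t (u k))) atTop (𝓝 (J (S t U₀))) := by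
    intro t ht
    rw [tendsto_iff_norm_sub_tendsto_zero] at hu ⊢
    refine hu.congr fun k => ?_
    rw [← map_sub, ← map_sub, ← map_sub, h.norm_orbit _ ht]
  have h3 : Tendsto (fun k => ∫ t in (0 : ℝ)..T, Q (J (S t (u k))) (J (S t (u k)))) atTop
      (𝓝 (∫ t in (0 : ℝ)..T, Q (J (S t U₀)) (J (S t U₀)))) := by
    -- Norms of a convergent sequence are bounded, and conservation carries the bound `R` to all
    -- times; this gives a constant dominating function.
    obtain ⟨R, hR⟩ := hu.norm.bddAbove_range
    refine intervalIntegral.tendsto_integral_filter_of_dominated_convergence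
      (fun _ => ‖Q‖ * R * R) ?_ ?_ (by simp) ?_
    · refine Eventually.of_forall fun k => ?_
      exact (intervalIntegrable_of_continuousOn (h.continuousOn_form Q _ _) hT.le).1.1 |>
        fun h' => by rwa [uIoc_of_le hT.le]
    · refine Eventually.of_forall fun k => Eventually.of_forall fun t ht => ?_
      rw [uIoc_of_le hT.le] at ht
      have hk : ‖J (S t (u k))‖ ≤ R := by
        rw [h.norm_orbit _ ht.1.le]
        exact hR ⟨k, rfl⟩
      refine (Q.le_opNorm₂ _ _).trans ?_
      have := (norm_nonneg _).trans hk
      gcongr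
    · refine Eventually.of_forall fun t ht => ?_
      rw [uIoc_of_le hT.le] at ht
      exact tendsto_form Q (hS t ht.1.le) (hS t ht.1.le)
  have hL := (h1.const_mul α).add (h2.const_mul β)
  have hR := ((tendsto_form B (hS T hT.le) (hS T hT.le)).sub (tendsto_form B hu hu)).add h3
  exact tendsto_nhds_unique (hL.congr fun k => h.integral_multiplier (huD k) hT.le) hR

end ObservedSemigroup

/-! ### Primitives on an interval that is half-open at the singular endpoint -/

/-- The interval between `e` and `b`, with `e` included and `b` excluded. -/
def side (e b : ℝ) : Set ℝ := uIcc e b \ {b}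

theorem side_of_lt {e b : ℝ} (h : e < b) : side e b = Ico e b := by
  ext x; simp only [side, uIcc_of_le h.le, Set.mem_sdiff, mem_Icc, mem_singleton_iff, mem_Ico]
  exact ⟨fun ⟨h1, h2⟩ => ⟨h1.1, lt_of_le_of_ne h1.2 h2⟩, fun h1 => ⟨⟨h1.1, h1.2.le⟩, h1.2.ne⟩⟩

theorem side_of_gt {e b : ℝ} (h : b < e) : side e b = Ioc b e := by
  ext x; simp only [side, uIcc_of_ge h.le, Set.mem_sdiff, mem_Icc, mem_singleton_iff, mem_Ioc]
  exact ⟨fun ⟨h1, h2⟩ => ⟨lt_of_le_of_ne h1.1 (Ne.symm h2), h1.2⟩,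
    fun h1 => ⟨⟨h1.1.le, h1.2⟩, h1.1.ne'⟩⟩

theorem nhdsWithin_side_of_lt {e b : ℝ} (h : e < b) : 𝓝[side e b] b = 𝓝[<] b := by
  rw [side_of_lt h, nhdsWithin_Ico_eq_nhdsLT h]

theorem nhdsWithin_side_of_gt {e b : ℝ} (h : b < e) : 𝓝[side e b] b = 𝓝[>] b := by
  rw [side_of_gt h, nhdsWithin_Ioc_eq_nhdsGT h]

theorem left_mem_side {e b : ℝ} (h : e ≠ b) : e ∈ side e b := ⟨left_mem_uIcc, h⟩

theorem uIcc_subset_side {e b x : ℝ} (hx : x ∈ side e b) : uIcc e x ⊆ side e b := by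
  rcases lt_trichotomy e b with h | h | h
  · rw [side_of_lt h] at *
    rw [uIcc_of_le hx.1]
    exact fun y hy => ⟨hy.1, hy.2.trans_lt hx.2⟩
  · subst h; simp [side] at hx
  · rw [side_of_gt h] at *
    rw [uIcc_of_ge hx.2]
    exact fun y hy => ⟨hx.1.trans_le hy.1, hy.2⟩

theorem uIoo_subset_side {e b : ℝ} : uIoo e b ⊆ side e b := fun _ hx =>
  ⟨uIoo_subset_uIcc_self hx, fun h => right_notMem_uIoo (h ▸ hx)⟩

/-- `p` is a primitive of `g` on the half-open interval `side e b`. -/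
def IsPrimitive (e b : ℝ) (p g : ℝ → ℝ) : Prop :=
  ∀ x ∈ side e b, IntervalIntegrable g volume e x ∧ p x = p e + ∫ t in e..x, g t

/-- Off the segment `p` and `q` are arbitrary, so the product rule is applied to the absolutely
continuous integral formulas and carried back. -/
theorem primitive_mul {p g q h : ℝ → ℝ} {e x : ℝ} (hg : IntervalIntegrable g volume e x)
    (hh : IntervalIntegrable h volume e x) (hp : ∀ y ∈ uIcc e x, p y = p e + ∫ t in e..y, g t)
    (hq : ∀ y ∈ uIcc e x, q y = q e + ∫ t in e..y, h t) :
    IntervalIntegrable (fun t => g t * q t + p t * h t) volume e x ∧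
      p x * q x = p e * q e + ∫ t in e..x, (g t * q t + p t * h t) := by
  have key : ∀ {p g : ℝ → ℝ}, IntervalIntegrable g volume e x →
      (∀ y ∈ uIcc e x, p y = p e + ∫ t in e..y, g t) →
      AbsolutelyContinuousOnInterval (fun y => p e + ∫ t in e..y, g t) e x ∧
      ContinuousOn p (uIcc e x) ∧
      ∀ᵐ y, y ∈ uIcc e x → deriv (fun y => p e + ∫ t in e..y, g t) y = g y := by
    intro p g hg hp
    have hac : AbsolutelyContinuousOnInterval (fun y => p e + ∫ t in e..y, g t) e x := by
      have h1 : AbsolutelyContinuousOnInterval (fun _ : ℝ => p e) e x :=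
        (LipschitzWith.const (p e)).lipschitzOnWith.absolutelyContinuousOnInterval
      exact h1.add (hg.absolutelyContinuousOnInterval_intervalIntegral left_mem_uIcc)
    refine ⟨hac, hac.continuousOn.congr hp, ?_⟩
    filter_upwards [hg.ae_hasDerivAt_integral] with y hy hyx
    exact ((hy hyx e left_mem_uIcc).const_add (p e)).deriv
  obtain ⟨pac, pc, pd⟩ := key hg hp
  obtain ⟨qac, qc, qd⟩ := key hh hq
  refine ⟨(hg.mul_continuousOn qc).add (hh.continuousOn_mul pc), ?_⟩
  have h1 := pac.integral_deriv_mul_eq_sub qac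
  simp only [intervalIntegral.integral_same, add_zero] at h1
  rw [← hp x right_mem_uIcc, ← hq x right_mem_uIcc] at h1
  rw [← sub_eq_iff_eq_add', ← h1]
  refine intervalIntegral.integral_congr_ae ?_
  filter_upwards [pd, qd] with y h2 h3 hy
  have hy' := uIoc_subset_uIcc hy
  rw [h2 hy', h3 hy', ← hp y hy', ← hq y hy']

namespace IsPrimitive

variable {e b : ℝ} {p g q h : ℝ → ℝ}

theorem mul (hp : IsPrimitive e b p g) (hq : IsPrimitive e b q h) :
    IsPrimitive e b (fun x => p x * q x) (fun x => g x * q x + p x * h x) := fun x hx =>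
  primitive_mul (hp x hx).1 (hq x hx).1 (fun y hy => (hp y (uIcc_subset_side hx hy)).2)
    (fun y hy => (hq y (uIcc_subset_side hx hy)).2)

theorem congr_deriv (hp : IsPrimitive e b p g) (hgh : ∀ᵐ x, x ∈ side e b → g x = h x) :
    IsPrimitive e b p h := fun x hx => by
  have hae : ∀ᵐ y, y ∈ uIoc e x → g y = h y := by
    filter_upwards [hgh] with y hy hyx
    exact hy (uIcc_subset_side hx (uIoc_subset_uIcc hyx))
  refine ⟨(hp x hx).1.congr_ae ?_, ?_⟩
  · exact (ae_restrict_iff' measurableSet_uIoc).2 hae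
  · rw [(hp x hx).2, intervalIntegral.integral_congr_ae hae]

theorem congr (hp : IsPrimitive e b p g) (hpq : EqOn p q (side e b)) :
    IsPrimitive e b q g := fun x hx => by
  have he : e ∈ side e b := uIcc_subset_side hx left_mem_uIcc
  rw [← hpq hx, ← hpq he]
  exact hp x hx

theorem of_hasDerivAt (hc : ContinuousOn p (side e b)) (hd : ∀ x ∈ uIoo e b, HasDerivAt p (g x) x)
    (hg : ContinuousOn g (side e b)) : IsPrimitive e b p g := fun x hx => by
  have hs := uIcc_subset_side hx
  have hi : IntervalIntegrable g volume e x := (hg.mono hs).intervalIntegrable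
  refine ⟨hi, ?_⟩
  rw [intervalIntegral.integral_eq_sub_of_hasDeriv_right (hc.mono hs) (fun y hy => ?_) hi]
  · ring
  · refine (hd y ?_).hasDerivWithinAt
    have hxb := hx.1
    rcases le_total e b with h | h
    · rw [uIcc_of_le h] at hxb
      rw [min_eq_left hxb.1, max_eq_right hxb.1] at hy
      rw [uIoo_of_le h]
      exact ⟨hy.1, hy.2.trans_le hxb.2⟩
    · rw [uIcc_of_ge h] at hxb
      rw [min_eq_right hxb.2, max_eq_left hxb.2] at hy
      rw [uIoo_of_ge h]
      exact ⟨hxb.1.trans_lt hy.1, hy.2⟩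

theorem tendsto (hp : IsPrimitive e b p g) (hg : IntervalIntegrable g volume e b) :
    Tendsto p (𝓝[side e b] b) (𝓝 (p e + ∫ t in e..b, g t)) := by
  have h1 := intervalIntegral.continuousOn_primitive_interval' hg left_mem_uIcc b right_mem_uIcc
  have h2 := (h1.tendsto.mono_left (nhdsWithin_mono _ (sdiff_subset (t := {b})))).const_add (p e)
  refine h2.congr' ?_
  filter_upwards [self_mem_nhdsWithin] with x hx
  exact (hp x hx).2.symm

end IsPrimitive

/-- A function with `w / (x - b)` integrable cannot have a nonzero limit at `b`. -/
theorem eq_zero_of_tendsto_of_intervalIntegrable_div {w : ℝ → ℝ} {e b l : ℝ} (heb : e ≠ b)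
    (hw : Tendsto w (𝓝[side e b] b) (𝓝 l))
    (hi : IntervalIntegrable (fun x => w x / (x - b)) volume e b) : l = 0 := by
  classical
  by_contra hl
  -- The non-integrability criterion asks for a comparison with $1/(x-b)$ in a full punctured
  -- neighbourhood of `b`. On the far side of `b` the function is therefore set equal to $1/(x-b)$
  -- itself.
  let f : ℝ → ℝ := fun x => if x ∈ side e b then w x / (x - b) else (x - b)⁻¹
  have hf : IntervalIntegrable f volume e b := by
    refine hi.congr_ae ?_
    refine (ae_restrict_iff' measurableSet_uIoc).2 ?_
    have hne : ∀ᵐ x : ℝ, x ≠ b := by simp [ae_iff]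
    filter_upwards [hne] with x hx hxu
    have : x ∈ side e b := ⟨uIoc_subset_uIcc hxu, hx⟩
    simp [f, this]
  refine not_intervalIntegrable_of_sub_inv_isBigO_punctured ?_ heb right_mem_uIcc hf
  refine Asymptotics.IsBigO.of_bound (max (2 / |l|) 1) ?_
  have h1 : ∀ᶠ x in 𝓝[side e b] b, |l| / 2 < |w x| :=
    hw.abs.eventually_const_lt (by have := abs_pos.2 hl; linarith)
  have h2 : ∀ᶠ x in 𝓝 b, x ∈ side e b → |l| / 2 < |w x| := eventually_nhdsWithin_iff.1 h1
  filter_upwards [nhdsWithin_le_nhds h2] with x hx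
  have hl' := abs_pos.2 hl
  by_cases hs : x ∈ side e b
  · have := hx hs
    simp only [f, hs, if_true, norm_div, Real.norm_eq_abs, norm_inv]
    have h3 : (1 : ℝ) ≤ max (2 / |l|) 1 * |w x| := by
      calc (1 : ℝ) = 2 / |l| * (|l| / 2) := by field_simp
        _ ≤ max (2 / |l|) 1 * |w x| := by gcongr; exact le_max_left _ _
    calc |x - b|⁻¹ = 1 * |x - b|⁻¹ := (one_mul _).symm
      _ ≤ (max (2 / |l|) 1 * |w x|) * |x - b|⁻¹ := by gcongr
      _ = max (2 / |l|) 1 * (|w x| / |x - b|) := by ring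
  · simp only [f, hs, if_false]
    exact le_mul_of_one_le_left (norm_nonneg _) (le_max_right _ _)

/-- Integrability of `g` gives a limit at `b`, and integrability of $w/(x-b)$ forces it to be zero.
This removes the boundary terms at the singular point from the multiplier identity. -/
theorem IsPrimitive.tendsto_zero {e b : ℝ} {w g : ℝ → ℝ} (hw : IsPrimitive e b w g) (heb : e ≠ b)
    (hg : IntervalIntegrable g volume e b)
    (hi : IntervalIntegrable (fun x => w x / (x - b)) volume e b) :
    ∫ t in e..b, g t = -w e ∧ Tendsto w (𝓝[side e b] b) (𝓝 0) := by
  have h1 := hw.tendsto hg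
  have h2 := eq_zero_of_tendsto_of_intervalIntegrable_div heb h1 hi
  rw [h2] at h1
  exact ⟨by linarith, h1⟩

/-! ### Weak derivatives -/

theorem integrable_mul_of_locallyIntegrableOn {s : Set ℝ} {u φ : ℝ → ℝ}
    (hu : LocallyIntegrableOn u s) (hφ : Continuous φ) (hc : HasCompactSupport φ)
    (hs : tsupport φ ⊆ s) : Integrable (fun x => u x * φ x) := by
  have h1 : IntegrableOn u (tsupport φ) :=
    (hu.mono_set hs).integrableOn_isCompact hc
  have h2 : IntegrableOn (fun x => u x * φ x) (tsupport φ) :=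
    h1.mul_continuousOn hφ.continuousOn hc
  refine (integrableOn_iff_integrable_of_support_subset fun x hx => ?_).1 h2
  exact subset_tsupport _ (right_ne_zero_of_mul hx)

theorem setIntegral_mul_test {s : Set ℝ} (u : ℝ → ℝ) {φ : ℝ → ℝ} (hs : tsupport φ ⊆ s) :
    ∫ x in s, u x * φ x = ∫ x, u x * φ x :=
  setIntegral_eq_integral_of_forall_compl_eq_zero fun x hx => by
    rw [image_eq_zero_of_notMem_tsupport fun h => hx (hs h), mul_zero]

theorem tsupport_deriv_subset (φ : ℝ → ℝ) : tsupport (deriv φ) ⊆ tsupport φ :=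
  closure_minimal support_deriv_subset (isClosed_tsupport φ)

theorem contDiff_deriv {φ : ℝ → ℝ} (h : ContDiff ℝ ∞ φ) : ContDiff ℝ ∞ (deriv φ) :=
  (contDiff_infty_iff_deriv.1 h).2

namespace HasWeakDerivOn

variable {s t : Set ℝ} {u v g h : ℝ → ℝ}

theorem mono (hu : HasWeakDerivOn s u g) (hts : t ⊆ s) : HasWeakDerivOn t u g := by
  refine ⟨hu.1.mono_set hts, hu.2.1.mono_set hts, fun φ h1 h2 h3 => ?_⟩
  have h4 := (tsupport_deriv_subset φ).trans h3
  have := hu.2.2 φ h1 h2 (h3.trans hts)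
  rw [setIntegral_mul_test u (h4.trans hts), setIntegral_mul_test g (h3.trans hts)] at this
  rw [setIntegral_mul_test u h4, setIntegral_mul_test g h3, this]

theorem congr (hu : HasWeakDerivOn s u g)
    (huv : u =ᵐ[volume.restrict s] v) (hgh : g =ᵐ[volume.restrict s] h) : HasWeakDerivOn s v h := by
  have key : ∀ {f k : ℝ → ℝ}, LocallyIntegrableOn f s → f =ᵐ[volume.restrict s] k →
      LocallyIntegrableOn k s := by
    intro f k hf hfk x hx
    obtain ⟨U, hU, hfU⟩ := hf x hx
    refine ⟨U ∩ s, inter_mem hU self_mem_nhdsWithin, ?_⟩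
    refine (hfU.mono_set inter_subset_left).congr_fun_ae ?_
    exact ae_restrict_of_ae_restrict_of_subset inter_subset_right hfk
  refine ⟨key hu.1 huv, key hu.2.1 hgh, fun φ h1 h2 h3 => ?_⟩
  have e1 : ∫ x in s, v x * deriv φ x = ∫ x in s, u x * deriv φ x :=
    integral_congr_ae (by filter_upwards [huv] with x hx; rw [hx])
  have e2 : ∫ x in s, h x * φ x = ∫ x in s, g x * φ x :=
    integral_congr_ae (by filter_upwards [hgh] with x hx; rw [hx])
  rw [e1, e2, hu.2.2 φ h1 h2 h3]

theorem add (hu : HasWeakDerivOn s u g) (hv : HasWeakDerivOn s v h) :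
    HasWeakDerivOn s (fun x => u x + v x) (fun x => g x + h x) := by
  refine ⟨hu.1.add hv.1, hu.2.1.add hv.2.1, fun φ h1 h2 h3 => ?_⟩
  have h4 := (tsupport_deriv_subset φ).trans h3
  have hc' := (contDiff_deriv h1).continuous
  simp only [add_mul]
  rw [integral_add (integrable_mul_of_locallyIntegrableOn hu.1 hc' h2.deriv h4).integrableOn
      (integrable_mul_of_locallyIntegrableOn hv.1 hc' h2.deriv h4).integrableOn,
    integral_add (integrable_mul_of_locallyIntegrableOn hu.2.1 h1.continuous h2 h3).integrableOn
      (integrable_mul_of_locallyIntegrableOn hv.2.1 h1.continuous h2 h3).integrableOn,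
    hu.2.2 φ h1 h2 h3, hv.2.2 φ h1 h2 h3]
  ring

theorem const_mul (k : ℝ) (hu : HasWeakDerivOn s u g) :
    HasWeakDerivOn s (fun x => k * u x) (fun x => k * g x) := by
  refine ⟨hu.1.smul k, hu.2.1.smul k, fun φ h1 h2 h3 => ?_⟩
  simp only [mul_assoc, integral_const_mul]
  rw [hu.2.2 φ h1 h2 h3]
  ring

theorem unique (hs : IsOpen s) (hu : HasWeakDerivOn s u g) (hv : HasWeakDerivOn s u h) :
    g =ᵐ[volume.restrict s] h := by
  have := hs.ae_eq_zero_of_integral_contDiff_smul_eq_zero (hu.2.1.sub hv.2.1) fun φ h1 h2 h3 => by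
    have e1 := hu.2.2 φ h1 h2 h3
    have e2 := hv.2.2 φ h1 h2 h3
    rw [setIntegral_mul_test g h3] at e1
    rw [setIntegral_mul_test h h3] at e2
    have i1 := integrable_mul_of_locallyIntegrableOn hu.2.1 h1.continuous h2 h3
    have i2 := integrable_mul_of_locallyIntegrableOn hv.2.1 h1.continuous h2 h3
    calc ∫ x, φ x • (g - h) x = ∫ x, (g x * φ x - h x * φ x) := by
          congr 1; ext x; simp; ring
      _ = 0 := by rw [integral_sub i1 i2]; linarith
  rw [Filter.EventuallyEq, ae_restrict_iff' hs.measurableSet]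
  filter_upwards [this] with x hx hxs
  have : g x - h x = 0 := hx hxs
  linarith

end HasWeakDerivOn

/-- **Du Bois-Reymond**: a function that annihilates all test functions of mean zero is constant. -/
theorem ae_const_of_integral_test_eq_zero {U : Set ℝ} (hU : IsOpen U) {f : ℝ → ℝ}
    (hf : LocallyIntegrableOn f U)
    (h : ∀ ψ : ℝ → ℝ, ContDiff ℝ ∞ ψ → HasCompactSupport ψ → tsupport ψ ⊆ U → ∫ x, ψ x = 0 →
      ∫ x, f x * ψ x = 0) :
    ∃ C, ∀ᵐ x, x ∈ U → f x = C := by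
  rcases U.eq_empty_or_nonempty with rfl | ⟨x₀, hx₀⟩
  · exact ⟨0, by simp⟩
  obtain ⟨χ, hχU, hχc, hχ, hχr, hχx⟩ := exists_contDiff_tsupport_subset (n := ⊤) (hU.mem_nhds hx₀)
  have hχ' : ContDiff ℝ ∞ χ := hχ
  have hpos : 0 < ∫ x, χ x :=
    hχ.continuous.integral_pos_of_hasCompactSupport_nonneg_nonzero hχc
      (fun x => (hχr ⟨x, rfl⟩).1) (by rw [hχx]; exact one_ne_zero)
  set m := ∫ x, χ x with hm
  have hχi : Integrable χ := hχ.continuous.integrable_of_hasCompactSupport hχc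
  refine ⟨m⁻¹ * ∫ x, f x * χ x, ?_⟩
  set C := m⁻¹ * ∫ x, f x * χ x with hC
  have hconst : LocallyIntegrableOn (fun _ : ℝ => C) U :=
    continuousOn_const.locallyIntegrableOn hU.measurableSet
  have := hU.ae_eq_zero_of_integral_contDiff_smul_eq_zero (hf.sub hconst)
    fun φ h1 h2 h3 => by
      have hφi : Integrable φ := h1.continuous.integrable_of_hasCompactSupport h2
      -- Subtracting $k\chi$ removes the mean of `φ`; the correction shows that `f` pairs with `φ`
      -- as the constant `C` does.
      set k := m⁻¹ * ∫ x, φ x with hk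
      have hts : tsupport (fun x => φ x - k * χ x) ⊆ tsupport φ ∪ tsupport χ := by
        refine closure_minimal (fun x hx => ?_)
          ((isClosed_tsupport φ).union (isClosed_tsupport χ))
        by_contra hcon
        rw [mem_union, not_or] at hcon
        apply hx
        simp only
        rw [image_eq_zero_of_notMem_tsupport hcon.1, image_eq_zero_of_notMem_tsupport hcon.2]
        simp
      have hz := h (fun x => φ x - k * χ x) (h1.sub (contDiff_const.mul hχ'))
        (HasCompactSupport.of_support_subset_isCompact (h2.union hχc)
          ((subset_tsupport _).trans hts))
        (hts.trans (union_subset h3 hχU)) (by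
          rw [integral_sub hφi (hχi.const_mul k), integral_const_mul, ← hm, hk]
          field_simp
          ring)
      have i1 := integrable_mul_of_locallyIntegrableOn hf h1.continuous h2 h3
      have i2 := integrable_mul_of_locallyIntegrableOn hf hχ.continuous hχc hχU
      have e1 : ∫ x, f x * (φ x - k * χ x) = (∫ x, f x * φ x) - k * ∫ x, f x * χ x := by
        rw [← integral_const_mul, ← integral_sub i1 (i2.const_mul k)]
        congr 1; ext x; ring
      have e2 : ∫ x, φ x • (f x - C) = (∫ x, f x * φ x) - C * ∫ x, φ x := by
        rw [← integral_const_mul, ← integral_sub i1 (hφi.const_mul C)]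
        congr 1; ext x; simp; ring
      refine e2.trans ?_
      rw [hC]
      rw [e1] at hz
      rw [hk] at hz
      linarith
  filter_upwards [this] with x hx hxU
  have : f x - C = 0 := hx hxU
  linarith

theorem exists_Icc_of_compact_subset_Ioo {K : Set ℝ} {α β : ℝ} (hK : IsCompact K)
    (hs : K ⊆ Ioo α β) (hαβ : α < β) : ∃ α' β', α < α' ∧ α' ≤ β' ∧ β' < β ∧ K ⊆ Icc α' β' := by
  rcases K.eq_empty_or_nonempty with rfl | hne
  · obtain ⟨m, hm⟩ := exists_between hαβ
    exact ⟨m, m, hm.1, le_rfl, hm.2, empty_subset _⟩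
  · have h1 := hs (hK.sInf_mem hne)
    have h2 := hs (hK.sSup_mem hne)
    exact ⟨sInf K, sSup K, h1.1, csInf_le_csSup hne hK.bddBelow hK.bddAbove, h2.2,
      fun x hx => ⟨csInf_le hK.bddBelow hx, le_csSup hK.bddAbove hx⟩⟩

/-- A test function of mean zero on an interval is the derivative of a test function. -/
theorem exists_test_primitive {α β : ℝ} (hαβ : α < β) {ψ : ℝ → ℝ} (h1 : ContDiff ℝ ∞ ψ)
    (h2 : HasCompactSupport ψ) (h3 : tsupport ψ ⊆ Ioo α β) (h0 : ∫ x, ψ x = 0) :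
    ∃ φ : ℝ → ℝ, ContDiff ℝ ∞ φ ∧ HasCompactSupport φ ∧ tsupport φ ⊆ Ioo α β ∧ deriv φ = ψ := by
  obtain ⟨α', β', hα, hle, hβ, hK⟩ := exists_Icc_of_compact_subset_Ioo h2 h3 hαβ
  have hd : ∀ x, HasDerivAt (fun y => ∫ t in α..y, ψ t) (ψ x) x := fun x =>
    intervalIntegral.integral_hasDerivAt_right (h1.continuous.intervalIntegrable _ _)
      h1.continuous.stronglyMeasurable.stronglyMeasurableAtFilter h1.continuous.continuousAt
  have hderiv : deriv (fun y => ∫ t in α..y, ψ t) = ψ := funext fun x => (hd x).deriv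
  have hz : ∀ x, x ∉ Icc α' β' → ψ x = 0 := fun x hx =>
    image_eq_zero_of_notMem_tsupport fun h => hx (hK h)
  have hsupp : Function.support (fun y => ∫ t in α..y, ψ t) ⊆ Icc α' β' := by
    intro x hx
    by_contra hcon
    apply hx
    rw [mem_Icc, not_and_or, not_le, not_le] at hcon
    rcases hcon with h | h
    · simp only
      rw [intervalIntegral.integral_congr (g := fun _ => 0), intervalIntegral.integral_zero]
      intro t ht
      refine hz t fun htt => ?_
      have : t ≤ max α x := ht.2
      have h' := htt.1
      rcases max_cases α x with h'' | h'' <;> linarith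
    -- To the right of the support the primitive is the whole integral of `ψ`, which is zero; this
    -- is where the mean-zero hypothesis enters.
    · simp only
      rw [intervalIntegral.integral_of_le (by linarith), setIntegral_eq_integral_of_forall_compl_eq_zero, h0]
      intro t ht
      refine hz t fun htt => ht ⟨by linarith [htt.1], by linarith [htt.2]⟩
  have hts : tsupport (fun y => ∫ t in α..y, ψ t) ⊆ Icc α' β' := closure_minimal hsupp isClosed_Icc
  refine ⟨fun y => ∫ t in α..y, ψ t, ?_, HasCompactSupport.of_support_subset_isCompact isCompact_Icc
    hsupp, hts.trans fun x hx => ⟨hα.trans_le hx.1, hx.2.trans_lt hβ⟩, hderiv⟩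
  rw [contDiff_infty_iff_deriv, hderiv]
  exact ⟨fun x => (hd x).differentiableAt, h1⟩

/-- Integration by parts on the segment from `e` to a point `x` beyond the support of `φ` but short
of `b`. Stopping there avoids any integrability of `g` up to the singular end. -/
theorem integral_primitive_mul_deriv {e b : ℝ} (heb : e ≠ b) {p g : ℝ → ℝ}
    (hp : IsPrimitive e b p g) {φ : ℝ → ℝ} (h1 : ContDiff ℝ ∞ φ) (h2 : HasCompactSupport φ)
    (h3 : tsupport φ ⊆ uIoo e b) : ∫ x, (g x * φ x + p x * deriv φ x) = 0 := by
  have hφ : IsPrimitive e b φ (deriv φ) := IsPrimitive.of_hasDerivAt h1.continuous.continuousOn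
    (fun x _ => (h1.differentiable (by simp) x).hasDerivAt)
    (contDiff_deriv h1).continuous.continuousOn
  obtain ⟨x, hx, hK⟩ : ∃ x ∈ side e b, tsupport φ ⊆ uIoc e x ∧ φ x = 0 := by
    rcases lt_or_gt_of_ne heb with h | h
    · rw [uIoo_of_lt h] at h3
      obtain ⟨α', β', hα, hle, hβ, hK⟩ := exists_Icc_of_compact_subset_Ioo h2 h3 h
      obtain ⟨x, hx⟩ := exists_between hβ
      refine ⟨x, ?_, ?_, ?_⟩
      · rw [side_of_lt h]; exact ⟨by linarith, hx.2⟩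
      · rw [uIoc_of_le (by linarith)]
        exact fun y hy => ⟨by linarith [(hK hy).1], by linarith [(hK hy).2]⟩
      · exact image_eq_zero_of_notMem_tsupport fun h => by linarith [(hK h).2]
    · rw [uIoo_of_gt h] at h3
      obtain ⟨α', β', hα, hle, hβ, hK⟩ := exists_Icc_of_compact_subset_Ioo h2 h3 h
      obtain ⟨x, hx⟩ := exists_between hα
      refine ⟨x, ?_, ?_, ?_⟩
      · rw [side_of_gt h]; exact ⟨hx.1, by linarith⟩
      · rw [uIoc_of_ge (by linarith)]
        exact fun y hy => ⟨by linarith [(hK hy).1], by linarith [(hK hy).2]⟩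
      · exact image_eq_zero_of_notMem_tsupport fun h => by linarith [(hK h).1]
  have hprod := ((hp.mul hφ) x hx).2
  have he : φ e = 0 := image_eq_zero_of_notMem_tsupport fun h => left_notMem_uIoo (h3 h)
  simp only [he, hK.2, mul_zero, zero_add] at hprod
  rw [intervalIntegral.intervalIntegral_eq_integral_uIoc] at hprod
  have h0 : ∫ t in uIoc e x, (g t * φ t + p t * deriv φ t) = 0 := by
    split_ifs at hprod <;> simpa using hprod.symm
  rw [← h0, setIntegral_eq_integral_of_forall_compl_eq_zero]
  intro y hy
  rw [image_eq_zero_of_notMem_tsupport fun h => hy (hK.1 h),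
    image_eq_zero_of_notMem_tsupport fun h => hy (hK.1 (tsupport_deriv_subset φ h))]
  simp

theorem IsPrimitive.continuousOn {e b : ℝ} {p g : ℝ → ℝ} (hp : IsPrimitive e b p g) :
    ContinuousOn p (side e b) := by
  intro x hx
  have key : ∀ z ∈ side e b, ContinuousOn p (uIcc e z) := by
    intro z hz
    have h1 := intervalIntegral.continuousOn_primitive_interval' (hp z hz).1 left_mem_uIcc
    exact (h1.const_add (p e)).congr fun y hy => (hp y (uIcc_subset_side hz hy)).2
  rcases lt_trichotomy e b with h | h | h
  · rw [side_of_lt h] at *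
    obtain ⟨z, hz⟩ := exists_between hx.2
    have h1 := key z ⟨hx.1.trans hz.1.le, hz.2⟩
    rw [uIcc_of_le (hx.1.trans hz.1.le)] at h1
    refine (h1 x ⟨hx.1, hz.1.le⟩).mono_of_mem_nhdsWithin ?_
    filter_upwards [self_mem_nhdsWithin, nhdsWithin_le_nhds (Iio_mem_nhds hz.1)] with y hy hyz
    exact ⟨hy.1, le_of_lt hyz⟩
  · subst h; simp [side] at hx
  · rw [side_of_gt h] at *
    obtain ⟨z, hz⟩ := exists_between hx.1
    have h1 := key z ⟨hz.1, hz.2.le.trans hx.2⟩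
    rw [uIcc_of_ge (hz.2.le.trans hx.2)] at h1
    refine (h1 x ⟨hz.2.le, hx.2⟩).mono_of_mem_nhdsWithin ?_
    filter_upwards [self_mem_nhdsWithin, nhdsWithin_le_nhds (Ioi_mem_nhds hz.2)] with y hy hyz
    exact ⟨le_of_lt hyz, hy.2⟩

/-- A function with a weak derivative is a.e. equal to a primitive of it. -/
theorem HasWeakDerivOn.exists_isPrimitive {e b : ℝ} (heb : e ≠ b) {u g : ℝ → ℝ}
    (hu : HasWeakDerivOn (uIoo e b) u g) (hg : ∀ x ∈ side e b, IntervalIntegrable g volume e x) :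
    ∃ p, IsPrimitive e b p g ∧ ∀ᵐ x, x ∈ uIoo e b → u x = p x := by
  have hp : ∀ C : ℝ, IsPrimitive e b (fun x => C + ∫ t in e..x, g t) g := fun C x hx =>
    ⟨hg x hx, by simp⟩
  have hpl : LocallyIntegrableOn (fun x => 0 + ∫ t in e..x, g t) (uIoo e b) :=
    ((hp 0).continuousOn.mono uIoo_subset_side).locallyIntegrableOn measurableSet_Ioo
  -- Mean-zero test functions are exactly derivatives of test functions, and on these `u` and the
  -- primitive of `g` have equal pairings. Their difference is therefore constant.
  obtain ⟨C, hC⟩ := ae_const_of_integral_test_eq_zero (U := uIoo e b) isOpen_Ioo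
    (hu.1.sub hpl) fun ψ h1 h2 h3 h0 => by
      obtain ⟨φ, k1, k2, k3, rfl⟩ := exists_test_primitive (inf_lt_sup.2 heb) h1 h2 h3 h0
      have k3 : tsupport φ ⊆ uIoo e b := k3
      have e1 := hu.2.2 φ k1 k2 k3
      rw [setIntegral_mul_test u h3, setIntegral_mul_test g k3] at e1
      have e2 := integral_primitive_mul_deriv heb (hp 0) k1 k2 k3
      have i1 := integrable_mul_of_locallyIntegrableOn hu.2.1 k1.continuous k2 k3
      have i2 := integrable_mul_of_locallyIntegrableOn hpl h1.continuous h2 h3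
      have i3 := integrable_mul_of_locallyIntegrableOn hu.1 h1.continuous h2 h3
      rw [integral_add i1 i2] at e2
      calc ∫ x, (u - fun x => 0 + ∫ t in e..x, g t) x * deriv φ x
          = ∫ x, (u x * deriv φ x - (0 + ∫ t in e..x, g t) * deriv φ x) := by
            congr 1; ext x; simp; ring
        _ = 0 := by rw [integral_sub i3 i2]; linarith
  refine ⟨fun x => C + ∫ t in e..x, g t, hp C, ?_⟩
  filter_upwards [hC] with x hx hxs
  have := hx hxs
  simp only [Pi.sub_apply] at this
  linarith

/-- A primitive has the expected weak derivative. -/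
theorem IsPrimitive.hasWeakDerivOn {e b : ℝ} (heb : e ≠ b) {p g : ℝ → ℝ}
    (hp : IsPrimitive e b p g) (hg : LocallyIntegrableOn g (uIoo e b)) :
    HasWeakDerivOn (uIoo e b) p g := by
  have hpl : LocallyIntegrableOn p (uIoo e b) :=
    (hp.continuousOn.mono uIoo_subset_side).locallyIntegrableOn measurableSet_Ioo
  refine ⟨hpl, hg, fun φ k1 k2 k3 => ?_⟩
  have k3' := (tsupport_deriv_subset φ).trans k3
  have e2 := integral_primitive_mul_deriv heb hp k1 k2 k3
  have i1 := integrable_mul_of_locallyIntegrableOn hg k1.continuous k2 k3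
  have i2 := integrable_mul_of_locallyIntegrableOn hpl (contDiff_deriv k1).continuous k2.deriv k3'
  rw [integral_add i1 i2] at e2
  rw [setIntegral_mul_test p k3', setIntegral_mul_test g k3]
  linarith

/-! ### The weight -/

/-- A weight with rate of degeneracy `μ` whose square root has derivative bounded below
satisfies `μ ≤ 2`. -/
theorem rate_le_two {b b' : ℝ → ℝ} {r μ m : ℝ} (hr : 0 < r) (hm : 0 < m)
    (hpos : ∀ s ∈ Ioo 0 r, 0 < b s) (hd : ∀ s ∈ Ioo 0 r, HasDerivAt b (b' s) s)
    (hmono : ∀ s ∈ Ioo 0 r, 0 ≤ b' s) (hle : ∀ s ∈ Ioo 0 r, s * |b' s| ≤ μ * b s)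
    (hlim : Tendsto (fun s => s * |b' s| / b s) (𝓝[>] 0) (𝓝 μ))
    (hsqrt : ∀ ε, 0 < ε → ε ≤ r → ∃ s ∈ Ioo 0 ε, m ≤ |b' s / (2 * √(b s))|) : μ ≤ 2 := by
  by_contra hcon
  push Not at hcon
  -- Any exponent strictly between $2$ and $\mu$ works: near $0$ the rate exceeds it, while $q>2$
  -- makes $s^{q/2-1}$ tend to zero.
  set q := (2 + μ) / 2 with hq
  have hq2 : 2 < q := by rw [hq]; linarith
  have hqμ : q < μ := by rw [hq]; linarith
  obtain ⟨δ, hδ0, hδ⟩ : ∃ δ ∈ Ioi (0 : ℝ), ∀ s ∈ Ioo 0 δ, q < s * |b' s| / b s ∧ s < r := by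
    have := (hlim.eventually_const_lt hqμ).and (nhdsWithin_le_nhds (Iio_mem_nhds hr))
    obtain ⟨δ, h1, h2⟩ := mem_nhdsGT_iff_exists_Ioo_subset.1 this
    exact ⟨δ, h1, fun s hs => h2 hs⟩
  have hδ0 : 0 < δ := hδ0
  -- Here $sb'>qb$, so $b\,s^{-q}$ increases and hence $b\le Cs^q$ near $0$.
  have hmonoq : MonotoneOn (fun s => b s * s ^ (-q)) (Ioo 0 δ) := by
    refine monotoneOn_of_hasDerivWithinAt_nonneg (convex_Ioo 0 δ)
      (f' := fun s => b' s * s ^ (-q) + b s * (-q * s ^ (-q - 1))) ?_ ?_ ?_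
    · intro s hs
      have hsr : s ∈ Ioo 0 r := ⟨hs.1, (hδ s hs).2⟩
      exact ((hd s hsr).mul (Real.hasDerivAt_rpow_const (Or.inl hs.1.ne'))).continuousAt.continuousWithinAt
    · intro s hs
      rw [interior_Ioo] at hs
      have hsr : s ∈ Ioo 0 r := ⟨hs.1, (hδ s hs).2⟩
      exact ((hd s hsr).mul (Real.hasDerivAt_rpow_const (Or.inl hs.1.ne'))).hasDerivWithinAt
    · intro s hs
      rw [interior_Ioo] at hs
      have hsr : s ∈ Ioo 0 r := ⟨hs.1, (hδ s hs).2⟩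
      have h1 := (hδ s hs).1
      rw [lt_div_iff₀ (hpos s hsr), abs_of_nonneg (hmono s hsr)] at h1
      have h2 : s ^ (-q) = s * s ^ (-q - 1) := by
        rw [Real.rpow_sub_one hs.1.ne']; field_simp [hs.1.ne']
      have h3 : b' s * s ^ (-q) + b s * (-q * s ^ (-q - 1)) =
          (s * b' s - q * b s) * s ^ (-q - 1) := by rw [h2]; ring
      rw [h3]
      exact mul_nonneg (by linarith) (Real.rpow_nonneg hs.1.le _)
  set C := b (δ / 2) * (δ / 2) ^ (-q) with hC
  have hδ2 : δ / 2 ∈ Ioo 0 δ := ⟨by linarith, by linarith⟩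
  have hbC : ∀ s ∈ Ioo 0 (δ / 2), b s ≤ C * s ^ q := by
    intro s hs
    have h1 := hmonoq ⟨hs.1, by linarith [hs.2]⟩ hδ2 hs.2.le
    simp only at h1
    rw [← hC, Real.rpow_neg hs.1.le, ← div_eq_mul_inv, div_le_iff₀ (Real.rpow_pos_of_pos hs.1 _)] at h1
    exact h1
  -- From $b\le Cs^q$ and $s|b'|\le\mu b$, the derivative of $\sqrt b$ is at most this expression in
  -- absolute value. Its decay contradicts the lower bound `m`.
  have hto : Tendsto (fun s : ℝ => μ / 2 * √C * s ^ (q / 2 - 1)) (𝓝[>] 0) (𝓝 0) := by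
    have h1 : Tendsto (fun s : ℝ => s ^ (q / 2 - 1)) (𝓝 0) (𝓝 (0 ^ (q / 2 - 1))) :=
      (Real.continuousAt_rpow_const 0 _ (Or.inr (by linarith))).tendsto
    rw [Real.zero_rpow (by linarith)] at h1
    simpa using (h1.const_mul (μ / 2 * √C)).mono_left nhdsWithin_le_nhds
  obtain ⟨ε, hε0, hε⟩ := mem_nhdsGT_iff_exists_Ioo_subset.1 (hto.eventually_lt_const hm)
  have hε0 : 0 < ε := hε0
  have hδr : δ / 2 ≤ r := (hδ _ hδ2).2.le
  obtain ⟨s, hs, hms⟩ := hsqrt (min ε (δ / 2)) (lt_min hε0 (by linarith))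
    ((min_le_right _ _).trans hδr)
  have hs1 : s ∈ Ioo 0 ε := ⟨hs.1, hs.2.trans_le (min_le_left _ _)⟩
  have hs2 : s ∈ Ioo 0 (δ / 2) := ⟨hs.1, hs.2.trans_le (min_le_right _ _)⟩
  have hsr : s ∈ Ioo 0 r := ⟨hs.1, hs2.2.trans_le hδr⟩
  have hlt : μ / 2 * √C * s ^ (q / 2 - 1) < m := hε hs1
  have hb := hpos s hsr
  have hsb := Real.sqrt_pos.2 hb
  have h1 : |b' s / (2 * √(b s))| ≤ μ / 2 * (√(b s) / s) := by
    rw [abs_div, abs_of_pos (by positivity : 0 < 2 * √(b s)), div_le_iff₀ (by positivity)]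
    have h2 := hle s hsr
    have h3 : μ / 2 * (√(b s) / s) * (2 * √(b s)) = μ * b s / s := by
      rw [show μ / 2 * (√(b s) / s) * (2 * √(b s)) = μ * (√(b s) * √(b s)) / s by ring,
        Real.mul_self_sqrt hb.le]
    rw [h3, le_div_iff₀ hs.1]
    linarith
  have h4 : √(b s) / s ≤ √C * s ^ (q / 2 - 1) := by
    rw [div_le_iff₀ hs.1, mul_assoc, Real.rpow_sub_one hs.1.ne', div_mul_cancel₀ _ hs.1.ne']
    have h5 : s ^ (q / 2) = √(s ^ q) := by
      rw [Real.sqrt_eq_rpow, ← Real.rpow_mul hs.1.le]; congr 1; ring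
    rw [h5, ← Real.sqrt_mul' _ (Real.rpow_nonneg hs.1.le _)]
    exact Real.sqrt_le_sqrt (hbC s hs2)
  have h6 : μ / 2 * (√(b s) / s) ≤ μ / 2 * (√C * s ^ (q / 2 - 1)) := by
    have : 0 ≤ μ / 2 := by linarith
    gcongr
  linarith

/-- The quotient $s^\mu/b$ is nondecreasing because its derivative has the sign of $\mu b-sb'\ge0$.
-/
theorem rpow_div_le_of_rate_le {b b' : ℝ → ℝ} {r μ : ℝ}
    (hpos : ∀ s ∈ Ioc 0 r, 0 < b s) (hc : ContinuousOn b (Ioc 0 r))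
    (hd : ∀ s ∈ Ioo 0 r, HasDerivAt b (b' s) s) (hle : ∀ s ∈ Ioo 0 r, s * |b' s| ≤ μ * b s)
    {s : ℝ} (hs : s ∈ Ioc 0 r) : s ^ μ / b s ≤ r ^ μ / b r := by
  have hr : 0 < r := hs.1.trans_le hs.2
  have hmono : MonotoneOn (fun s => s ^ μ / b s) (Ioc 0 r) := by
    refine monotoneOn_of_hasDerivWithinAt_nonneg (convex_Ioc 0 r)
      (f' := fun s => (μ * s ^ (μ - 1) * b s - s ^ μ * b' s) / b s ^ 2) ?_ ?_ ?_
    · refine ContinuousOn.div (fun s hs => ?_) hc fun s hs => (hpos s hs).ne'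
      exact (Real.continuousAt_rpow_const s μ (Or.inl hs.1.ne')).continuousWithinAt
    · intro s hs
      rw [interior_Ioc] at hs
      exact ((Real.hasDerivAt_rpow_const (Or.inl hs.1.ne')).div (hd s hs)
        (hpos s ⟨hs.1, hs.2.le⟩).ne').hasDerivWithinAt
    · intro s hs
      rw [interior_Ioc] at hs
      have h1 : s ^ μ = s * s ^ (μ - 1) := by
        rw [Real.rpow_sub_one hs.1.ne']; field_simp [hs.1.ne']
      have h2 : μ * s ^ (μ - 1) * b s - s ^ μ * b' s = (μ * b s - s * b' s) * s ^ (μ - 1) := by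
        rw [h1]; ring
      rw [h2]
      have h3 : s * b' s ≤ s * |b' s| := by
        have := hs.1
        gcongr
        exact le_abs_self _
      exact div_nonneg (mul_nonneg (by linarith [hle s hs]) (Real.rpow_nonneg hs.1.le _)) (sq_nonneg _)
  exact hmono hs ⟨hr, le_rfl⟩ hs.2

theorem exists_mem_Ioo_of_ae {P : ℝ → Prop} {c d α β : ℝ}
    (h : ∀ᵐ x ∂(volume.restrict (Ioo c d)), P x) (hαβ : α < β) (hs : Ioo α β ⊆ Ioo c d) :
    ∃ x ∈ Ioo α β, P x := by
  have h1 : ∀ᵐ x ∂(volume.restrict (Ioo α β)), x ∈ Ioo α β ∧ P x :=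
    (ae_restrict_mem measurableSet_Ioo).and (ae_restrict_of_ae_restrict_of_subset hs h)
  have : (ae (volume.restrict (Ioo α β))).NeBot := by
    rw [ae_neBot, Ne, Measure.restrict_eq_zero, Real.volume_Ioo, ENNReal.ofReal_eq_zero]
    linarith
  exact h1.exists

/-- Assigning the limit as value at $1$ gives a continuous function on a compact interval.
Boundedness matters because a real `sSup` bounds its set only when that set is bounded above. -/
theorem bddAbove_image_of_tendsto {f : ℝ → ℝ} {e l : ℝ} (hf : ContinuousOn f (side e 1))
    (hl : Tendsto f (𝓝[side e 1] 1) (𝓝 l)) : BddAbove (f '' side e 1) := by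
  classical
  rcases eq_or_ne e 1 with rfl | he
  · simp [side]
  have hc : ContinuousOn (Function.update f 1 l) (uIcc e 1) := by
    rw [continuousOn_update_iff]
    exact ⟨hf, fun _ => hl⟩
  have := (isCompact_uIcc.image_of_continuousOn hc).bddAbove
  refine this.mono ?_
  rintro _ ⟨x, hx, rfl⟩
  exact ⟨x, hx.1, by rw [Function.update_of_ne hx.2]⟩

/-! ### Consequences of the hypotheses on the weight: rates, the bound by two, comparison with the
quadratic -/

namespace IsWeight

variable {a : ℝ → ℝ} {c d x₁ x₂ : ℝ}

theorem side_left (ha : IsWeight a c d x₁ x₂) : side c 1 = Ico c 1 := side_of_lt ha.c_lt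

theorem side_right (ha : IsWeight a c d x₁ x₂) : side d 1 = Ioc 1 d := side_of_gt ha.lt_d

theorem side_subset (ha : IsWeight a c d x₁ x₂) {e : ℝ} (he : e = c ∨ e = d) : side e 1 ⊆ Icc c d \ {1} := by
  rcases he with rfl | rfl
  · rw [ha.side_left]
    exact fun x hx => ⟨⟨hx.1, hx.2.le.trans ha.lt_d.le⟩, hx.2.ne⟩
  · rw [ha.side_right]
    exact fun x hx => ⟨⟨ha.c_lt.le.trans hx.1.le, hx.2⟩, hx.1.ne'⟩

theorem derivWithin_eq {x : ℝ} (hx : x ∈ Icc c d \ {1}) :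
    derivWithin a (Icc c d \ {1}) x = wt' a c d x := by
  refine derivWithin_congr_set ?_
  filter_upwards [isOpen_ne.mem_nhds hx.2] with y hy
  exact propext ⟨fun h => h.1, fun h => ⟨h, hy⟩⟩

theorem uniqueDiffOn (ha : IsWeight a c d x₁ x₂) : UniqueDiffOn ℝ (Icc c d \ {1}) :=
  (uniqueDiffOn_Icc (ha.c_lt.trans ha.lt_d)).inter isOpen_ne

theorem continuousOn_wt' (ha : IsWeight a c d x₁ x₂) :
    ContinuousOn (wt' a c d) (Icc c d \ {1}) :=
  (ha.smooth.continuousOn_derivWithin ha.uniqueDiffOn le_rfl).congr fun _ hx =>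
    (derivWithin_eq hx).symm

theorem hasDerivAt (ha : IsWeight a c d x₁ x₂) {x : ℝ} (hx : x ∈ Omega0 c d) :
    HasDerivAt a (wt' a c d x) x := by
  have hx' : x ∈ Icc c d \ {1} := ⟨Ioo_subset_Icc_self hx.1, hx.2⟩
  have h1 := (ha.smooth.differentiableOn one_ne_zero x hx').hasDerivWithinAt
  rw [derivWithin_eq hx'] at h1
  refine h1.hasDerivAt ?_
  filter_upwards [(isOpen_Ioo.sdiff isClosed_singleton).mem_nhds hx] with y hy
  exact ⟨Ioo_subset_Icc_self hy.1, hy.2⟩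

theorem uIoo_subset (ha : IsWeight a c d x₁ x₂) {e : ℝ} (he : e = c ∨ e = d) : uIoo e 1 ⊆ Omega0 c d := by
  rcases he with rfl | rfl
  · rw [uIoo_of_lt ha.c_lt]
    exact fun x hx => ⟨⟨hx.1, hx.2.trans ha.lt_d⟩, hx.2.ne⟩
  · rw [uIoo_of_gt ha.lt_d]
    exact fun x hx => ⟨⟨ha.c_lt.trans hx.1, hx.2⟩, hx.1.ne'⟩

theorem ne_one (ha : IsWeight a c d x₁ x₂) {e : ℝ} (he : e = c ∨ e = d) : e ≠ 1 := by
  rcases he with rfl | rfl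
  · exact ha.c_lt.ne
  · exact ha.lt_d.ne'

theorem continuousOn_rate_left (ha : IsWeight a c d x₁ x₂) :
    ContinuousOn (fun x => (1 - x) * |wt' a c d x| / a x) (side c 1) :=
  ((continuousOn_const.sub continuousOn_id).mul
    (ha.continuousOn_wt'.mono (ha.side_subset (.inl rfl))).abs).div
    (ha.smooth.continuousOn.mono (ha.side_subset (.inl rfl)))
    fun x hx => (ha.pos x (ha.side_subset (.inl rfl) hx)).ne'

theorem continuousOn_rate_right (ha : IsWeight a c d x₁ x₂) :
    ContinuousOn (fun x => (x - 1) * |wt' a c d x| / a x) (side d 1) :=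
  ((continuousOn_id.sub continuousOn_const).mul
    (ha.continuousOn_wt'.mono (ha.side_subset (.inr rfl))).abs).div
    (ha.smooth.continuousOn.mono (ha.side_subset (.inr rfl)))
    fun x hx => (ha.pos x (ha.side_subset (.inr rfl) hx)).ne'

theorem bddAbove_left (ha : IsWeight a c d x₁ x₂) :
    BddAbove ((fun x => (1 - x) * |wt' a c d x| / a x) '' Ico c 1) := by
  have := bddAbove_image_of_tendsto ha.continuousOn_rate_left
    (by rw [nhdsWithin_side_of_lt ha.c_lt]; exact ha.lim_left)
  rwa [ha.side_left] at this

theorem bddAbove_right (ha : IsWeight a c d x₁ x₂) :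
    BddAbove ((fun x => (x - 1) * |wt' a c d x| / a x) '' Ioc 1 d) := by
  have := bddAbove_image_of_tendsto ha.continuousOn_rate_right
    (by rw [nhdsWithin_side_of_gt ha.lt_d]; exact ha.lim_right)
  rwa [ha.side_right] at this

theorem rate_le_kappa1 (ha : IsWeight a c d x₁ x₂) {x : ℝ} (hx : x ∈ Ico c 1) :
    (1 - x) * |wt' a c d x| / a x ≤ kappa1 a c d x₁ * mu1 a c d x₁ := by
  rw [kappa1, div_mul_cancel₀ _ ha.mu1_pos.ne']
  exact le_csSup ha.bddAbove_left ⟨x, hx, rfl⟩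

theorem rate_le_kappa2 (ha : IsWeight a c d x₁ x₂) {x : ℝ} (hx : x ∈ Ioc 1 d) :
    (x - 1) * |wt' a c d x| / a x ≤ kappa2 a c d x₂ * mu2 a c d x₂ := by
  rw [kappa2, div_mul_cancel₀ _ ha.mu2_pos.ne']
  exact le_csSup ha.bddAbove_right ⟨x, hx, rfl⟩

theorem rate_le_mu1 (ha : IsWeight a c d x₁ x₂) {x : ℝ} (hx : x ∈ Ico x₁ 1) :
    (1 - x) * |wt' a c d x| / a x ≤ mu1 a c d x₁ :=
  le_csSup (ha.bddAbove_left.mono (image_mono (Ico_subset_Ico_left ha.x₁_mem.1))) ⟨x, hx, rfl⟩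

theorem rate_le_mu2 (ha : IsWeight a c d x₁ x₂) {x : ℝ} (hx : x ∈ Ioc 1 x₂) :
    (x - 1) * |wt' a c d x| / a x ≤ mu2 a c d x₂ :=
  le_csSup (ha.bddAbove_right.mono (image_mono (Ioc_subset_Ioc_right ha.x₂_mem.2))) ⟨x, hx, rfl⟩

theorem abs_rate_le (ha : IsWeight a c d x₁ x₂) {x : ℝ} (hx : x ∈ Icc c d \ {1}) :
    |(x - 1) * wt' a c d x / a x| ≤
    max (kappa1 a c d x₁ * mu1 a c d x₁) (kappa2 a c d x₂ * mu2 a c d x₂) := by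
  rw [abs_div, abs_mul, abs_of_pos (ha.pos x hx)]
  rcases lt_or_gt_of_ne (mem_compl_singleton_iff.1 hx.2) with h | h
  · rw [abs_of_neg (by linarith), neg_sub]
    exact (ha.rate_le_kappa1 ⟨hx.1.1, h⟩).trans (le_max_left _ _)
  · rw [abs_of_pos (by linarith)]
    exact (ha.rate_le_kappa2 ⟨h, hx.1.2⟩).trans (le_max_right _ _)

theorem exists_le_abs_deriv_sqrt (ha : IsWeight a c d x₁ x₂) : ∃ m : ℝ, 0 < m ∧
    ∀ᵐ x ∂(volume.restrict (Ioo c d)), m ≤ |deriv (fun z => √(a z)) x| := by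
  obtain ⟨h1, h2⟩ := ha.sqrt_inv_bdd
  have h3 := h2.2
  rw [eLpNorm_exponent_top] at h3
  set M := eLpNormEssSup (fun x => (deriv (fun z => √(a z)) x)⁻¹) (volume.restrict (Ioo c d))
  have h4 := ae_le_eLpNormEssSup (f := fun x => (deriv (fun z => √(a z)) x)⁻¹)
    (μ := volume.restrict (Ioo c d))
  -- Adding $1$ to the essential supremum keeps the constant positive without having to exclude
  -- $M=0$.
  refine ⟨(M.toReal + 1)⁻¹, by positivity, ?_⟩
  filter_upwards [h1, h4] with x hx hx4
  have h5 : |deriv (fun z => √(a z)) x|⁻¹ ≤ M.toReal := by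
    have := (ENNReal.toReal_le_toReal enorm_ne_top h3.ne).2 hx4
    rwa [toReal_enorm, Real.norm_eq_abs, abs_inv] at this
  exact inv_le_of_inv_le₀ (abs_pos.2 hx) (h5.trans (by linarith))

theorem deriv_sqrt (ha : IsWeight a c d x₁ x₂) {x : ℝ} (hx : x ∈ Omega0 c d) :
    deriv (fun z => √(a z)) x = wt' a c d x / (2 * √(a x)) :=
  ((ha.hasDerivAt hx).sqrt (ha.pos x ⟨Ioo_subset_Icc_self hx.1, hx.2⟩).ne').deriv

/-- The reflection $s=1-x$ moves the singular point to $0$ and turns the decreasing branch of `a`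
into an increasing one, so that `rate_le_two` and `rpow_div_le_of_rate_le` apply. -/
theorem mul_sq_le_left (ha : IsWeight a c d x₁ x₂) {s : ℝ} (hs : s ∈ Ioc 0 (1 - x₁)) : mu1 a c d x₁ ≤ 2 ∧
    s ^ mu1 a c d x₁ / a (1 - s) ≤ (1 - x₁) ^ mu1 a c d x₁ / a x₁ := by
  have hr : 0 < 1 - x₁ := by linarith [ha.x₁_mem.2]
  have hx1 := ha.x₁_mem
  have hO : ∀ s ∈ Ioo 0 (1 - x₁), 1 - s ∈ Omega0 c d := fun s hs =>
    ⟨⟨by linarith [hs.2, hx1.1], by linarith [hs.1, ha.lt_d]⟩, by simpa using hs.1.ne'⟩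
  have hI : ∀ s ∈ Ioc 0 (1 - x₁), 1 - s ∈ Icc c d \ {1} := fun s hs =>
    ⟨⟨by linarith [hs.2, hx1.1], by linarith [hs.1, ha.lt_d]⟩, by simpa using hs.1.ne'⟩
  have hd : ∀ s ∈ Ioo 0 (1 - x₁), HasDerivAt (fun s => a (1 - s)) (-wt' a c d (1 - s)) s := by
    intro s hs
    have := (ha.hasDerivAt (hO s hs)).comp s ((hasDerivAt_id s).const_sub 1)
    simpa [Function.comp_def] using this
  have hle : ∀ s ∈ Ioo 0 (1 - x₁), s * |-wt' a c d (1 - s)| ≤ mu1 a c d x₁ * a (1 - s) := by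
    intro s hs
    have := ha.rate_le_mu1 (x := 1 - s) ⟨by linarith [hs.2], by linarith [hs.1]⟩
    rw [div_le_iff₀ (ha.pos _ (hI s ⟨hs.1, hs.2.le⟩))] at this
    rw [abs_neg]
    simpa using this
  constructor
  · obtain ⟨m, hm, hms⟩ := ha.exists_le_abs_deriv_sqrt
    refine rate_le_two (b := fun s => a (1 - s)) (b' := fun s => -wt' a c d (1 - s)) hr hm
      (fun s hs => ha.pos _ (hI s ⟨hs.1, hs.2.le⟩)) hd (fun s hs => ?_) hle ?_ ?_
    · have hx : 1 - s ∈ Ioo x₁ 1 := ⟨by linarith [hs.2], by linarith [hs.1]⟩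
      have h1 : derivWithin a (Ioo x₁ 1) (1 - s) = wt' a c d (1 - s) :=
        (ha.hasDerivAt (hO s hs)).hasDerivWithinAt.derivWithin
          (isOpen_Ioo.uniqueDiffWithinAt hx)
      rw [← h1]
      have := ha.anti.derivWithin_nonpos (x := 1 - s)
      linarith
    · have hmap : Tendsto (fun s : ℝ => 1 - s) (𝓝[>] 0) (𝓝[<] 1) := by
        refine tendsto_nhdsWithin_iff.2 ⟨?_, ?_⟩
        · have : Tendsto (fun s : ℝ => 1 - s) (𝓝 0) (𝓝 (1 - 0)) := tendsto_id.const_sub 1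
          rw [sub_zero] at this
          exact this.mono_left nhdsWithin_le_nhds
        · filter_upwards [self_mem_nhdsWithin] with s hs
          have : 0 < s := hs
          simpa using this
      simpa [Function.comp_def] using ha.lim_left.comp hmap
    · intro ε hε hεr
      obtain ⟨x, hx, hmx⟩ := exists_mem_Ioo_of_ae hms (α := 1 - ε) (β := 1) (by linarith)
        (Ioo_subset_Ioo (by linarith [hx1.1]) ha.lt_d.le)
      have hxO : x ∈ Omega0 c d :=
        ⟨⟨by linarith [hx.1, hx1.1], hx.2.trans ha.lt_d⟩, hx.2.ne⟩
      refine ⟨1 - x, ⟨by linarith [hx.2], by linarith [hx.1]⟩, ?_⟩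
      rw [ha.deriv_sqrt hxO] at hmx
      simpa [neg_div, abs_neg] using hmx
  · have hmaps : ContinuousOn (fun s => a (1 - s)) (Ioc 0 (1 - x₁)) :=
      ha.smooth.continuousOn.comp (continuousOn_const.sub continuousOn_id) hI
    have := rpow_div_le_of_rate_le (b := fun s => a (1 - s)) (b' := fun s => -wt' a c d (1 - s))
      (fun s hs => ha.pos _ (hI s hs)) hmaps hd hle hs
    simpa using this

/-- The same on the other side, with the translation $s=x-1$. -/
theorem mul_sq_le_right (ha : IsWeight a c d x₁ x₂) {s : ℝ} (hs : s ∈ Ioc 0 (x₂ - 1)) : mu2 a c d x₂ ≤ 2 ∧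
    s ^ mu2 a c d x₂ / a (1 + s) ≤ (x₂ - 1) ^ mu2 a c d x₂ / a x₂ := by
  have hr : 0 < x₂ - 1 := by linarith [ha.x₂_mem.1]
  have hx2 := ha.x₂_mem
  have hO : ∀ s ∈ Ioo 0 (x₂ - 1), 1 + s ∈ Omega0 c d := fun s hs =>
    ⟨⟨by linarith [hs.1, ha.c_lt], by linarith [hs.2, hx2.2]⟩, by simpa using hs.1.ne'⟩
  have hI : ∀ s ∈ Ioc 0 (x₂ - 1), 1 + s ∈ Icc c d \ {1} := fun s hs =>
    ⟨⟨by linarith [hs.1, ha.c_lt], by linarith [hs.2, hx2.2]⟩, by simpa using hs.1.ne'⟩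
  have hd : ∀ s ∈ Ioo 0 (x₂ - 1), HasDerivAt (fun s => a (1 + s)) (wt' a c d (1 + s)) s := by
    intro s hs
    have := (ha.hasDerivAt (hO s hs)).comp s ((hasDerivAt_id s).const_add 1)
    simpa [Function.comp_def] using this
  have hle : ∀ s ∈ Ioo 0 (x₂ - 1), s * |wt' a c d (1 + s)| ≤ mu2 a c d x₂ * a (1 + s) := by
    intro s hs
    have := ha.rate_le_mu2 (x := 1 + s) ⟨by linarith [hs.1], by linarith [hs.2]⟩
    rw [div_le_iff₀ (ha.pos _ (hI s ⟨hs.1, hs.2.le⟩))] at this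
    simpa using this
  constructor
  · obtain ⟨m, hm, hms⟩ := ha.exists_le_abs_deriv_sqrt
    refine rate_le_two (b := fun s => a (1 + s)) (b' := fun s => wt' a c d (1 + s)) hr hm
      (fun s hs => ha.pos _ (hI s ⟨hs.1, hs.2.le⟩)) hd (fun s hs => ?_) hle ?_ ?_
    · have hx : 1 + s ∈ Ioo 1 x₂ := ⟨by linarith [hs.1], by linarith [hs.2]⟩
      have h1 : derivWithin a (Ioo 1 x₂) (1 + s) = wt' a c d (1 + s) :=
        (ha.hasDerivAt (hO s hs)).hasDerivWithinAt.derivWithin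
          (isOpen_Ioo.uniqueDiffWithinAt hx)
      rw [← h1]
      exact ha.mono.derivWithin_nonneg (x := 1 + s)
    · have hmap : Tendsto (fun s : ℝ => 1 + s) (𝓝[>] 0) (𝓝[>] 1) := by
        refine tendsto_nhdsWithin_iff.2 ⟨?_, ?_⟩
        · have : Tendsto (fun s : ℝ => 1 + s) (𝓝 0) (𝓝 (1 + 0)) := tendsto_id.const_add 1
          rw [add_zero] at this
          exact this.mono_left nhdsWithin_le_nhds
        · filter_upwards [self_mem_nhdsWithin] with s hs
          have : 0 < s := hs
          simpa using this
      simpa [Function.comp_def] using ha.lim_right.comp hmap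
    · intro ε hε hεr
      obtain ⟨x, hx, hmx⟩ := exists_mem_Ioo_of_ae hms (α := 1) (β := 1 + ε) (by linarith)
        (Ioo_subset_Ioo ha.c_lt.le (by linarith [hx2.2]))
      have hxO : x ∈ Omega0 c d :=
        ⟨⟨ha.c_lt.trans hx.1, by linarith [hx.2, hx2.2]⟩, hx.1.ne'⟩
      refine ⟨x - 1, ⟨by linarith [hx.1], by linarith [hx.2]⟩, ?_⟩
      rw [ha.deriv_sqrt hxO] at hmx
      simpa using hmx
  · have hmaps : ContinuousOn (fun s => a (1 + s)) (Ioc 0 (x₂ - 1)) :=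
      ha.smooth.continuousOn.comp (continuousOn_const.add continuousOn_id) hI
    have := rpow_div_le_of_rate_le (b := fun s => a (1 + s)) (b' := fun s => wt' a c d (1 + s))
      (fun s hs => ha.pos _ (hI s hs)) hmaps hd hle hs
    simpa using this

theorem sq_le_rpow {s μ : ℝ} (hs0 : 0 < s) (hs1 : s ≤ 1) (hμ : μ ≤ 2) : s ^ 2 ≤ s ^ μ := by
  rw [← Real.rpow_two]
  exact Real.rpow_le_rpow_of_exponent_ge hs0 hs1 hμ

theorem sInf_pos_le (ha : IsWeight a c d x₁ x₂) {α β x : ℝ} (hαβ : Icc α β ⊆ Icc c d \ {1}) (hx : x ∈ Icc α β) :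
    0 < sInf (a '' Icc α β) ∧ sInf (a '' Icc α β) ≤ a x := by
  have hK : IsCompact (a '' Icc α β) :=
    isCompact_Icc.image_of_continuousOn (ha.smooth.continuousOn.mono hαβ)
  obtain ⟨z, hz, hze⟩ := hK.sInf_mem ⟨_, x, hx, rfl⟩
  exact ⟨hze ▸ ha.pos z (hαβ hz), csInf_le hK.bddBelow ⟨x, hx, rfl⟩⟩

/-- Each side splits into two zones, which account for the four entries of $C_a^2$. Away from $1$,
`a` is bounded below by its minimum. Near $1$, the quotient of $|x-1|^{\mu}$ by `a` is largest at
the far end of the zone. The exponent is lowered from $2$ to $\mu_i$ using $\mu_i\le2$ and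
$|x-1|\le1$, hence $0\le c$ and $d\le2$. -/
theorem sq_le (ha : IsWeight a c d x₁ x₂) {x : ℝ} (hx : x ∈ Icc c d \ {1}) : (x - 1) ^ 2 ≤ CaSq a c d x₁ x₂ / 4 * a x := by
  have hax := ha.pos x hx
  have hC : CaSq a c d x₁ x₂ / 4 = max
    (max ((1 - c) ^ mu1 a c d x₁ / sInf (a '' Icc c x₁)) ((1 - x₁) ^ mu1 a c d x₁ / a x₁))
    (max ((d - 1) ^ mu2 a c d x₂ / sInf (a '' Icc x₂ d)) ((x₂ - 1) ^ mu2 a c d x₂ / a x₂)) := by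
    rw [CaSq]; ring
  rw [hC, ← div_le_iff₀ hax]
  have h0 := ha.c_nonneg
  have h2 := ha.d_le
  have hx1 := ha.x₁_mem
  have hx2 := ha.x₂_mem
  rcases lt_or_gt_of_ne (mem_compl_singleton_iff.1 hx.2) with h | h
  · refine le_trans ?_ (le_max_left _ _)
    have hμ := (ha.mul_sq_le_left (s := 1 - x₁) ⟨by linarith [hx1.2], le_rfl⟩).1
    have hsq := sq_le_rpow (s := 1 - x) (by linarith) (by linarith [hx.1.1]) hμ
    rw [show (x - 1) ^ 2 = (1 - x) ^ 2 by ring]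
    rcases le_total x x₁ with hxx | hxx
    · refine le_trans ?_ (le_max_left _ _)
      obtain ⟨hp, hl⟩ := ha.sInf_pos_le (α := c) (β := x₁) (fun y hy =>
        ⟨⟨hy.1, by linarith [hy.2, hx1.2, ha.lt_d]⟩, (hy.2.trans_lt hx1.2).ne⟩) ⟨hx.1.1, hxx⟩
      have : (1 - x) ^ mu1 a c d x₁ ≤ (1 - c) ^ mu1 a c d x₁ :=
        Real.rpow_le_rpow (by linarith) (by linarith [hx.1.1]) ha.mu1_pos.le
      have h3 := hsq.trans this
      exact div_le_div₀ ((sq_nonneg _).trans h3) h3 hp hl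
    · refine le_trans ?_ (le_max_right _ _)
      have := (ha.mul_sq_le_left (s := 1 - x) ⟨by linarith, by linarith⟩).2
      rw [sub_sub_cancel] at this
      exact le_trans (by gcongr) this
  · refine le_trans ?_ (le_max_right _ _)
    have hμ := (ha.mul_sq_le_right (s := x₂ - 1) ⟨by linarith [hx2.1], le_rfl⟩).1
    have hsq := sq_le_rpow (s := x - 1) (by linarith) (by linarith [hx.1.2]) hμ
    rcases le_total x₂ x with hxx | hxx
    · refine le_trans ?_ (le_max_left _ _)
      obtain ⟨hp, hl⟩ := ha.sInf_pos_le (α := x₂) (β := d) (fun y hy =>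
        ⟨⟨by linarith [hy.1, hx2.1, ha.c_lt], hy.2⟩, (hx2.1.trans_le hy.1).ne'⟩) ⟨hxx, hx.1.2⟩
      have : (x - 1) ^ mu2 a c d x₂ ≤ (d - 1) ^ mu2 a c d x₂ :=
        Real.rpow_le_rpow (by linarith) (by linarith [hx.1.2]) ha.mu2_pos.le
      have h3 := hsq.trans this
      exact div_le_div₀ ((sq_nonneg _).trans h3) h3 hp hl
    · refine le_trans ?_ (le_max_right _ _)
      have := (ha.mul_sq_le_right (s := x - 1) ⟨by linarith, by linarith⟩).2
      rw [add_sub_cancel] at this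
      exact le_trans (by gcongr) this

end IsWeight

/-! ### Continuous representatives -/

theorem restrict_Omega0 (c d : ℝ) :
    (volume : Measure ℝ).restrict (Omega0 c d) = volume.restrict (Ioo c d) :=
  Measure.restrict_congr_set (sdiff_null_ae_eq_self (measure_singleton 1))

theorem isOpen_Omega0 (c d : ℝ) : IsOpen (Omega0 c d) := isOpen_Ioo.sdiff isClosed_singleton

theorem Omega0_subset (c d : ℝ) : Omega0 c d ⊆ Icc c d \ {1} := fun _ hx =>
  ⟨Ioo_subset_Icc_self hx.1, hx.2⟩

/-- This makes a.e. equality of continuous functions into equality up to the endpoints `c` and `d`,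
where the boundary values are read. -/
theorem subset_closure_interior {c d : ℝ} (hc : c < 1) (hd : 1 < d) :
    Icc c d \ {1} ⊆ closure (interior (Icc c d \ {1})) := by
  have h1 : Omega0 c d ⊆ interior (Icc c d \ {1}) :=
    interior_maximal (Omega0_subset c d) (isOpen_Omega0 c d)
  refine Subset.trans ?_ (closure_mono h1)
  intro x hx
  rcases lt_or_gt_of_ne (mem_compl_singleton_iff.1 hx.2) with h | h
  · have : Ioo c 1 ⊆ Omega0 c d := fun y hy => ⟨⟨hy.1, hy.2.trans hd⟩, hy.2.ne⟩
    refine closure_mono this ?_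
    rw [closure_Ioo hc.ne]
    exact ⟨hx.1.1, h.le⟩
  · have : Ioo 1 d ⊆ Omega0 c d := fun y hy => ⟨⟨hc.trans hy.1, hy.2⟩, hy.1.ne'⟩
    refine closure_mono this ?_
    rw [closure_Ioo hd.ne]
    exact ⟨h.le, hx.1.2⟩

theorem ae_restrict_Icc_sdiff {c d : ℝ} {f g : ℝ → ℝ} (h : f =ᵐ[volume.restrict (Ioo c d)] g) :
    f =ᵐ[volume.restrict (Icc c d \ {1})] g := by
  have : (volume : Measure ℝ).restrict (Icc c d \ {1}) = volume.restrict (Ioo c d) :=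
    Measure.restrict_congr_set
      ((sdiff_null_ae_eq_self (measure_singleton 1)).trans Ioo_ae_eq_Icc.symm)
  rwa [this]

/-- Shows that the choice in `crep` is immaterial: any continuous candidate computes its values on
$[c,d]\setminus\{1\}$. -/
theorem crep_spec {c d : ℝ} (hc : c < 1) (hd : 1 < d) {f q : ℝ → ℝ}
    (hq : ContinuousOn q (Icc c d \ {1})) (hfq : f =ᵐ[volume.restrict (Ioo c d)] q) :
    ContinuousOn (crep c d f) (Icc c d \ {1}) ∧ f =ᵐ[volume.restrict (Ioo c d)] crep c d f ∧
      EqOn (crep c d f) q (Icc c d \ {1}) := by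
  have hex : ∃ q : ℝ → ℝ, ContinuousOn q (Icc c d \ {1}) ∧ f =ᵐ[volume.restrict (Ioo c d)] q :=
    ⟨q, hq, hfq⟩
  have h1 : crep c d f = hex.choose := dif_pos hex
  have h2 := hex.choose_spec
  rw [← h1] at h2
  exact ⟨h2.1, h2.2, Measure.eqOn_of_ae_eq (ae_restrict_Icc_sdiff (h2.2.symm.trans hfq)) h2.1 hq
    (subset_closure_interior hc hd)⟩

theorem wderiv_spec {c d : ℝ} {u g : ℝ → ℝ} (h : HasWeakDerivOn (Omega0 c d) u g) :
    HasWeakDerivOn (Omega0 c d) u (wderiv c d u) ∧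
      wderiv c d u =ᵐ[volume.restrict (Ioo c d)] g := by
  have hex : ∃ g, HasWeakDerivOn (Omega0 c d) u g := ⟨g, h⟩
  have h1 : wderiv c d u = hex.choose := dif_pos hex
  have h2 := hex.choose_spec
  rw [← h1] at h2
  refine ⟨h2, ?_⟩
  rw [← restrict_Omega0]
  exact h2.unique (isOpen_Omega0 c d) h

theorem intervalIntegrable_iff_uIoo {f : ℝ → ℝ} {x y : ℝ} :
    IntervalIntegrable f volume x y ↔ IntegrableOn f (uIoo x y) := by
  rcases le_total x y with h | h
  · rw [intervalIntegrable_iff_integrableOn_Ioo_of_le h, uIoo_of_le h]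
  · rw [intervalIntegrable_iff, uIoc_of_ge h, uIoo_of_ge h, integrableOn_Ioc_iff_integrableOn_Ioo]

/-- Cauchy–Schwarz against the constant $1$, from nonnegativity of the integral of
$(h-\text{mean})^2$. -/
theorem sq_integral_le {s : Set ℝ} {h : ℝ → ℝ} (hs : volume s ≠ ⊤)
    (hh : MemLp h 2 (volume.restrict s)) :
    (∫ x in s, h x) ^ 2 ≤ volume.real s * ∫ x in s, h x ^ 2 := by
  have : IsFiniteMeasure (volume.restrict s) := ⟨by simpa using hs.lt_top⟩
  have hi : Integrable h (volume.restrict s) := hh.integrable (by norm_num)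
  have hi2 : Integrable (fun x => h x ^ 2) (volume.restrict s) := hh.integrable_sq
  set l := volume.real s with hl
  set m := ∫ x in s, h x with hm
  have hl0 : 0 ≤ l := measureReal_nonneg
  rcases hl0.eq_or_lt with h0 | h0
  · have : volume s = 0 := by
      have := (measureReal_eq_zero_iff hs).1 (hl ▸ h0.symm)
      exact this
    have hm0 : m = 0 := by rw [hm, setIntegral_measure_zero _ this]
    rw [hm0, ← h0]; simp
  · have h1 : 0 ≤ ∫ x in s, (h x - m / l) ^ 2 := integral_nonneg fun x => sq_nonneg _
    have h2 : ∫ x in s, (h x - m / l) ^ 2 = (∫ x in s, h x ^ 2) - m ^ 2 / l := by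
      have e : (fun x => (h x - m / l) ^ 2) = fun x => h x ^ 2 - 2 * (m / l) * h x + (m / l) ^ 2 := by
        ext x; ring
      have hi3 : Integrable (fun x => h x ^ 2 - 2 * (m / l) * h x) (volume.restrict s) :=
        hi2.sub (hi.const_mul _)
      rw [e, integral_add hi3 (integrable_const _),
        integral_sub hi2 (hi.const_mul _), integral_const_mul, ← hm]
      simp only [integral_const, measureReal_restrict_apply_univ, ← hl, smul_eq_mul]
      field_simp
      ring
    rw [h2, sub_nonneg, div_le_iff₀ h0] at h1
    linarith

/-! ### Continuous representatives in the weighted spaces and of the flux -/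

section

variable {a : ℝ → ℝ} {c d x₁ x₂ : ℝ}

theorem IsWeight.intervalIntegrable_inv (ha : IsWeight a c d x₁ x₂) {e x : ℝ} (he : e = c ∨ e = d)
    (hx : x ∈ side e 1) : IntervalIntegrable (fun x => 1 / a x) volume e x := by
  have hs := (uIcc_subset_side hx).trans (ha.side_subset he)
  exact (continuousOn_const.div (ha.smooth.continuousOn.mono hs)
    fun y hy => (ha.pos y (hs hy)).ne').intervalIntegrable

theorem IsWeight.uIoo_subset_of_mem_side (ha : IsWeight a c d x₁ x₂) {e x : ℝ} (he : e = c ∨ e = d)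
    (hx : x ∈ side e 1) : uIoo e x ⊆ Omega0 c d := by
  rcases he with rfl | rfl
  · rw [ha.side_left] at hx
    rw [uIoo_of_le hx.1]
    exact fun y hy => ⟨⟨hy.1, (hy.2.trans hx.2).trans ha.lt_d⟩, (hy.2.trans hx.2).ne⟩
  · rw [ha.side_right] at hx
    rw [uIoo_of_ge hx.2]
    exact fun y hy => ⟨⟨ha.c_lt.trans (hx.1.trans hy.1), hy.2⟩, (hx.1.trans hy.1).ne'⟩

theorem IsWeight.aemeasurable (ha : IsWeight a c d x₁ x₂) :
    AEMeasurable a (volume.restrict (Ioo c d)) :=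
  (ha.cont.mono Ioo_subset_Icc_self).aemeasurable measurableSet_Ioo

/-- Where `1/a` is integrable, so is every function of `L²(a dx)`. -/
theorem IsWeight.integrableOn_of_inv (ha : IsWeight a c d x₁ x₂) {s : Set ℝ} {g : ℝ → ℝ}
    (hs : MeasurableSet s) (hsO : s ⊆ Ioo c d) (hinv : IntegrableOn (fun x => 1 / a x) s)
    (hgm : AEStronglyMeasurable g (volume.restrict (Ioo c d)))
    (hg : IntegrableOn (fun x => a x * g x ^ 2) (Ioo c d)) : IntegrableOn g s := by
  refine Integrable.mono' (hinv.add (hg.mono_set hsO))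
    (hgm.mono_measure (Measure.restrict_mono hsO le_rfl)) ?_
  have hne : ∀ᵐ x : ℝ, x ≠ 1 := by simp [ae_iff]
  filter_upwards [ae_restrict_of_ae hne, ae_restrict_mem hs] with x hx1 hx
  have hax := ha.pos x ⟨Ioo_subset_Icc_self (hsO hx), hx1⟩
  simp only [Pi.add_apply, Real.norm_eq_abs]
  -- Expanding this square gives $2|g|\le ag^2+1/a$.
  have h1 : 0 ≤ (1 / a x) * (a x * |g x| - 1) ^ 2 := by positivity
  have h2 : (1 / a x) * (a x * |g x| - 1) ^ 2 = a x * g x ^ 2 - 2 * |g x| + 1 / a x := by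
    rw [← sq_abs (g x)]; field_simp; ring
  have h3 := abs_nonneg (g x)
  linarith

theorem HasWeakDerivOn.aestronglyMeasurable {u g : ℝ → ℝ} (h : HasWeakDerivOn (Omega0 c d) u g) :
    AEStronglyMeasurable g (volume.restrict (Ioo c d)) := by
  rw [← restrict_Omega0]
  exact h.2.1.aestronglyMeasurable

/-- The continuous representative of a function with a weak derivative on `Ω₀`. -/
theorem IsWeight.crep_isPrimitive (ha : IsWeight a c d x₁ x₂) {u g : ℝ → ℝ}
    (hu : HasWeakDerivOn (Omega0 c d) u g)
    (hg : ∀ e, e = c ∨ e = d → ∀ x ∈ side e 1, IntervalIntegrable g volume e x) :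
    ContinuousOn (crep c d u) (Icc c d \ {1}) ∧ u =ᵐ[volume.restrict (Ioo c d)] crep c d u ∧
      ∀ e, e = c ∨ e = d → IsPrimitive e 1 (crep c d u) g := by
  have key : ∀ e, e = c ∨ e = d → ∃ p, IsPrimitive e 1 p g ∧ ∀ᵐ x, x ∈ uIoo e 1 → u x = p x :=
    fun e he => (hu.mono (ha.uIoo_subset he)).exists_isPrimitive (ha.ne_one he) (hg e he)
  obtain ⟨p, hp, hpu⟩ := key c (.inl rfl)
  obtain ⟨r, hr, hru⟩ := key d (.inr rfl)
  rw [uIoo_of_lt ha.c_lt] at hpu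
  rw [uIoo_of_gt ha.lt_d] at hru
  -- The two one-sided primitives are glued; the value at $1$ plays no role.
  let q : ℝ → ℝ := fun x => if x < 1 then p x else r x
  have hqp : EqOn p q (side c 1) := by
    intro x hx
    rw [ha.side_left] at hx
    simp [q, hx.2]
  have hqr : EqOn r q (side d 1) := by
    intro x hx
    rw [ha.side_right] at hx
    simp [q, hx.1.le]
  have hq : ContinuousOn q (Icc c d \ {1}) := by
    intro x hx
    rcases lt_or_gt_of_ne (mem_compl_singleton_iff.1 hx.2) with h | h
    · have hxs : x ∈ side c 1 := by rw [ha.side_left]; exact ⟨hx.1.1, h⟩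
      have := (hp.continuousOn.congr hqp.symm) x hxs
      refine this.mono_of_mem_nhdsWithin ?_
      filter_upwards [self_mem_nhdsWithin, nhdsWithin_le_nhds (Iio_mem_nhds h)] with y hy hy1
      rw [ha.side_left]
      exact ⟨hy.1.1, hy1⟩
    · have hxs : x ∈ side d 1 := by rw [ha.side_right]; exact ⟨h, hx.1.2⟩
      have := (hr.continuousOn.congr hqr.symm) x hxs
      refine this.mono_of_mem_nhdsWithin ?_
      filter_upwards [self_mem_nhdsWithin, nhdsWithin_le_nhds (Ioi_mem_nhds h)] with y hy hy1
      rw [ha.side_right]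
      exact ⟨hy1, hy.1.2⟩
  have huq : u =ᵐ[volume.restrict (Ioo c d)] q := by
    rw [← restrict_Omega0, Filter.EventuallyEq, ae_restrict_iff' (isOpen_Omega0 c d).measurableSet]
    filter_upwards [hpu, hru] with x h1 h2 hx
    rcases lt_or_gt_of_ne (mem_compl_singleton_iff.1 hx.2) with h | h
    · simp [q, h, h1 ⟨hx.1.1, h⟩]
    · simp [q, h.le, h2 ⟨h, hx.1.2⟩]
  obtain ⟨h1, h2, h3⟩ := crep_spec ha.c_lt ha.lt_d hq huq
  refine ⟨h1, h2, ?_⟩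
  rintro e (rfl | rfl)
  · exact hp.congr fun x hx => (hqp hx).trans (h3 (ha.side_subset (.inl rfl) hx)).symm
  · exact hr.congr fun x hx => (hqr hx).trans (h3 (ha.side_subset (.inr rfl) hx)).symm

/-- The continuous representative of a function with an integrable weak derivative on `Ω`. -/
theorem IsWeight.crep_of_integrable (ha : IsWeight a c d x₁ x₂) {u g : ℝ → ℝ}
    (hu : HasWeakDerivOn (Ioo c d) u g) (hg : IntegrableOn g (Ioo c d)) :
    (∃ l, Tendsto (crep c d u) (𝓝[<] 1) (𝓝 l) ∧ Tendsto (crep c d u) (𝓝[>] 1) (𝓝 l)) ∧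
      crep c d u d - crep c d u c = ∫ x in Ioo c d, g x := by
  have hcd : c < d := ha.c_lt.trans ha.lt_d
  have hgi : IntervalIntegrable g volume c d :=
    (intervalIntegrable_iff_integrableOn_Ioo_of_le hcd.le).2 hg
  obtain ⟨p, hp, hpu⟩ := HasWeakDerivOn.exists_isPrimitive (e := c) (b := d) hcd.ne
    (by rwa [uIoo_of_lt hcd]) fun x hx => hgi.mono_set (uIcc_subset_uIcc left_mem_uIcc hx.1)
  rw [uIoo_of_lt hcd] at hpu
  set P : ℝ → ℝ := fun x => p c + ∫ t in c..x, g t with hP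
  have hPc : ContinuousOn P (Icc c d) := by
    have := intervalIntegral.continuousOn_primitive_interval' hgi left_mem_uIcc
    rw [uIcc_of_le hcd.le] at this
    exact this.const_add (p c)
  have huP : u =ᵐ[volume.restrict (Ioo c d)] P := by
    rw [Filter.EventuallyEq, ae_restrict_iff' measurableSet_Ioo]
    filter_upwards [hpu] with x hx hxI
    rw [hx hxI, (hp x (uIoo_subset_side (by rwa [uIoo_of_lt hcd]))).2]
  obtain ⟨h1, h2, h3⟩ := crep_spec ha.c_lt ha.lt_d (hPc.mono sdiff_subset) huP
  have h1m : Icc c d ∈ 𝓝 (1 : ℝ) := Icc_mem_nhds ha.c_lt ha.lt_d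
  have hPt : Tendsto P (𝓝 1) (𝓝 (P 1)) := hPc.continuousAt h1m
  have hne : Tendsto (crep c d u) (𝓝[≠] 1) (𝓝 (P 1)) := by
    refine (hPt.mono_left nhdsWithin_le_nhds).congr' ?_
    filter_upwards [self_mem_nhdsWithin, nhdsWithin_le_nhds h1m] with x hx hxI
    exact (h3 ⟨hxI, hx⟩).symm
  refine ⟨⟨P 1, hne.mono_left (nhdsWithin_mono _ fun x hx => ne_of_lt hx),
    hne.mono_left (nhdsWithin_mono _ fun x hx => ne_of_gt hx)⟩, ?_⟩
  rw [h3 ⟨right_mem_Icc.2 hcd.le, ha.lt_d.ne'⟩, h3 ⟨left_mem_Icc.2 hcd.le, ha.c_lt.ne⟩, hP]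
  simp [intervalIntegral.integral_of_le hcd.le, integral_Ioc_eq_integral_Ioo]

/-- The witness `g` may be replaced by the canonical `wderiv`, as both are derivatives on $\Omega_0$
and so agree a.e. -/
theorem MemW1a.spec {u : L2 c d} (hu : MemW1a a c d u) :
    HasWeakDerivOn (Omega0 c d) u (wderiv c d u) ∧
      IntegrableOn (fun x => a x * wderiv c d u x ^ 2) (Ioo c d) ∧
      (WeakDegeneration a c d → HasWeakDerivOn (Ioo c d) u (wderiv c d u)) := by
  obtain ⟨g, h1, h2, h3⟩ := hu
  obtain ⟨h4, h5⟩ := wderiv_spec h1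
  refine ⟨h4, h2.congr ?_, fun hw => (h3 hw).congr EventuallyEq.rfl h5.symm⟩
  filter_upwards [h5] with x hx
  rw [hx]

/-- Between an endpoint and a point short of $1$ the function $1/a$ is continuous, so
`integrableOn_of_inv` applies whether or not $1/a\in L^1(\Omega)$. -/
theorem IsWeight.intervalIntegrable_wderiv (ha : IsWeight a c d x₁ x₂) {u : L2 c d}
    (hu : MemW1a a c d u) {e x : ℝ} (he : e = c ∨ e = d) (hx : x ∈ side e 1) :
    IntervalIntegrable (wderiv c d u) volume e x := by
  obtain ⟨h1, h2, -⟩ := hu.spec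
  rw [intervalIntegrable_iff_uIoo]
  exact ha.integrableOn_of_inv measurableSet_Ioo
    ((ha.uIoo_subset_of_mem_side he hx).trans sdiff_subset)
    (intervalIntegrable_iff_uIoo.1 (ha.intervalIntegrable_inv he hx)) h1.aestronglyMeasurable h2

theorem IsWeight.crep_of_memW1a (ha : IsWeight a c d x₁ x₂) {u : L2 c d} (hu : MemW1a a c d u) :
    ContinuousOn (crep c d u) (Icc c d \ {1}) ∧ u =ᵐ[volume.restrict (Ioo c d)] crep c d u ∧
      ∀ e, e = c ∨ e = d → IsPrimitive e 1 (crep c d u) (wderiv c d u) :=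
  ha.crep_isPrimitive hu.spec.1 fun _ he _ hx => ha.intervalIntegrable_wderiv hu he hx

theorem IsWeight.crep_of_weak (ha : IsWeight a c d x₁ x₂) (hw : WeakDegeneration a c d)
    {u : L2 c d} (hu : MemW1a a c d u) :
    (∃ l, Tendsto (crep c d u) (𝓝[<] 1) (𝓝 l) ∧ Tendsto (crep c d u) (𝓝[>] 1) (𝓝 l)) ∧
      crep c d u d - crep c d u c = ∫ x in Ioo c d, wderiv c d u x := by
  obtain ⟨h1, h2, h3⟩ := hu.spec
  exact ha.crep_of_integrable (h3 hw)
    (ha.integrableOn_of_inv measurableSet_Ioo subset_rfl hw h1.aestronglyMeasurable h2)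

theorem IsWeight.crep_of_memLp (ha : IsWeight a c d x₁ x₂) {f g : ℝ → ℝ}
    (hf : HasWeakDerivOn (Ioo c d) f g) (hg : MemLp g 2 (volume.restrict (Ioo c d))) :
    ContinuousOn (crep c d f) (Icc c d \ {1}) ∧ f =ᵐ[volume.restrict (Ioo c d)] crep c d f ∧
      (∀ e, e = c ∨ e = d → IsPrimitive e 1 (crep c d f) g) ∧
      ∃ l, Tendsto (crep c d f) (𝓝[<] 1) (𝓝 l) ∧ Tendsto (crep c d f) (𝓝[>] 1) (𝓝 l) := by
  have hgi : IntegrableOn g (Ioo c d) := hg.integrable (by norm_num)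
  obtain ⟨h1, h2, h3⟩ := ha.crep_isPrimitive (hf.mono sdiff_subset) fun e he x hx =>
    intervalIntegrable_iff_uIoo.2
      (hgi.mono_set ((ha.uIoo_subset_of_mem_side he hx).trans sdiff_subset))
  exact ⟨h1, h2, h3, (ha.crep_of_integrable hf hgi).1⟩

/-- The values of `u_x` are those of the flux divided by the weight. -/
theorem IsWeight.crep_wderiv (ha : IsWeight a c d x₁ x₂) {u : ℝ → ℝ} {q : ℝ → ℝ}
    (hq : ContinuousOn q (Icc c d \ {1})) (hfq : flux a c d u =ᵐ[volume.restrict (Ioo c d)] q) :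
    EqOn (crep c d (wderiv c d u)) (fun x => q x / a x) (Icc c d \ {1}) := by
  refine (crep_spec ha.c_lt ha.lt_d (hq.div ha.smooth.continuousOn
    fun x hx => (ha.pos x hx).ne') ?_).2.2
  have hne : ∀ᵐ x : ℝ, x ≠ 1 := by simp [ae_iff]
  filter_upwards [hfq, ae_restrict_of_ae hne, ae_restrict_mem measurableSet_Ioo] with x hx h1 h2
  have := (ha.pos x ⟨Ioo_subset_Icc_self h2, h1⟩).ne'
  rw [Pi.div_apply, ← hx, flux]
  field_simp

end

/-! ### The multiplier identity on one side of the singular point -/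

/-- Serves the case $1/a\notin L^1$ of skew symmetry, with `p` the velocity, perhaps unbounded at
$1$, and `q` the flux. The product has a limit because its derivative is integrable. Cauchy–Schwarz
gives $q^2\le K|x-1|$, so $(pq)^2/(x-1)$ is dominated by $Kp^2$ and the limit must be zero. -/
theorem IsPrimitive.tendsto_mul_zero {e : ℝ} (he : e ≠ 1) {p g q h : ℝ → ℝ}
    (hp : IsPrimitive e 1 p g) (hq : IsPrimitive e 1 q h)
    (hi : IntervalIntegrable (fun t => g t * q t + p t * h t) volume e 1)
    (hh : MemLp h 2 (volume.restrict (uIoc e 1))) (hq0 : Tendsto q (𝓝[side e 1] 1) (𝓝 0))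
    (hp2 : IntervalIntegrable (fun x => p x ^ 2) volume e 1) :
    Tendsto (fun x => p x * q x) (𝓝[side e 1] 1) (𝓝 0) := by
  have : IsFiniteMeasure (volume.restrict (uIoc e 1)) := ⟨by simp [uIoc]⟩
  have hlim := (hp.mul hq).tendsto hi
  set L := p e * q e + ∫ t in e..1, (g t * q t + p t * h t)
  have hhi : IntervalIntegrable h volume e 1 :=
    intervalIntegrable_iff.2 (hh.integrable (by norm_num))
  have hne : (𝓝[side e 1] (1 : ℝ)).NeBot := by
    rcases lt_or_gt_of_ne he with h | h
    · rw [nhdsWithin_side_of_lt h]; infer_instance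
    · rw [nhdsWithin_side_of_gt h]; infer_instance
  have hq1 := tendsto_nhds_unique (hq.tendsto hhi) hq0
  set K := ∫ x in uIoc e 1, h x ^ 2 with hK
  have hqb : ∀ x ∈ side e 1, q x ^ 2 ≤ |x - 1| * K := by
    intro x hx
    have hsub : uIoc x 1 ⊆ uIoc e 1 := by
      rw [uIoc_comm x, uIoc_comm e]
      exact uIoc_subset_uIoc_of_uIcc_subset_uIcc (uIcc_subset_uIcc left_mem_uIcc (uIcc_comm e 1 ▸ hx.1))
    have h1 : q x = -∫ t in x..1, h t := by
      have hx1 : IntervalIntegrable h volume x 1 := (hq x hx).1.symm.trans hhi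
      have := intervalIntegral.integral_add_adjacent_intervals (hq x hx).1 hx1
      rw [(hq x hx).2]; linarith
    have h2 : q x ^ 2 = (∫ t in uIoc x 1, h t) ^ 2 := by
      rw [h1, intervalIntegral.intervalIntegral_eq_integral_uIoc]
      split_ifs <;> simp
    rw [h2]
    refine (sq_integral_le (by simp [uIoc]) (hh.mono_measure (Measure.restrict_mono hsub le_rfl))).trans ?_
    have h3 : volume.real (uIoc x 1) = |x - 1| := by
      rw [uIoc, Real.volume_real_Ioc, max_sub_min_eq_abs, max_eq_left (abs_nonneg _), abs_sub_comm]
    rw [h3, hK]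
    refine mul_le_mul_of_nonneg_left ?_ (abs_nonneg _)
    exact setIntegral_mono_set hh.integrable_sq (Eventually.of_forall fun _ => sq_nonneg _)
      (Eventually.of_forall hsub)
  have hw : IntervalIntegrable (fun x => (p x * q x) ^ 2 / (x - 1)) volume e 1 := by
    rw [intervalIntegrable_iff_uIoo] at hp2 ⊢
    have hco : ContinuousOn (fun x => (p x * q x) ^ 2 / (x - 1)) (uIoo e 1) := by
      refine ContinuousOn.div (((hp.continuousOn.mul hq.continuousOn).pow 2).mono
        uIoo_subset_side) (by fun_prop) fun x hx => ?_
      exact sub_ne_zero.2 (uIoo_subset_side hx).2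
    refine Integrable.mono' (hp2.const_mul K) (hco.aestronglyMeasurable measurableSet_Ioo) ?_
    filter_upwards [ae_restrict_mem measurableSet_Ioo] with x hx
    have hxs : x ∈ side e 1 := uIoo_subset_side hx
    have hx1 : 0 < |x - 1| := abs_pos.2 (sub_ne_zero.2 hxs.2)
    rw [norm_div, Real.norm_eq_abs, Real.norm_eq_abs, abs_of_nonneg (sq_nonneg _),
      div_le_iff₀ hx1, mul_pow]
    have := mul_le_mul_of_nonneg_left (hqb x hxs) (sq_nonneg (p x))
    linarith
  have hL := eq_zero_of_tendsto_of_intervalIntegrable_div he (hlim.pow 2) hw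
  rw [pow_eq_zero_iff two_ne_zero] at hL
  rwa [hL] at hlim

variable {a : ℝ → ℝ} {c d x₁ x₂ : ℝ}

/-- Away from $1$ the weight is $C^1$, so the quotient rule applies; its numerator produces the
coefficient $1-(x-1)a'/a$ of the identity. -/
theorem IsWeight.isPrimitive_multiplier (ha : IsWeight a c d x₁ x₂) {e : ℝ} (he : e = c ∨ e = d) :
    IsPrimitive e 1 (fun x => (x - 1) / a x)
      (fun x => (1 - (x - 1) * wt' a c d x / a x) / a x) := by
  have hs := ha.side_subset he
  have hne : ∀ x ∈ side e 1, a x ≠ 0 := fun x hx => (ha.pos x (hs hx)).ne'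
  have hac : ContinuousOn a (side e 1) := ha.smooth.continuousOn.mono hs
  refine IsPrimitive.of_hasDerivAt (ContinuousOn.div (by fun_prop) hac hne) (fun x hx => ?_) ?_
  · have h1 := ((hasDerivAt_id x).sub_const 1).div (ha.hasDerivAt (ha.uIoo_subset he hx))
      (hne x (uIoo_subset_side hx))
    refine h1.congr_deriv ?_
    have := hne x (uIoo_subset_side hx)
    simp only [id]
    field_simp
  · refine ContinuousOn.div (continuousOn_const.sub (ContinuousOn.div ?_ hac hne)) hac hne
    exact (continuousOn_id.sub continuousOn_const).mul (ha.continuousOn_wt'.mono hs)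

/-- The integrand is the derivative of $(x-1)p^2$, which vanishes at `e` since $p(e)=0$, and at $1$
since its quotient by $x-1$ is the integrable $p^2$. -/
theorem integral_mul_sq_side {e : ℝ} (he : e ≠ 1) {p g : ℝ → ℝ} (hp : IsPrimitive e 1 p g)
    (hp0 : p e = 0) (hp2 : IntervalIntegrable (fun x => p x ^ 2) volume e 1)
    (hpg : IntervalIntegrable (fun x => 2 * (x - 1) * g x * p x) volume e 1) :
    ∫ x in e..1, (2 * (x - 1) * g x * p x + p x ^ 2) = 0 := by
  have h1 : IsPrimitive e 1 (fun x => x - 1) (fun _ => 1) :=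
    IsPrimitive.of_hasDerivAt (by fun_prop) (fun x _ => (hasDerivAt_id x).sub_const 1)
      (by fun_prop)
  have h2 := (h1.mul (hp.mul hp)).congr_deriv
    (h := fun x => 2 * (x - 1) * g x * p x + p x ^ 2)
    (Eventually.of_forall fun x _ => by ring)
  have hdiv : IntervalIntegrable (fun x => (x - 1) * (p x * p x) / (x - 1)) volume e 1 := by
    refine hp2.congr_ae ?_
    have hne : ∀ᵐ x : ℝ, x ≠ 1 := by simp [ae_iff]
    filter_upwards [ae_restrict_of_ae hne] with x hx
    have := sub_ne_zero.2 hx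
    field_simp
  have := (h2.tendsto_zero he (hpg.add hp2) hdiv).1
  rw [this]
  simp [hp0]

/-- The integrand is the derivative of $\frac{x-1}{a}q^2$. It vanishes at $1$ because its quotient
by $x-1$ is the integrable $q^2/a$, so only the value at `e` remains. -/
theorem IsWeight.integral_flux_side (ha : IsWeight a c d x₁ x₂) {e : ℝ} (he : e = c ∨ e = d)
    {q h : ℝ → ℝ} (hq : IsPrimitive e 1 q h)
    (hq2 : IntervalIntegrable (fun x => q x ^ 2 / a x) volume e 1)
    (hρ : IntervalIntegrable (fun x => (1 - (x - 1) * wt' a c d x / a x) * (q x ^ 2 / a x))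
      volume e 1)
    (hqh : IntervalIntegrable (fun x => 2 * ((x - 1) / a x) * q x * h x) volume e 1) :
    ∫ x in e..1, (2 * ((x - 1) / a x) * q x * h x +
      (1 - (x - 1) * wt' a c d x / a x) * (q x ^ 2 / a x)) = (1 - e) / a e * q e ^ 2 := by
  have h2 := ((ha.isPrimitive_multiplier he).mul (hq.mul hq)).congr_deriv
    (h := fun x => 2 * ((x - 1) / a x) * q x * h x +
      (1 - (x - 1) * wt' a c d x / a x) * (q x ^ 2 / a x))
    (Eventually.of_forall fun x _ => by ring)
  have hdiv : IntervalIntegrable (fun x => (x - 1) / a x * (q x * q x) / (x - 1)) volume e 1 := by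
    refine hq2.congr_ae ?_
    have hne : ∀ᵐ x : ℝ, x ≠ 1 := by simp [ae_iff]
    filter_upwards [ae_restrict_of_ae hne] with x hx
    have := sub_ne_zero.2 hx
    field_simp
  have := (h2.tendsto_zero (ha.ne_one he) (hqh.add hρ) hdiv).1
  rw [this]
  ring

theorem IsWeight.intervalIntegrable_side (ha : IsWeight a c d x₁ x₂) {e : ℝ} (he : e = c ∨ e = d)
    {f : ℝ → ℝ} (hf : Integrable f (volume.restrict (Ioo c d))) :
    IntervalIntegrable f volume e 1 :=
  intervalIntegrable_iff_uIoo.2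
    (IntegrableOn.mono_set hf ((ha.uIoo_subset he).trans sdiff_subset))

/-- Both one-sided integrals run from the outer endpoint towards $1$, so that the lemmas on `side`
serve for both; this accounts for the minus sign. -/
theorem IsWeight.integral_eq_sides (ha : IsWeight a c d x₁ x₂) {f : ℝ → ℝ}
    (hf : Integrable f (volume.restrict (Ioo c d))) :
    ∫ x in Ioo c d, f x = (∫ x in c..1, f x) - ∫ x in d..1, f x := by
  have h1 := ha.intervalIntegrable_side (.inl rfl) hf
  have h2 := ha.intervalIntegrable_side (.inr rfl) hf
  rw [← integral_Ioc_eq_integral_Ioo, ← intervalIntegral.integral_of_le (ha.c_lt.trans ha.lt_d).le,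
    ← intervalIntegral.integral_add_adjacent_intervals h1 h2.symm,
    intervalIntegral.integral_symm d 1, ← sub_eq_add_neg]

/-! ### Square integrability and bounded multipliers -/

theorem integrable_bdd_mul_mul {w f g : ℝ → ℝ} {K : ℝ} {μ : Measure ℝ}
    (hw : AEStronglyMeasurable w μ) (hK : ∀ᵐ x ∂μ, |w x| ≤ K) (hf : MemLp f 2 μ)
    (hg : MemLp g 2 μ) : Integrable (fun x => w x * (f x * g x)) μ :=
  (hf.integrable_mul hg).bdd_mul hw hK

theorem IsWeight.ae_mem (ha : IsWeight a c d x₁ x₂) :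
    ∀ᵐ x ∂(volume.restrict (Ioo c d)), x ∈ Icc c d \ {1} ∧ 0 < a x := by
  have hne : ∀ᵐ x : ℝ, x ≠ 1 := by simp [ae_iff]
  filter_upwards [ae_restrict_of_ae hne, ae_restrict_mem measurableSet_Ioo] with x h1 h2
  exact ⟨⟨Ioo_subset_Icc_self h2, h1⟩, ha.pos x ⟨Ioo_subset_Icc_self h2, h1⟩⟩

/-- The multiplier `(x - 1) / √a`. -/
def wmul (a : ℝ → ℝ) (x : ℝ) : ℝ := (x - 1) / √(a x)

/-- The coefficient `1 - (x - 1) a' / a`. -/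
def qmul (a : ℝ → ℝ) (c d x : ℝ) : ℝ := 1 - (x - 1) * wt' a c d x / a x

theorem aestronglyMeasurable_of_continuousOn {f : ℝ → ℝ}
    (hf : ContinuousOn f (Icc c d \ {1})) : AEStronglyMeasurable f (volume.restrict (Ioo c d)) := by
  rw [← restrict_Omega0]
  exact (hf.mono (Omega0_subset c d)).aestronglyMeasurable (isOpen_Omega0 c d).measurableSet

theorem IsWeight.wmul_meas (ha : IsWeight a c d x₁ x₂) :
    AEStronglyMeasurable (wmul a) (volume.restrict (Ioo c d)) :=
  aestronglyMeasurable_of_continuousOn (ContinuousOn.div (by fun_prop)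
    ha.smooth.continuousOn.sqrt fun x hx => (Real.sqrt_pos.2 (ha.pos x hx)).ne')

theorem IsWeight.qmul_meas (ha : IsWeight a c d x₁ x₂) :
    AEStronglyMeasurable (qmul a c d) (volume.restrict (Ioo c d)) :=
  aestronglyMeasurable_of_continuousOn (continuousOn_const.sub (ContinuousOn.div
    ((continuousOn_id.sub continuousOn_const).mul ha.continuousOn_wt') ha.smooth.continuousOn
    fun x hx => (ha.pos x hx).ne'))

theorem IsWeight.wmul_sq_le (ha : IsWeight a c d x₁ x₂) {x : ℝ} (hx : x ∈ Icc c d \ {1}) :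
    wmul a x ^ 2 ≤ CaSq a c d x₁ x₂ / 4 := by
  have hax := ha.pos x hx
  rw [wmul, div_pow, Real.sq_sqrt hax.le, div_le_iff₀ hax]
  exact ha.sq_le hx

theorem IsWeight.wmul_le (ha : IsWeight a c d x₁ x₂) :
    ∀ᵐ x ∂(volume.restrict (Ioo c d)), |wmul a x| ≤ √(CaSq a c d x₁ x₂ / 4) := by
  filter_upwards [ha.ae_mem] with x hx
  exact Real.abs_le_sqrt (ha.wmul_sq_le hx.1)

/-- The constant `max κᵢ μᵢ`. -/
def kapMax (a : ℝ → ℝ) (c d x₁ x₂ : ℝ) : ℝ :=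
  max (kappa1 a c d x₁ * mu1 a c d x₁) (kappa2 a c d x₂ * mu2 a c d x₂)

theorem IsWeight.qmul_le (ha : IsWeight a c d x₁ x₂) :
    ∀ᵐ x ∂(volume.restrict (Ioo c d)), |qmul a c d x| ≤ 1 + kapMax a c d x₁ x₂ := by
  filter_upwards [ha.ae_mem] with x hx
  refine (abs_sub _ _).trans ?_
  rw [abs_one]
  exact add_le_add le_rfl (ha.abs_rate_le hx.1)

theorem IsWeight.memLp_sqrt_mul_wderiv (ha : IsWeight a c d x₁ x₂) {u : L2 c d}
    (hu : MemW1a a c d u) :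
    MemLp (fun x => √(a x) * wderiv c d u x) 2 (volume.restrict (Ioo c d)) := by
  obtain ⟨h1, h2, -⟩ := hu.spec
  refine (memLp_two_iff_integrable_sq ?_).2 ?_
  · exact (ha.aemeasurable.sqrt.aestronglyMeasurable).mul h1.aestronglyMeasurable
  · refine Integrable.congr h2 ?_
    filter_upwards [ha.ae_mem] with x hx
    rw [mul_pow, Real.sq_sqrt hx.2.le]

/-! ### Identities in the domain of the wave operator -/

theorem L2.memLp (f : L2 c d) : MemLp f 2 (volume.restrict (Ioo c d)) := Lp.memLp f

/-- The integrand is a.e. the derivative of $v\cdot au_x$ on each side. Since $v(c)=v(d)=0$, the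
integral is the difference of the one-sided limits of this product at $1$. -/
theorem IsWeight.skew (ha : IsWeight a c d x₁ x₂) {u v g : L2 c d} (hu : MemW1a a c d u)
    (hv : MemW1a0 a c d v) (hT : Transmission a u)
    (hg : HasWeakDerivOn (Ioo c d) (flux a c d u) g) :
    ∫ x in Ioo c d, (√(a x) * wderiv c d u x * (√(a x) * wderiv c d v x) + v x * g x) = 0 := by
  obtain ⟨hv1, hvc, hvd⟩ := hv
  obtain ⟨-, p2, p3⟩ := ha.crep_of_memW1a hv1
  obtain ⟨-, q2, q3, lq, hql, hqr⟩ := ha.crep_of_memLp hg (L2.memLp g)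
  set p := crep c d v
  set q := crep c d (flux a c d u)
  set G := wderiv c d v
  have mu := ha.memLp_sqrt_mul_wderiv hu
  have mv := ha.memLp_sqrt_mul_wderiv hv1
  have i0 : Integrable (fun x => √(a x) * wderiv c d u x * (√(a x) * wderiv c d v x) + v x * g x)
      (volume.restrict (Ioo c d)) :=
    (mu.integrable_mul mv).add ((L2.memLp v).integrable_mul (L2.memLp g))
  have e0 : (fun x => √(a x) * wderiv c d u x * (√(a x) * wderiv c d v x) + v x * g x)
      =ᵐ[volume.restrict (Ioo c d)] fun x => G x * q x + p x * g x := by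
    filter_upwards [p2, q2, ha.ae_mem] with x hp hq hx
    rw [← hp, ← hq, flux]
    have := Real.mul_self_sqrt hx.2.le
    linear_combination wderiv c d u x * wderiv c d v x * this
  have i1 := i0.congr e0
  rw [integral_congr_ae e0, ha.integral_eq_sides i1]
  have lim : ∀ e, e = c ∨ e = d → Tendsto (fun x => p x * q x) (𝓝[side e 1] 1)
      (𝓝 (∫ x in e..1, (G x * q x + p x * g x))) := by
    intro e he
    have := ((p3 e he).mul (q3 e he)).tendsto (ha.intervalIntegrable_side he i1)
    have hpe : p e = 0 := by rcases he with rfl | rfl <;> assumption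
    simpa [hpe] using this
  have limc := lim c (.inl rfl)
  have limd := lim d (.inr rfl)
  rw [nhdsWithin_side_of_lt ha.c_lt] at limc
  rw [nhdsWithin_side_of_gt ha.lt_d] at limd
  suffices ∃ L, Tendsto (fun x => p x * q x) (𝓝[<] 1) (𝓝 L) ∧
      Tendsto (fun x => p x * q x) (𝓝[>] 1) (𝓝 L) by
    obtain ⟨L, hL1, hL2⟩ := this
    rw [tendsto_nhds_unique limc hL1, tendsto_nhds_unique limd hL2, sub_self]
  -- If $1/a\in L^1$, both `v` and the flux have a common limit from the two sides. Otherwise the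
  -- transmission condition makes the flux vanish at $1$, and the product with it.
  by_cases hw : WeakDegeneration a c d
  · obtain ⟨lp, hpl, hpr⟩ := (ha.crep_of_weak hw hv1).1
    exact ⟨lp * lq, hpl.mul hql, hpr.mul hqr⟩
  · obtain ⟨-, h1, h2⟩ := hT.2 hw
    have key : ∀ e, e = c ∨ e = d → Tendsto q (𝓝[side e 1] 1) (𝓝 0) →
        Tendsto (fun x => p x * q x) (𝓝[side e 1] 1) (𝓝 0) := by
      intro e he hq0
      refine (p3 e he).tendsto_mul_zero (ha.ne_one he) (q3 e he)
        (ha.intervalIntegrable_side he i1) ?_ hq0 (ha.intervalIntegrable_side he ?_)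
      · have : (volume : Measure ℝ).restrict (uIoc e 1) ≤ volume.restrict (Ioo c d) := by
          have h3 : (volume : Measure ℝ).restrict (uIoc e 1) = volume.restrict (uIoo e 1) :=
            Measure.restrict_congr_set Ioo_ae_eq_Ioc.symm
          rw [h3]
          exact Measure.restrict_mono ((ha.uIoo_subset he).trans sdiff_subset) le_rfl
        exact (L2.memLp g).mono_measure this
      · refine (L2.memLp v).integrable_sq.congr ?_
        filter_upwards [p2] with x hx
        rw [hx]
    have k1 := key c (.inl rfl) (by rw [nhdsWithin_side_of_lt ha.c_lt]; exact h1)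
    have k2 := key d (.inr rfl) (by rw [nhdsWithin_side_of_gt ha.lt_d]; exact h2)
    rw [nhdsWithin_side_of_lt ha.c_lt] at k1
    rw [nhdsWithin_side_of_gt ha.lt_d] at k2
    exact ⟨0, k1, k2⟩

theorem IsWeight.normalDeriv_eq (ha : IsWeight a c d x₁ x₂) {u g : L2 c d}
    (hg : HasWeakDerivOn (Ioo c d) (flux a c d u) g) {e : ℝ} (he : e = c ∨ e = d) :
    normalDeriv u e = crep c d (flux a c d u) e / a e := by
  obtain ⟨q1, q2, -, -⟩ := ha.crep_of_memLp hg (L2.memLp g)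
  exact ha.crep_wderiv q1 q2 (ha.side_subset he (left_mem_side (ha.ne_one he)))

/-- The sum of two exact identities: `t1`, from $(x-1)v^2$, and `t2`, from $\frac{x-1}{a}q^2$ with
$q=au_x$. At `c` and `d` the normal derivative is $q/a$, which converts the boundary values in `t3`.
-/
theorem IsWeight.multiplier (ha : IsWeight a c d x₁ x₂) {u v g : L2 c d} (hu : MemW1a a c d u)
    (hv : MemW1a0 a c d v) (hg : HasWeakDerivOn (Ioo c d) (flux a c d u) g) :
    (1 - c) * a c * normalDeriv u c ^ 2 + (d - 1) * a d * normalDeriv u d ^ 2 =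
      2 * (∫ x in Ioo c d, wmul a x * (√(a x) * wderiv c d v x * v x)) +
      2 * (∫ x in Ioo c d, wmul a x * (√(a x) * wderiv c d u x * g x)) +
      ((∫ x in Ioo c d, v x * v x) + ∫ x in Ioo c d,
        qmul a c d x * (√(a x) * wderiv c d u x * (√(a x) * wderiv c d u x))) := by
  obtain ⟨hv1, hvc, hvd⟩ := hv
  obtain ⟨-, p2, p3⟩ := ha.crep_of_memW1a hv1
  obtain ⟨-, q2, q3, -⟩ := ha.crep_of_memLp hg (L2.memLp g)
  rw [ha.normalDeriv_eq hg (.inl rfl), ha.normalDeriv_eq hg (.inr rfl)]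
  set p := crep c d v
  set q := crep c d (flux a c d u)
  set G := wderiv c d v
  have mu := ha.memLp_sqrt_mul_wderiv hu
  have mv := ha.memLp_sqrt_mul_wderiv hv1
  have i1 := (integrable_bdd_mul_mul ha.wmul_meas ha.wmul_le mv (L2.memLp v)).const_mul 2
  have i2 := (integrable_bdd_mul_mul ha.wmul_meas ha.wmul_le mu (L2.memLp g)).const_mul 2
  have i3 := (L2.memLp v).integrable_mul (L2.memLp v)
  have i4 := integrable_bdd_mul_mul ha.qmul_meas ha.qmul_le mu mu
  have e1 : (fun x => 2 * (wmul a x * (√(a x) * wderiv c d v x * v x)))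
      =ᵐ[volume.restrict (Ioo c d)] fun x => 2 * (x - 1) * G x * p x := by
    filter_upwards [p2, ha.ae_mem] with x hp hx
    rw [← hp, wmul]
    have := Real.sqrt_pos.2 hx.2
    simp only [G]
    field_simp
  have e2 : (fun x => 2 * (wmul a x * (√(a x) * wderiv c d u x * g x)))
      =ᵐ[volume.restrict (Ioo c d)] fun x => 2 * ((x - 1) / a x) * q x * g x := by
    filter_upwards [q2, ha.ae_mem] with x hq hx
    rw [← hq, wmul, flux]
    have := Real.sqrt_pos.2 hx.2
    have := hx.2
    field_simp
  have e3 : (fun x => v x * v x) =ᵐ[volume.restrict (Ioo c d)] fun x => p x ^ 2 := by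
    filter_upwards [p2] with x hp
    rw [← hp, sq]
  have e5 : (fun x => √(a x) * wderiv c d u x * (√(a x) * wderiv c d u x))
      =ᵐ[volume.restrict (Ioo c d)] fun x => q x ^ 2 / a x := by
    filter_upwards [q2, ha.ae_mem] with x hq hx
    rw [← hq, flux]
    have h1 := hx.2.ne'
    have h2 := Real.mul_self_sqrt hx.2.le
    rw [eq_div_iff h1]
    linear_combination a x * wderiv c d u x ^ 2 * h2
  have e4 : (fun x => qmul a c d x * (√(a x) * wderiv c d u x * (√(a x) * wderiv c d u x)))
      =ᵐ[volume.restrict (Ioo c d)]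
      fun x => (1 - (x - 1) * wt' a c d x / a x) * (q x ^ 2 / a x) := by
    filter_upwards [e5] with x hx
    rw [hx, qmul]
  have i5 := (mu.integrable_mul mu).congr e5
  have j1 := i1.congr e1
  have j2 := i2.congr e2
  have j3 := Integrable.congr i3 e3
  have j4 := i4.congr e4
  rw [← integral_const_mul, ← integral_const_mul, integral_congr_ae e1, integral_congr_ae e2,
    integral_congr_ae e3, integral_congr_ae e4]
  have t1 : (∫ x in Ioo c d, 2 * (x - 1) * G x * p x) + ∫ x in Ioo c d, p x ^ 2 = 0 := by
    have k : Integrable (fun x => 2 * (x - 1) * G x * p x + p x ^ 2)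
        (volume.restrict (Ioo c d)) := j1.add j3
    rw [← integral_add j1 j3, ha.integral_eq_sides k,
      integral_mul_sq_side ha.c_lt.ne (p3 c (.inl rfl)) hvc
        (ha.intervalIntegrable_side (.inl rfl) j3) (ha.intervalIntegrable_side (.inl rfl) j1),
      integral_mul_sq_side ha.lt_d.ne' (p3 d (.inr rfl)) hvd
        (ha.intervalIntegrable_side (.inr rfl) j3) (ha.intervalIntegrable_side (.inr rfl) j1),
      sub_self]
  have t2 : (∫ x in Ioo c d, 2 * ((x - 1) / a x) * q x * g x) +
      (∫ x in Ioo c d, (1 - (x - 1) * wt' a c d x / a x) * (q x ^ 2 / a x)) =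
      (1 - c) / a c * q c ^ 2 - (1 - d) / a d * q d ^ 2 := by
    have k : Integrable (fun x => 2 * ((x - 1) / a x) * q x * g x +
        (1 - (x - 1) * wt' a c d x / a x) * (q x ^ 2 / a x)) (volume.restrict (Ioo c d)) :=
      j2.add j4
    rw [← integral_add j2 j4, ha.integral_eq_sides k,
      ha.integral_flux_side (.inl rfl) (q3 c (.inl rfl)) (ha.intervalIntegrable_side (.inl rfl) i5)
        (ha.intervalIntegrable_side (.inl rfl) j4) (ha.intervalIntegrable_side (.inl rfl) j2),
      ha.integral_flux_side (.inr rfl) (q3 d (.inr rfl)) (ha.intervalIntegrable_side (.inr rfl) i5)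
        (ha.intervalIntegrable_side (.inr rfl) j4) (ha.intervalIntegrable_side (.inr rfl) j2)]
  have hac := (ha.pos c (ha.side_subset (.inl rfl) (left_mem_side ha.c_lt.ne))).ne'
  have had := (ha.pos d (ha.side_subset (.inr rfl) (left_mem_side ha.lt_d.ne'))).ne'
  have t3 : (1 - c) * a c * (q c / a c) ^ 2 + (d - 1) * a d * (q d / a d) ^ 2 =
      (1 - c) / a c * q c ^ 2 - (1 - d) / a d * q d ^ 2 := by
    field_simp
    ring
  rw [t3]
  linarith

/-! ### The state space as a subspace of `L² × L²` -/

theorem wderiv_add {u v : L2 c d} (hu : MemW1a a c d u) (hv : MemW1a a c d v) :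
    wderiv c d (u + v : L2 c d) =ᵐ[volume.restrict (Ioo c d)]
      fun x => wderiv c d u x + wderiv c d v x := by
  refine (wderiv_spec ((hu.spec.1.add hv.spec.1).congr ?_ EventuallyEq.rfl)).2
  rw [restrict_Omega0]
  filter_upwards [Lp.coeFn_add u v] with x hx
  rw [hx, Pi.add_apply]

theorem wderiv_smul {u : L2 c d} (hu : MemW1a a c d u) (k : ℝ) :
    wderiv c d (k • u : L2 c d) =ᵐ[volume.restrict (Ioo c d)] fun x => k * wderiv c d u x := by
  refine (wderiv_spec ((hu.spec.1.const_mul k).congr ?_ EventuallyEq.rfl)).2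
  rw [restrict_Omega0]
  filter_upwards [Lp.coeFn_smul k u] with x hx
  rw [hx, Pi.smul_apply, smul_eq_mul]

/-- The linear map `u ↦ √a u_x`. -/
def sqrtDeriv (ha : IsWeight a c d x₁ x₂) {V : Submodule ℝ (L2 c d)}
    (hVW : ∀ u ∈ V, MemW1a0 a c d u) : V →ₗ[ℝ] L2 c d where
  toFun u := (ha.memLp_sqrt_mul_wderiv (hVW u u.2).1).toLp _
  map_add' u v := by
    rw [← MemLp.toLp_add]
    refine MemLp.toLp_congr _ _ ?_
    filter_upwards [wderiv_add (hVW u u.2).1 (hVW v v.2).1] with x hx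
    rw [Submodule.coe_add, hx, Pi.add_apply]
    ring
  map_smul' k u := by
    rw [RingHom.id_apply, ← MemLp.toLp_const_smul]
    refine MemLp.toLp_congr _ _ ?_
    filter_upwards [wderiv_smul (hVW u u.2).1 k] with x hx
    rw [Submodule.coe_smul, hx, Pi.smul_apply, smul_eq_mul]
    ring

/-- The linear map `(u, v) ↦ (√a u_x, v)`. -/
def stateMap (ha : IsWeight a c d x₁ x₂) {V : Submodule ℝ (L2 c d)}
    (hVW : ∀ u ∈ V, MemW1a0 a c d u) : V × L2 c d →ₗ[ℝ] WithLp 2 (L2 c d × L2 c d) :=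
  (WithLp.linearEquiv 2 ℝ (L2 c d × L2 c d)).symm.toLinearMap ∘ₗ
    (sqrtDeriv ha hVW).prodMap LinearMap.id

section
variable (ha : IsWeight a c d x₁ x₂) {V : Submodule ℝ (L2 c d)} (hVW : ∀ u ∈ V, MemW1a0 a c d u)

theorem stateMap_fst (U : V × L2 c d) : ((stateMap ha hVW U).fst : ℝ → ℝ)
    =ᵐ[volume.restrict (Ioo c d)] fun x => √(a x) * wderiv c d (U.1 : L2 c d) x :=
  (ha.memLp_sqrt_mul_wderiv (hVW U.1 U.1.2).1).coeFn_toLp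

theorem stateMap_snd (U : V × L2 c d) : (stateMap ha hVW U).snd = U.2 := rfl

end

theorem inner_L2 (f g : L2 c d) : inner ℝ f g = ∫ x in Ioo c d, f x * g x := by
  rw [L2.inner_def]
  refine integral_congr_ae (Eventually.of_forall fun x => ?_)
  simp [mul_comm]

theorem norm_sq_L2 (f : L2 c d) : ‖f‖ ^ 2 = ∫ x in Ioo c d, f x * f x := by
  rw [← real_inner_self_eq_norm_sq, inner_L2]

theorem norm_sq_state (x : WithLp 2 (L2 c d × L2 c d)) :
    ‖x‖ ^ 2 = ‖x.fst‖ ^ 2 + ‖x.snd‖ ^ 2 := by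
  rw [WithLp.prod_norm_eq_of_L2, Real.sq_sqrt (by positivity)]

theorem norm_sq_stateMap (ha : IsWeight a c d x₁ x₂) {V : Submodule ℝ (L2 c d)}
    (hVW : ∀ u ∈ V, MemW1a0 a c d u) (U : V × L2 c d) : ‖stateMap ha hVW U‖ ^ 2 =
      (∫ x in Omega0 c d, U.2 x ^ 2) +
        ∫ x in Omega0 c d, a x * wderiv c d (U.1 : L2 c d) x ^ 2 := by
  rw [norm_sq_state, restrict_Omega0, norm_sq_L2, norm_sq_L2, stateMap_snd, add_comm]
  congr 1
  · simp only [sq]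
  · refine integral_congr_ae ?_
    filter_upwards [stateMap_fst ha hVW U, ha.ae_mem] with x hx hax
    rw [hx]
    have := Real.mul_self_sqrt hax.2.le
    linear_combination wderiv c d (U.1 : L2 c d) x ^ 2 * this

theorem haNorm_eq (ha : IsWeight a c d x₁ x₂) {V : Submodule ℝ (L2 c d)}
    (hVW : ∀ u ∈ V, MemW1a0 a c d u) (U : V × L2 c d) :
    haNorm a c d U.1 U.2 = ‖stateMap ha hVW U‖ := by
  rw [haNorm, ← norm_sq_stateMap ha hVW U, Real.sqrt_sq (norm_nonneg _)]

theorem energy_eq (ha : IsWeight a c d x₁ x₂) {V : Submodule ℝ (L2 c d)}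
    (hVW : ∀ u ∈ V, MemW1a0 a c d u) (U : V × L2 c d) :
    energy a c d U.1 U.2 = 1 / 2 * ‖stateMap ha hVW U‖ ^ 2 := by
  rw [energy, norm_sq_stateMap ha hVW U, integral_add]
  · rw [restrict_Omega0]; exact (L2.memLp U.2).integrable_sq
  · rw [restrict_Omega0]; exact (hVW U.1 U.1.2).1.spec.2.1

/-! ### The quadratic forms of the multiplier identity -/

/-- Multiplication by a bounded function, on `L²(Ω)`. -/
def mulOp {w : ℝ → ℝ} (hw : MemLp w ⊤ (volume.restrict (Ioo c d))) : L2 c d →L[ℝ] L2 c d :=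
  (ContinuousLinearMap.mul ℝ ℝ).holderL (volume.restrict (Ioo c d)) ⊤ 2 2 (hw.toLp w)

theorem mulOp_apply {w : ℝ → ℝ} (hw : MemLp w ⊤ (volume.restrict (Ioo c d))) (f : L2 c d) :
    (mulOp hw f : ℝ → ℝ) =ᵐ[volume.restrict (Ioo c d)] fun x => w x * f x := by
  have h1 := (ContinuousLinearMap.mul ℝ ℝ).coeFn_holder (r := 2) (hw.toLp w) f
  filter_upwards [h1, hw.coeFn_toLp] with x hx hwx
  refine hx.trans ?_
  rw [hwx]
  rfl

theorem IsWeight.wmul_memLp (ha : IsWeight a c d x₁ x₂) :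
    MemLp (wmul a) ⊤ (volume.restrict (Ioo c d)) := memLp_top_of_bound ha.wmul_meas _ ha.wmul_le

theorem IsWeight.qmul_memLp (ha : IsWeight a c d x₁ x₂) :
    MemLp (qmul a c d) ⊤ (volume.restrict (Ioo c d)) :=
  memLp_top_of_bound ha.qmul_meas _ ha.qmul_le

/-- The bilinear form `∫ f g` on `L²(Ω)`. -/
def pairing (c d : ℝ) : L2 c d →L[ℝ] L2 c d →L[ℝ] ℝ :=
  (ContinuousLinearMap.mul ℝ ℝ).lpPairing (volume.restrict (Ioo c d)) 2 2

theorem pairing_apply (f g : L2 c d) : pairing c d f g = inner ℝ f g := by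
  rw [inner_L2]
  exact ContinuousLinearMap.lpPairing_eq_integral _ _ _

/-- The bilinear form `2 ∫ (x - 1) / √a X₁ Y₂`. -/
def crossForm (ha : IsWeight a c d x₁ x₂) :
    WithLp 2 (L2 c d × L2 c d) →L[ℝ] WithLp 2 (L2 c d × L2 c d) →L[ℝ] ℝ :=
  (2 : ℝ) • (pairing c d).bilinearComp
    (mulOp ha.wmul_memLp ∘L WithLp.fstL 2 ℝ (L2 c d) (L2 c d)) (WithLp.sndL 2 ℝ (L2 c d) (L2 c d))

/-- The bilinear form `∫ X₂ Y₂ + ∫ (1 - (x - 1) a' / a) X₁ Y₁`. -/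
def densityForm (ha : IsWeight a c d x₁ x₂) :
    WithLp 2 (L2 c d × L2 c d) →L[ℝ] WithLp 2 (L2 c d × L2 c d) →L[ℝ] ℝ :=
  (pairing c d).bilinearComp (WithLp.sndL 2 ℝ (L2 c d) (L2 c d))
      (WithLp.sndL 2 ℝ (L2 c d) (L2 c d)) +
    (pairing c d).bilinearComp (mulOp ha.qmul_memLp ∘L WithLp.fstL 2 ℝ (L2 c d) (L2 c d))
      (WithLp.fstL 2 ℝ (L2 c d) (L2 c d))

theorem inner_mulOp {w : ℝ → ℝ} (hw : MemLp w ⊤ (volume.restrict (Ioo c d))) (f g : L2 c d) :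
    inner ℝ (mulOp hw f) g = ∫ x in Ioo c d, w x * (f x * g x) := by
  rw [inner_L2]
  refine integral_congr_ae ?_
  filter_upwards [mulOp_apply hw f] with x hx
  rw [hx, mul_assoc]

theorem crossForm_eq_inner (ha : IsWeight a c d x₁ x₂) (x y : WithLp 2 (L2 c d × L2 c d)) :
    crossForm ha x y = 2 * inner ℝ (mulOp ha.wmul_memLp x.fst) y.snd := by
  rw [← pairing_apply]
  rfl

theorem crossForm_apply (ha : IsWeight a c d x₁ x₂) (x y : WithLp 2 (L2 c d × L2 c d)) :
    crossForm ha x y = 2 * ∫ t in Ioo c d, wmul a t * (x.fst t * y.snd t) := by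
  rw [crossForm_eq_inner, inner_mulOp]

theorem densityForm_apply (ha : IsWeight a c d x₁ x₂) (x y : WithLp 2 (L2 c d × L2 c d)) :
    densityForm ha x y = (∫ t in Ioo c d, x.snd t * y.snd t) +
      ∫ t in Ioo c d, qmul a c d t * (x.fst t * y.fst t) := by
  rw [← inner_mulOp ha.qmul_memLp, ← inner_L2, ← pairing_apply, ← pairing_apply]
  rfl

theorem IsWeight.kapMax_nonneg (ha : IsWeight a c d x₁ x₂) : 0 ≤ kapMax a c d x₁ x₂ :=
  (abs_nonneg _).trans (ha.abs_rate_le (ha.side_subset (.inl rfl) (left_mem_side ha.c_lt.ne)))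

/-- Young's inequality, with $(x-1)^2/a\le C_a^2/4$ for the first component. The $4$ in the maximum
covers the coefficient $1$ of the second. -/
theorem abs_crossForm_le (ha : IsWeight a c d x₁ x₂) (x : WithLp 2 (L2 c d × L2 c d)) :
    |crossForm ha x x| ≤ max 4 (CaSq a c d x₁ x₂) / 4 * ‖x‖ ^ 2 := by
  have h1 : ‖mulOp ha.wmul_memLp x.fst‖ ^ 2 ≤ CaSq a c d x₁ x₂ / 4 * ‖x.fst‖ ^ 2 := by
    rw [norm_sq_L2, norm_sq_L2, ← integral_const_mul]
    refine integral_mono_ae ((L2.memLp _).integrable_mul (L2.memLp _))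
      (((L2.memLp _).integrable_mul (L2.memLp _)).const_mul _) ?_
    filter_upwards [mulOp_apply ha.wmul_memLp x.fst, ha.ae_mem] with t ht hat
    rw [ht]
    have := mul_le_mul_of_nonneg_right (ha.wmul_sq_le hat.1) (mul_self_nonneg (x.fst t))
    linarith
  have h3 := abs_real_inner_le_norm (mulOp ha.wmul_memLp x.fst) x.snd
  rw [crossForm_eq_inner, abs_mul, abs_two, norm_sq_state]
  have h4 := two_mul_le_add_sq ‖mulOp ha.wmul_memLp x.fst‖ ‖x.snd‖
  have h5 : CaSq a c d x₁ x₂ / 4 * ‖x.fst‖ ^ 2 ≤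
      max 4 (CaSq a c d x₁ x₂) / 4 * ‖x.fst‖ ^ 2 := by
    gcongr
    exact le_max_right _ _
  have h6 : 1 * ‖x.snd‖ ^ 2 ≤ max 4 (CaSq a c d x₁ x₂) / 4 * ‖x.snd‖ ^ 2 := by
    gcongr
    rw [le_div_iff₀ (by norm_num), one_mul]
    exact le_max_left _ _
  linarith

theorem densityForm_le (ha : IsWeight a c d x₁ x₂) (x : WithLp 2 (L2 c d × L2 c d)) :
    densityForm ha x x ≤ (1 + kapMax a c d x₁ x₂) * ‖x‖ ^ 2 := by
  rw [densityForm_apply, norm_sq_state, ← norm_sq_L2]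
  have h1 : ∫ t in Ioo c d, qmul a c d t * (x.fst t * x.fst t) ≤
      (1 + kapMax a c d x₁ x₂) * ‖x.fst‖ ^ 2 := by
    rw [norm_sq_L2, ← integral_const_mul]
    refine integral_mono_ae (integrable_bdd_mul_mul ha.qmul_meas ha.qmul_le (L2.memLp _)
      (L2.memLp _)) (((L2.memLp _).integrable_mul (L2.memLp _)).const_mul _) ?_
    filter_upwards [ha.qmul_le] with t ht
    exact mul_le_mul_of_nonneg_right (abs_le.1 ht).2 (mul_self_nonneg _)
  have h2 := mul_nonneg ha.kapMax_nonneg (sq_nonneg ‖x.snd‖)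
  linarith

/-! ### Density of the domain -/

theorem IsWeight.hasWeakDerivOn_of_hasDerivAt (ha : IsWeight a c d x₁ x₂) {f g : ℝ → ℝ}
    (hf : ∀ x, HasDerivAt f (g x) x) (hg : Continuous g) : HasWeakDerivOn (Ioo c d) f g := by
  have hcd : c < d := ha.c_lt.trans ha.lt_d
  have hfc : Continuous f := continuous_iff_continuousAt.2 fun x => (hf x).continuousAt
  have := (IsPrimitive.of_hasDerivAt (e := c) (b := d) hfc.continuousOn (fun x _ => hf x)
    hg.continuousOn).hasWeakDerivOn hcd.ne (hg.continuousOn.locallyIntegrableOn measurableSet_Ioo)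
  rwa [uIoo_of_lt hcd] at this

theorem memLp_test {φ : ℝ → ℝ} (h1 : Continuous φ) (h2 : HasCompactSupport φ) :
    MemLp φ 2 (volume.restrict (Ioo c d)) :=
  (h1.memLp_of_hasCompactSupport h2).mono_measure Measure.restrict_le_self

theorem IsWeight.memH1a0_test (ha : IsWeight a c d x₁ x₂) {φ : ℝ → ℝ} {u : L2 c d}
    (h1 : ContDiff ℝ ∞ φ) (h2 : HasCompactSupport φ) (h3 : tsupport φ ⊆ Ioo c d)
    (hu : u =ᵐ[volume.restrict (Ioo c d)] φ) :
    MemH1a0 a c d u ∧ HasWeakDerivOn (Omega0 c d) u (deriv φ) := by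
  have hd := (contDiff_deriv h1).continuous
  have hw : HasWeakDerivOn (Omega0 c d) u (deriv φ) :=
    ((ha.hasWeakDerivOn_of_hasDerivAt (fun x => (h1.differentiable (by simp) x).hasDerivAt)
      hd).congr hu.symm EventuallyEq.rfl).mono sdiff_subset
  refine ⟨⟨deriv φ, hw, ?_, fun _ => φ, fun _ => ⟨h1, h2, h3⟩, ?_⟩, hw⟩
  · exact ((ha.cont.mul (hd.pow 2).continuousOn).integrableOn_Icc).mono_set Ioo_subset_Icc_self
  · have : ∫ x in Ioo c d, ((u x - φ x) ^ 2 + a x * (deriv φ x - deriv φ x) ^ 2) = 0 := by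
      rw [integral_congr_ae (g := fun _ => 0), integral_zero]
      filter_upwards [hu] with x hx
      simp [hx]
    simp only [this]
    exact tendsto_const_nhds

/-- The flux `q` is continuous across $1$. If its limit were $l\ne0$, then
$au_x^2=q^2/a\ge(l/2)^2/a$ near $1$, so $1/a$ would be integrable there, and away from $1$ it always
is. -/
theorem IsWeight.flux_tendsto_zero (ha : IsWeight a c d x₁ x₂) (hw : ¬ WeakDegeneration a c d)
    {u : ℝ → ℝ} (hi : IntegrableOn (fun x => a x * wderiv c d u x ^ 2) (Ioo c d))
    (hf : MemW12 c d (flux a c d u)) :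
    Tendsto (crep c d (flux a c d u)) (𝓝[<] 1) (𝓝 0) ∧
      Tendsto (crep c d (flux a c d u)) (𝓝[>] 1) (𝓝 0) := by
  obtain ⟨-, g, hg2, hg⟩ := hf
  obtain ⟨q1, q2, -, l, hl, hr⟩ := ha.crep_of_memLp hg hg2
  set q := crep c d (flux a c d u)
  suffices l = 0 by rw [this] at hl hr; exact ⟨hl, hr⟩
  by_contra hl0
  apply hw
  have hpos := abs_pos.2 hl0
  have he1 : ∀ᶠ x in 𝓝[<] (1 : ℝ), |l| / 2 < |q x| :=
    hl.abs.eventually_const_lt (by linarith)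
  have he2 : ∀ᶠ x in 𝓝[>] (1 : ℝ), |l| / 2 < |q x| :=
    hr.abs.eventually_const_lt (by linarith)
  obtain ⟨y, hy, hyq⟩ := mem_nhdsLT_iff_exists_Ioo_subset' ha.c_lt |>.1
    (he1.and (Ioo_mem_nhdsLT ha.c_lt))
  obtain ⟨z, hz, hzq⟩ := mem_nhdsGT_iff_exists_Ioo_subset' ha.lt_d |>.1
    (he2.and (Ioo_mem_nhdsGT ha.lt_d))
  obtain ⟨y', hy'⟩ := exists_between (mem_Iio.1 hy)
  obtain ⟨z', hz'⟩ := exists_between (mem_Ioi.1 hz)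
  have hy'c := (hyq hy').2
  have hz'd := (hzq hz').2
  have i1 := ha.intervalIntegrable_inv (.inl rfl) (x := y')
    (by rw [ha.side_left]; exact ⟨hy'c.1.le, hy'.2⟩)
  have i2 := ha.intervalIntegrable_inv (.inr rfl) (x := z')
    (by rw [ha.side_right]; exact ⟨hz'.1, hz'd.2.le⟩)
  rw [intervalIntegrable_iff, uIoc_of_le hy'c.1.le] at i1
  rw [intervalIntegrable_iff, uIoc_of_ge hz'd.2.le] at i2
  have hsub : Ioc y' z' ⊆ Ioo c d := fun x hx => ⟨hy'c.1.trans hx.1, hx.2.trans_lt hz'd.2⟩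
  have i3 : IntegrableOn (fun x => 1 / a x) (Ioc y' z') := by
    refine Integrable.mono' ((hi.mono_set hsub).const_mul ((|l| / 2) ^ 2)⁻¹) ?_ ?_
    · have : AEStronglyMeasurable (fun x => 1 / a x) (volume.restrict (Ioo c d)) :=
        aestronglyMeasurable_of_continuousOn (continuousOn_const.div ha.smooth.continuousOn
          fun x hx => (ha.pos x hx).ne')
      exact this.mono_measure (Measure.restrict_mono hsub le_rfl)
    · filter_upwards [ae_restrict_of_ae_restrict_of_subset hsub q2,
        ae_restrict_of_ae_restrict_of_subset hsub ha.ae_mem,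
        ae_restrict_mem measurableSet_Ioc] with x hx hax hxm
      have hq : |l| / 2 < |q x| := by
        rcases lt_or_gt_of_ne (mem_compl_singleton_iff.1 hax.1.2) with h | h
        · exact (hyq ⟨hy'.1.trans hxm.1, h⟩).1
        · exact (hzq ⟨h, hxm.2.trans_lt hz'.2⟩).1
      have hq2 : (|l| / 2) ^ 2 ≤ q x ^ 2 := by
        rw [← sq_abs (q x)]
        gcongr
      rw [← hx, flux] at hq2
      have hpa := hax.2
      rw [Real.norm_eq_abs, abs_of_pos (by positivity), inv_mul_eq_div, div_le_div_iff₀ hpa (by positivity)]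
      nlinarith
  refine ((i1.union i3).union i2).mono_set fun x hx => ?_
  rcases le_or_gt x y' with h | h
  · exact .inl (.inl ⟨hx.1, h⟩)
  · rcases le_or_gt x z' with h' | h'
    · exact .inl (.inr ⟨h, h'⟩)
    · exact .inr ⟨h', hx.2.le⟩

/-- `a` need not be differentiable at $1$, but $\varphi'$ vanishes near $1$, so $a\varphi'$ is $C^1$
with compact support. This is why the test functions are taken constant near $1$. -/
theorem IsWeight.memW12_flux_test (ha : IsWeight a c d x₁ x₂) {φ : ℝ → ℝ} {u : L2 c d}
    (h1 : ContDiff ℝ ∞ φ) (h2 : HasCompactSupport φ) (h4 : tsupport (deriv φ) ⊆ Omega0 c d)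
    (hu : HasWeakDerivOn (Omega0 c d) u (deriv φ)) : MemW12 c d (flux a c d u) := by
  set ψ := deriv φ with hψ
  have hψs : ContDiff ℝ ∞ ψ := contDiff_deriv h1
  have hψc : HasCompactSupport ψ := h2.deriv
  have hO := isOpen_Omega0 c d
  let f : ℝ → ℝ := fun x => a x * ψ x
  let f1 : ℝ → ℝ := fun x => wt' a c d x * ψ x + a x * deriv ψ x
  have hz : ∀ x, x ∉ tsupport ψ → ψ =ᶠ[𝓝 x] 0 := fun x hx =>
    notMem_tsupport_iff_eventuallyEq.1 hx
  have hfd : ∀ x, HasDerivAt f (f1 x) x := by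
    intro x
    by_cases hx : x ∈ tsupport ψ
    · exact (ha.hasDerivAt (h4 hx)).mul (hψs.differentiable (by simp) x).hasDerivAt
    · have e1 : f =ᶠ[𝓝 x] fun _ => 0 := by
        filter_upwards [hz x hx] with y hy
        simp [f, hy]
      have e2 : f1 x = 0 := by
        simp [f1, (hz x hx).eq_of_nhds, (hz x hx).deriv_eq]
      rw [e2]
      exact (hasDerivAt_const x (0 : ℝ)).congr_of_eventuallyEq e1
  have hf1c : Continuous f1 := by
    rw [continuous_iff_continuousAt]
    intro x
    by_cases hx : x ∈ tsupport ψ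
    · have hxO := h4 hx
      have hn : Icc c d \ {1} ∈ 𝓝 x := mem_of_superset (hO.mem_nhds hxO) (Omega0_subset c d)
      exact ((ha.continuousOn_wt'.continuousAt hn).mul hψs.continuous.continuousAt).add
        ((ha.hasDerivAt hxO).continuousAt.mul (contDiff_deriv hψs).continuous.continuousAt)
    · have e1 : f1 =ᶠ[𝓝 x] fun _ => 0 := by
        filter_upwards [hz x hx, (hz x hx).deriv] with y hy hy'
        rw [show (deriv (0 : ℝ → ℝ)) = 0 from deriv_zero] at hy'
        simp [f1, hy, hy']
      exact continuousAt_const.congr e1.symm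
  have hsf : Function.support f ⊆ tsupport ψ := fun x hx =>
    subset_tsupport _ (right_ne_zero_of_mul hx)
  have hsf1 : Function.support f1 ⊆ tsupport ψ := by
    intro x hx
    by_contra hcon
    exact hx (by simp [f1, (hz x hcon).eq_of_nhds, (hz x hcon).deriv_eq])
  have hfc : Continuous f := continuous_iff_continuousAt.2 fun x => (hfd x).continuousAt
  have hmf : MemLp f 2 (volume.restrict (Ioo c d)) :=
    memLp_test hfc (HasCompactSupport.of_support_subset_isCompact hψc hsf)
  have hmf1 : MemLp f1 2 (volume.restrict (Ioo c d)) :=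
    memLp_test hf1c (HasCompactSupport.of_support_subset_isCompact hψc hsf1)
  have hae : f =ᵐ[volume.restrict (Ioo c d)] flux a c d u := by
    filter_upwards [(wderiv_spec hu).2] with x hx
    simp [f, flux, hx]
  exact ⟨(memLp_congr_ae hae).1 hmf, f1, hmf1,
    (ha.hasWeakDerivOn_of_hasDerivAt hfd hf1c).congr hae EventuallyEq.rfl⟩

/-- If $1/a\in L^1$ the transmission conditions hold automatically in $W^2_a$. If not, all fluxes in
question tend to zero at $1$, while `φ` stays bounded there. -/
theorem IsWeight.inDomain_test (ha : IsWeight a c d x₁ x₂) {V : Submodule ℝ (L2 c d)}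
    (hVW : ∀ u ∈ V, MemW1a0 a c d u) {φ : ℝ → ℝ} {U : V × L2 c d}
    (h1 : ContDiff ℝ ∞ φ) (h2 : HasCompactSupport φ) (h3 : tsupport φ ⊆ Ioo c d)
    (h4 : tsupport (deriv φ) ⊆ Omega0 c d)
    (hu : (U.1 : L2 c d) =ᵐ[volume.restrict (Ioo c d)] φ) (hV : U.2 ∈ V) : InDomain a V U := by
  have hW := (hVW U.1 U.1.2).1
  have hF := ha.memW12_flux_test h1 h2 h4 (ha.memH1a0_test h1 h2 h3 hu).2
  refine ⟨⟨hW, hF⟩, hV, fun hw => ⟨(ha.crep_of_weak hw hW).1, ?_⟩, fun hw => ⟨?_, ?_⟩⟩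
  · obtain ⟨-, g, hg2, hg⟩ := hF
    exact (ha.crep_of_memLp hg hg2).2.2.2
  · rintro w ⟨⟨g, hg1, hg2, -⟩, hwF⟩
    have hwi : IntegrableOn (fun x => a x * wderiv c d w x ^ 2) (Ioo c d) := by
      refine Integrable.congr hg2 ?_
      filter_upwards [(wderiv_spec hg1).2] with x hx
      rw [hx]
    obtain ⟨k1, k2⟩ := ha.flux_tendsto_zero hw hwi hwF
    have hc := (crep_spec ha.c_lt ha.lt_d h1.continuous.continuousOn hu).2.2
    have hI : Icc c d ∈ 𝓝 (1 : ℝ) := Icc_mem_nhds ha.c_lt ha.lt_d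
    have hne : Tendsto (crep c d U.1) (𝓝[≠] 1) (𝓝 (φ 1)) := by
      refine ((h1.continuous.tendsto 1).mono_left nhdsWithin_le_nhds).congr' ?_
      filter_upwards [self_mem_nhdsWithin, nhdsWithin_le_nhds hI] with x hx hxI
      exact (hc ⟨hxI, hx⟩).symm
    have k3 := k1.mul (hne.mono_left (nhdsWithin_mono _ fun x hx => ne_of_lt hx))
    have k4 := k2.mul (hne.mono_left (nhdsWithin_mono _ fun x hx => ne_of_gt hx))
    rw [zero_mul] at k3 k4
    exact ⟨k3, k4⟩
  · exact ha.flux_tendsto_zero hw hW.spec.2.1 hF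

/-- Elements of `V` represented by a test function that is constant near `1`. -/
def testSpace {c d : ℝ} (V : Submodule ℝ (L2 c d)) : Submodule ℝ V where
  carrier := {u | ∃ φ : ℝ → ℝ, ContDiff ℝ ∞ φ ∧ HasCompactSupport φ ∧ tsupport φ ⊆ Ioo c d ∧
    tsupport (deriv φ) ⊆ Omega0 c d ∧ (u : L2 c d) =ᵐ[volume.restrict (Ioo c d)] φ}
  zero_mem' := ⟨0, contDiff_const, HasCompactSupport.zero, by simp [tsupport_eq_empty_iff.2],
    by
      rw [show deriv (0 : ℝ → ℝ) = 0 from deriv_zero, tsupport_eq_empty_iff.2 rfl]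
      exact empty_subset _, Lp.coeFn_zero _ _ _⟩
  add_mem' := by
    rintro u v ⟨φ, p1, p2, p3, p4, p5⟩ ⟨ψ, q1, q2, q3, q4, q5⟩
    refine ⟨φ + ψ, p1.add q1, p2.add q2, (tsupport_add φ ψ).trans (union_subset p3 q3), ?_, ?_⟩
    · have : deriv (φ + ψ) = deriv φ + deriv ψ := funext fun x =>
        deriv_add (p1.differentiable (by simp) x) (q1.differentiable (by simp) x)
      rw [this]
      exact (tsupport_add _ _).trans (union_subset p4 q4)
    · filter_upwards [Lp.coeFn_add (u : L2 c d) v, p5, q5] with x hx h5 h5'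
      rw [Submodule.coe_add, hx, Pi.add_apply, Pi.add_apply, h5, h5']
  smul_mem' := by
    rintro k u ⟨φ, p1, p2, p3, p4, p5⟩
    have hs : ∀ f : ℝ → ℝ, tsupport (k • f) ⊆ tsupport f := fun f =>
      closure_mono (Function.support_const_smul_subset k f)
    refine ⟨k • φ, p1.const_smul k, p2.mono (Function.support_const_smul_subset k φ),
      (hs φ).trans p3, ?_, ?_⟩
    · have : deriv (k • φ) = k • deriv φ := funext fun x =>
        deriv_const_smul k (p1.differentiable (by simp) x)
      rw [this]
      exact (hs _).trans p4
    · filter_upwards [Lp.coeFn_smul k (u : L2 c d), p5] with x hx h5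
      rw [Submodule.coe_smul, hx, Pi.smul_apply, Pi.smul_apply, h5]

/-- The orthogonality relations determine `w`: its second component is zero and $\sqrt a$ times its
first is a constant `C`. The pairing with any state is thus $C\int_\Omega u_x$. -/
theorem IsWeight.orthogonal_testSpace (ha : IsWeight a c d x₁ x₂) {V : Submodule ℝ (L2 c d)}
    (hHV : ∀ u : L2 c d, MemH1a0 a c d u → u ∈ V) (hVW : ∀ u ∈ V, MemW1a0 a c d u)
    {w : WithLp 2 (L2 c d × L2 c d)}
    (hw : ∀ U : V × L2 c d, U.1 ∈ testSpace V → U.2 ∈ V → inner ℝ (stateMap ha hVW U) w = 0)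
    (U : V × L2 c d) : inner ℝ (stateMap ha hVW U) w = 0 := by
  have hcd : c < d := ha.c_lt.trans ha.lt_d
  have hin : ∀ U : V × L2 c d, inner ℝ (stateMap ha hVW U) w =
      (∫ x in Ioo c d, √(a x) * wderiv c d (U.1 : L2 c d) x * w.fst x) +
        ∫ x in Ioo c d, U.2 x * w.snd x := by
    intro U
    rw [WithLp.prod_inner_apply, inner_L2, inner_L2]
    congr 1
    refine integral_congr_ae ?_
    filter_upwards [stateMap_fst ha hVW U] with x hx
    exact congrArg (· * w.fst x) hx
  have hsnd : ∀ᵐ x, x ∈ Ioo c d → w.snd x = 0 := by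
    have hwi : IntegrableOn w.snd (Ioo c d) := (L2.memLp w.snd).integrable (by norm_num)
    refine isOpen_Ioo.ae_eq_zero_of_integral_contDiff_smul_eq_zero hwi.locallyIntegrableOn
      fun φ h1 h2 h3 => ?_
    have hm : MemLp φ 2 (volume.restrict (Ioo c d)) := memLp_test h1.continuous h2
    have hV : hm.toLp φ ∈ V := hHV _ (ha.memH1a0_test h1 h2 h3 hm.coeFn_toLp).1
    have h0 := hw (0, hm.toLp φ) (zero_mem _) hV
    rw [WithLp.prod_inner_apply] at h0
    have e0 : (stateMap ha hVW (0, hm.toLp φ)).ofLp.1 = 0 := map_zero (sqrtDeriv ha hVW)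
    rw [e0, inner_zero_left, zero_add, inner_L2] at h0
    rw [← setIntegral_eq_integral_of_forall_compl_eq_zero (s := Ioo c d), ← h0]
    · refine integral_congr_ae ?_
      filter_upwards [hm.coeFn_toLp] with x hx
      exact congrArg (· * w.snd x) hx.symm
    · intro x hx
      rw [image_eq_zero_of_notMem_tsupport fun h => hx (h3 h), zero_smul]
  -- The mean-zero condition is imposed on $\Omega$ as a whole, so `ψ` may have opposite nonzero
  -- means on the two sides of $1$. This yields the same constant on both; the primitive `φ` is then
  -- constant, possibly nonzero, near $1$.
  obtain ⟨C, hC⟩ : ∃ C, ∀ᵐ x, x ∈ Omega0 c d → √(a x) * w.fst x = C := by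
    refine ae_const_of_integral_test_eq_zero (isOpen_Omega0 c d) ?_ fun ψ h1 h2 h3 h0 => ?_
    · have hwi : IntegrableOn w.fst (Ioo c d) := (L2.memLp w.fst).integrable (by norm_num)
      have := hwi.locallyIntegrableOn.continuousOn_mul (ha.cont.mono Ioo_subset_Icc_self).sqrt
        isOpen_Ioo.isLocallyClosed
      exact this.mono_set sdiff_subset
    · obtain ⟨φ, k1, k2, k3, rfl⟩ := exists_test_primitive hcd h1 h2 (h3.trans sdiff_subset) h0
      have hm : MemLp φ 2 (volume.restrict (Ioo c d)) := memLp_test k1.continuous k2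
      obtain ⟨hH, hwd⟩ := ha.memH1a0_test k1 k2 k3 hm.coeFn_toLp
      have h0 := hw (⟨hm.toLp φ, hHV _ hH⟩, 0) ⟨φ, k1, k2, k3, h3, hm.coeFn_toLp⟩ V.zero_mem
      rw [hin] at h0
      have e1 : ∫ x in Ioo c d, (0 : L2 c d) x * w.snd x = 0 := by
        rw [← inner_L2, inner_zero_left]
      rw [e1, add_zero] at h0
      rw [← setIntegral_eq_integral_of_forall_compl_eq_zero (s := Ioo c d), ← h0]
      · refine integral_congr_ae ?_
        filter_upwards [(wderiv_spec hwd).2] with x hx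
        rw [hx]
        ring
      · intro x hx
        rw [image_eq_zero_of_notMem_tsupport fun h => hx (sdiff_subset (h3 h)), mul_zero]
  have hC' : ∀ᵐ x ∂(volume.restrict (Ioo c d)), √(a x) * w.fst x = C := by
    have := (ae_restrict_iff' (μ := volume) (isOpen_Omega0 c d).measurableSet).2 hC
    rwa [restrict_Omega0] at this
  have e1 : ∫ x in Ioo c d, U.2 x * w.snd x = 0 := by
    rw [integral_congr_ae (g := fun _ => 0), integral_zero]
    have := (ae_restrict_iff' (μ := volume) measurableSet_Ioo).2 hsnd
    filter_upwards [this] with x hx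
    rw [hx, mul_zero]
  have e2 : ∫ x in Ioo c d, √(a x) * wderiv c d (U.1 : L2 c d) x * w.fst x =
      C * ∫ x in Ioo c d, wderiv c d (U.1 : L2 c d) x := by
    rw [← integral_const_mul]
    refine integral_congr_ae ?_
    filter_upwards [hC'] with x hx
    rw [← hx]; ring
  rw [hin, e1, e2, add_zero]
  obtain ⟨hU1, hUc, hUd⟩ := hVW U.1 U.1.2
  -- If $1/a\in L^1$, then $\int u_x=u(d)-u(c)=0$. Otherwise $C\ne0$ would make $1/a=C^{-2}w_1^2$
  -- integrable, where $w_1$ is the first component.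
  by_cases hwk : WeakDegeneration a c d
  · rw [← (ha.crep_of_weak hwk hU1).2, hUc, hUd]
    simp
  · suffices C = 0 by rw [this, zero_mul]
    by_contra hC0
    apply hwk
    have := ((L2.memLp w.fst).integrable_sq).const_mul (C ^ 2)⁻¹
    refine Integrable.congr this ?_
    filter_upwards [hC', ha.ae_mem] with x hx hax
    have h1 := Real.sq_sqrt hax.2.le
    have h2 := hax.2.ne'
    rw [← hx] at hC0 ⊢
    have h3 : w.fst x ≠ 0 := right_ne_zero_of_mul hC0
    rw [mul_pow, h1]
    field_simp

/-- In the complete space $L^2\times L^2$ the closure of a subspace is its double orthogonal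
complement. Completeness of `V` is not needed, because only images under `stateMap` are compared. -/
theorem IsWeight.dense_domain (ha : IsWeight a c d x₁ x₂) {V : Submodule ℝ (L2 c d)}
    (hHV : ∀ u : L2 c d, MemH1a0 a c d u → u ∈ V) (hVW : ∀ u ∈ V, MemW1a0 a c d u)
    (U : V × L2 c d) : ∃ u : ℕ → V × L2 c d, (∀ k, InDomain a V (u k)) ∧
      Tendsto (fun k => stateMap ha hVW (u k)) atTop (𝓝 (stateMap ha hVW U)) := by
  set K := ((testSpace V).prod V).map (stateMap ha hVW) with hK
  have hmem : stateMap ha hVW U ∈ K.topologicalClosure := by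
    rw [← Submodule.orthogonal_orthogonal_eq_closure, Submodule.mem_orthogonal]
    intro w hw
    rw [real_inner_comm]
    refine ha.orthogonal_testSpace hHV hVW (fun W h1 h2 => ?_) U
    exact (Submodule.mem_orthogonal _ _).1 hw _ ⟨W, ⟨h1, h2⟩, rfl⟩
  obtain ⟨x, hx, hxt⟩ := mem_closure_iff_seq_limit.1 hmem
  choose u hu hux using hx
  refine ⟨u, fun k => ?_, by simpa only [hux] using hxt⟩
  obtain ⟨⟨φ, h1, h2, h3, h4, h5⟩, hV⟩ := hu k
  exact ha.inDomain_test hVW h1 h2 h3 h4 h5 hV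

/-! ### The wave semigroup -/

theorem inDomain_iff {V : Submodule ℝ (L2 c d)} (U : V × L2 c d) :
    InDomain a V U ↔ ∃ F, IsA a V U F := by
  refine ⟨fun h => ?_, fun ⟨F, hF⟩ => hF.1⟩
  obtain ⟨-, g, hg2, hg⟩ := h.1.2
  exact ⟨(⟨U.2, h.2.1⟩, hg2.toLp g), h, rfl, hg.congr EventuallyEq.rfl hg2.coeFn_toLp.symm⟩

theorem IsWeight.crep_wderiv_spec (ha : IsWeight a c d x₁ x₂) {u : L2 c d} (hu : MemW2a a c d u) :
    ContinuousOn (crep c d (wderiv c d u)) (Icc c d \ {1}) ∧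
      wderiv c d u =ᵐ[volume.restrict (Ioo c d)] crep c d (wderiv c d u) := by
  obtain ⟨-, g, hg2, hg⟩ := hu.2
  obtain ⟨q1, q2, -, -⟩ := ha.crep_of_memLp hg hg2
  have hq := q1.div ha.smooth.continuousOn fun x hx => (ha.pos x hx).ne'
  have h := crep_spec ha.c_lt ha.lt_d (f := wderiv c d u) hq (by
    filter_upwards [q2, ha.ae_mem] with x hx hax
    have := hax.2.ne'
    rw [Pi.div_apply, ← hx, flux]
    field_simp)
  exact ⟨h.1, h.2.1⟩

/-- The continuous representatives of the two derivatives may be subtracted, and `crep_spec`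
identifies the difference up to the endpoints. -/
theorem IsWeight.normalDeriv_sub (ha : IsWeight a c d x₁ x₂) {u w : L2 c d}
    (hu : MemW2a a c d u) (hw : MemW2a a c d w) {e : ℝ} (he : e = c ∨ e = d) :
    normalDeriv (u - w) e = normalDeriv u e - normalDeriv w e := by
  obtain ⟨u1, u2⟩ := ha.crep_wderiv_spec hu
  obtain ⟨w1, w2⟩ := ha.crep_wderiv_spec hw
  refine (crep_spec ha.c_lt ha.lt_d (u1.sub w1) ?_).2.2
    (ha.side_subset he (left_mem_side (ha.ne_one he)))
  have hsub : HasWeakDerivOn (Omega0 c d) (u - w : L2 c d)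
      (fun x => wderiv c d u x + (-1) * wderiv c d w x) := by
    refine (hu.1.spec.1.add (hw.1.spec.1.const_mul (-1))).congr ?_ EventuallyEq.rfl
    rw [restrict_Omega0]
    filter_upwards [Lp.coeFn_sub u w] with x hx
    rw [hx, Pi.sub_apply]
    ring
  filter_upwards [(wderiv_spec hsub).2, u2, w2] with x h1 h2 h3
  rw [h1, Pi.sub_apply, ← h2, ← h3]
  ring

/-- Here $B(x,y)=2\int\frac{x-1}{\sqrt a}x_1y_2$: `B (J F) (J U)` is the term with $v_xv$ and `B (J
U) (J F)` the one with $u_x(au_x)_x$. -/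
theorem observedSemigroup (ha : IsWeight a c d x₁ x₂) {V : Submodule ℝ (L2 c d)}
    (hHV : ∀ u : L2 c d, MemH1a0 a c d u → u ∈ V) (hVW : ∀ u ∈ V, MemW1a0 a c d u)
    {S : ℝ → (V × L2 c d) →ₗ[ℝ] (V × L2 c d)} (hS : IsSemigroupOf a V S) :
    ObservedSemigroup (stateMap ha hVW) S (IsA a V) (InDomain a V)
      (fun U => normalDeriv (U.1 : L2 c d) c) (fun U => normalDeriv (U.1 : L2 c d) d)
      ((1 - c) * a c) ((d - 1) * a d) (crossForm ha) (densityForm ha) where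
  zero := hS.zero
  add := hS.add
  bounded t ht := by
    obtain ⟨M, hM⟩ := hS.bounded t ht
    exact ⟨M, fun U => by rw [← haNorm_eq, ← haNorm_eq]; exact hM U⟩
  cont U t₀ ht₀ := by
    rw [ContinuousWithinAt, tendsto_iff_norm_sub_tendsto_zero]
    refine (hS.cont U t₀ ht₀).congr fun t => ?_
    rw [haNorm_eq ha hVW, map_sub]
  generator U F := by
    rw [hS.generator]
    refine Iff.trans ?_ tendsto_iff_norm_sub_tendsto_zero.symm
    refine tendsto_congr fun h => ?_
    rw [haNorm_eq ha hVW, map_sub, map_smul, map_sub]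
  domain := inDomain_iff
  skew U F h := by
    obtain ⟨⟨hW, hV, hT⟩, hF1, hF2⟩ := h
    have hv := hVW F.1 F.1.2
    have key := ha.skew hW.1 hv hT hF2
    have i1 := (ha.memLp_sqrt_mul_wderiv hW.1).integrable_mul (ha.memLp_sqrt_mul_wderiv hv.1)
    have i2 := (L2.memLp (F.1 : L2 c d)).integrable_mul (L2.memLp F.2)
    rw [← key, WithLp.prod_inner_apply, inner_L2, inner_L2]
    refine Eq.trans ?_ (integral_add i1 i2).symm
    congr 1
    · refine integral_congr_ae ?_
      filter_upwards [stateMap_fst ha hVW U, stateMap_fst ha hVW F] with x hx hy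
      exact congrArg₂ (· * ·) hx hy
    · rw [hF1]; rfl
  p_sub U W hU hW := ha.normalDeriv_sub hU.1 hW.1 (.inl rfl)
  q_sub U W hU hW := ha.normalDeriv_sub hU.1 hW.1 (.inr rfl)
  α_pos := mul_pos (by linarith [ha.c_lt])
    (ha.pos c (ha.side_subset (.inl rfl) (left_mem_side ha.c_lt.ne)))
  β_pos := mul_pos (by linarith [ha.lt_d])
    (ha.pos d (ha.side_subset (.inr rfl) (left_mem_side ha.lt_d.ne')))
  multiplier U F h := by
    obtain ⟨⟨hW, hV, hT⟩, hF1, hF2⟩ := h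
    rw [ha.multiplier hW.1 (hVW F.1 F.1.2) hF2, crossForm_apply, crossForm_apply,
      densityForm_apply, stateMap_snd, stateMap_snd, hF1]
    congr 2
    · congr 1
      refine integral_congr_ae ?_
      filter_upwards [stateMap_fst ha hVW F] with x hx
      rw [hx, hF1]
    · congr 1
      refine integral_congr_ae ?_
      filter_upwards [stateMap_fst ha hVW U] with x hx
      rw [hx]
    · refine integral_congr_ae ?_
      filter_upwards [stateMap_fst ha hVW U] with x hx
      rw [hx]
  dense := ha.dense_domain hHV hVW

theorem crossForm_stateMap (ha : IsWeight a c d x₁ x₂) {V : Submodule ℝ (L2 c d)}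
    (hVW : ∀ u ∈ V, MemW1a0 a c d u) (U : V × L2 c d) :
    crossForm ha (stateMap ha hVW U) (stateMap ha hVW U) =
      2 * ∫ x in Omega0 c d, (x - 1) * wderiv c d (U.1 : L2 c d) x * U.2 x := by
  rw [crossForm_apply, restrict_Omega0, stateMap_snd]
  congr 1
  refine integral_congr_ae ?_
  filter_upwards [stateMap_fst ha hVW U, ha.ae_mem] with x hx hax
  rw [hx, wmul]
  have := Real.sqrt_pos.2 hax.2
  field_simp

theorem densityForm_stateMap (ha : IsWeight a c d x₁ x₂) {V : Submodule ℝ (L2 c d)}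
    (hVW : ∀ u ∈ V, MemW1a0 a c d u) (U : V × L2 c d) :
    densityForm ha (stateMap ha hVW U) (stateMap ha hVW U) =
      ∫ x in Omega0 c d, (U.2 x ^ 2 + (1 - (x - 1) * wt' a c d x / a x) *
        (a x * wderiv c d (U.1 : L2 c d) x ^ 2)) := by
  have hi : Integrable (fun t => U.2 t * U.2 t) (volume.restrict (Ioo c d)) :=
    (L2.memLp _).integrable_mul (L2.memLp _)
  rw [densityForm_apply, restrict_Omega0, stateMap_snd, ← integral_add hi
    (integrable_bdd_mul_mul ha.qmul_meas ha.qmul_le (L2.memLp _) (L2.memLp _))]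
  refine integral_congr_ae ?_
  filter_upwards [stateMap_fst ha hVW U, ha.ae_mem] with x hx hax
  rw [hx, qmul]
  have := Real.mul_self_sqrt hax.2.le
  linear_combination (1 - (x - 1) * wt' a c d x / a x) * wderiv c d (U.1 : L2 c d) x ^ 2 * this

end DegenerateWave

end

/-! ### Traces, bounds and multiplier identity for mild solutions -/

theorem lemma3p1 (a : ℝ → ℝ) (c d x₁ x₂ : ℝ) (ha : IsWeight a c d x₁ x₂)
    (V : Submodule ℝ (L2 c d))
    (hHV : ∀ u : L2 c d, MemH1a0 a c d u → u ∈ V)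
    (hVW : ∀ u ∈ V, MemW1a0 a c d u)
    (S : ℝ → (V × L2 c d) →ₗ[ℝ] (V × L2 c d)) (hS : IsSemigroupOf a V S)
    (U₀ : V × L2 c d) (y : ℝ → V) (yt : ℝ → L2 c d) (hy : IsMildSolution V S U₀ y yt) :
    ∃ yxc yxd : ℝ → ℝ, ∀ T : ℝ, 0 < T →
      IsBoundaryDeriv a V S U₀ c T yxc ∧ IsBoundaryDeriv a V S U₀ d T yxd ∧
      MemLp yxc 2 (volume.restrict (Ioo 0 T)) ∧ MemLp yxd 2 (volume.restrict (Ioo 0 T)) ∧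
      a c * (∫ t in (0 : ℝ)..T, yxc t ^ 2) ≤
        1 / (1 - c) * (max 4 (CaSq a c d x₁ x₂) + 2 * T +
          2 * T * max (kappa1 a c d x₁ * mu1 a c d x₁) (kappa2 a c d x₂ * mu2 a c d x₂)) *
          energy a c d (y 0) (yt 0) ∧
      a d * (∫ t in (0 : ℝ)..T, yxd t ^ 2) ≤
        1 / (d - 1) * (max 4 (CaSq a c d x₁ x₂) + 2 * T +
          2 * T * max (kappa1 a c d x₁ * mu1 a c d x₁) (kappa2 a c d x₂ * mu2 a c d x₂)) *
          energy a c d (y 0) (yt 0) ∧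
      (1 - c) * a c * (∫ t in (0 : ℝ)..T, yxc t ^ 2) +
          (d - 1) * a d * (∫ t in (0 : ℝ)..T, yxd t ^ 2) =
        2 * ((∫ x in Omega0 c d, (x - 1) * wderiv c d (y T : L2 c d) x * yt T x) -
            ∫ x in Omega0 c d, (x - 1) * wderiv c d (y 0 : L2 c d) x * yt 0 x) +
          ∫ t in (0 : ℝ)..T, ∫ x in Omega0 c d,
            (yt t x ^ 2 + (1 - (x - 1) * wt' a c d x / a x) *
              (a x * wderiv c d (y t : L2 c d) x ^ 2)) := by
  have hO := observedSemigroup ha hHV hVW hS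
  obtain ⟨f, g, hfg⟩ := hO.exists_traces (abs_crossForm_le ha) (densityForm_le ha) U₀
  have hstate : ∀ t, 0 ≤ t → S t U₀ = (y t, yt t) := fun t ht => (hy t ht).1.symm
  have hS0 : S 0 U₀ = U₀ := by rw [hS.zero]; rfl
  have hU₀ : U₀ = (y 0, yt 0) := by rw [← hstate 0 le_rfl, hS0]
  have hconv : ∀ u : ℕ → V × L2 c d,
      Tendsto (fun k => haNorm a c d (u k - U₀).1 (u k - U₀).2) atTop (𝓝 0) ↔
      Tendsto (fun k => stateMap ha hVW (u k)) atTop (𝓝 (stateMap ha hVW U₀)) := by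
    intro u
    refine Iff.trans ?_ tendsto_iff_norm_sub_tendsto_zero.symm
    refine tendsto_congr fun k => ?_
    rw [haNorm_eq ha hVW, map_sub]
  obtain ⟨u₀, hu₀D, hu₀⟩ := hO.dense U₀
  have happrox : ∃ u : ℕ → V × L2 c d, (∀ k, InDomain a V (u k)) ∧
      Tendsto (fun k => haNorm a c d (u k - U₀).1 (u k - U₀).2) atTop (𝓝 0) :=
    ⟨u₀, hu₀D, (hconv u₀).2 hu₀⟩
  refine ⟨f, g, fun T hT => ?_⟩
  obtain ⟨hf, hg, hpf, hqg, hid⟩ := hfg T hT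
  have hle := hO.multiplier_le (abs_crossForm_le ha) (densityForm_le ha) U₀ hT.le
  rw [← hid] at hle
  -- The cross form is counted at times $0$ and $T$, each with constant $\max\{4,C_a^2\}/4$. Since
  -- $\|J U_0\|^2=2E_y(0)$, every coefficient is then doubled.
  have hE : (2 * (max 4 (CaSq a c d x₁ x₂) / 4) + T * (1 + kapMax a c d x₁ x₂)) *
      ‖stateMap ha hVW U₀‖ ^ 2 = (max 4 (CaSq a c d x₁ x₂) + 2 * T +
        2 * T * kapMax a c d x₁ x₂) * energy a c d (y 0) (yt 0) := by
    have := energy_eq ha hVW (y 0, yt 0)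
    rw [this, ← hU₀]
    ring
  rw [hE] at hle
  have hc1 : 0 < 1 - c := by linarith [ha.c_lt]
  have hd1 : 0 < d - 1 := by linarith [ha.lt_d]
  -- Each of the two bounds drops the nonnegative boundary term of the opposite endpoint.
  have hf0 : 0 ≤ (1 - c) * a c * ∫ t in (0 : ℝ)..T, f t ^ 2 :=
    mul_nonneg hO.α_pos.le (intervalIntegral.integral_nonneg hT.le fun t _ => sq_nonneg _)
  have hg0 : 0 ≤ (d - 1) * a d * ∫ t in (0 : ℝ)..T, g t ^ 2 :=
    mul_nonneg hO.β_pos.le (intervalIntegral.integral_nonneg hT.le fun t _ => sq_nonneg _)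
  refine ⟨⟨happrox, fun u hu hu' => hpf u hu ((hconv u).1 hu')⟩,
    ⟨happrox, fun u hu hu' => hqg u hu ((hconv u).1 hu')⟩, hf, hg, ?_, ?_, ?_⟩
  · rw [one_div, inv_mul_eq_div, div_mul_eq_mul_div, le_div_iff₀ hc1]
    refine le_trans ?_ hle
    linarith
  · rw [one_div, inv_mul_eq_div, div_mul_eq_mul_div, le_div_iff₀ hd1]
    refine le_trans ?_ hle
    linarith
  · rw [hid, crossForm_stateMap, crossForm_stateMap, hstate T hT.le, mul_sub]
    congr 1
    · rw [hU₀]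
    · refine intervalIntegral.integral_congr fun t ht => ?_
      rw [uIcc_of_le hT.le] at ht
      rw [densityForm_stateMap, hstate t ht.1]
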